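/- **Setting.** Let $K$ be a field, $V$ a finite-dimensional $K$-vector space of dimension $\ell$, $S=S(V^*)$ with its standard grading, and $\operatorname{Der}(S)$ the $S$-module of $K$-derivations of $S$. A derivation $\theta$ has polynomial degree $p$ if $\theta(\alpha)$ is $0$ or homogeneous of degree $p$ for all $\alpha\in V^*$. An arrangement $\mathcal A$ in $V$ is a finite set of linear hyperplanes $H=\ker\alpha_H$ of $V$. For a subspace $X\subseteq V$ put $\mathcal A_X=\{H\in\mathcal A\mid X\subseteq H\}$ and $\mathcal A^X=\{X\cap H\mid H\in\mathcal A\setminus\mathcal A_X\}$, an arrangement in $X$. A multiarrangement $(\mathcal A,\mu)$ is an arrangement $\mathcal A$ with a multiplicity $\mu(H)\in\mathbb Z_{\geq 1}$ for each $H\in\mathcal A$. Put $$D(\mathcal A,\mu)=\{\theta\in\operatorname{Der}(S)\mid \theta(\alpha_H)\in\alpha_H^{\mu(H)}S\ \text{ for all } H\in\mathcal A\},\qquad D(\mathcal A)=D(\mathcal A,1).$$ If $D(\mathcal A,\mu)$ is a free $S$-module, it has a basis of $\ell$ homogeneous derivations; the multiset of their polynomial degrees is $\exp(\mathcal A,\mu)$,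 and $\exp\mathcal A=\exp(\mathcal A,1)$. The class of *inductively free arrangements* is the smallest class of arrangements that contains the empty arrangement in every finite-dimensional space, and contains $\mathcal A$ whenever for some $H\in\mathcal A$ it contains $\mathcal A'=\mathcal A\setminus\{H\}$ and $\mathcal A''=\mathcal A^{H}$ and $\exp\mathcal A''\subseteq\exp\mathcal A'$ as multisets. For a multiarrangement $(\mathcal A,\mu)$ and $H\in\mathcal A$, the deletion $(\mathcal A',\mu')$ is obtained by lowering $\mu(H)$ by one (removing $H$ if $\mu(H)=1$). The restriction is $(\mathcal A^{H},\mu^*)$ with the Euler multiplicity $\mu^*$: for $Y\in\mathcal A^{H}$ the module $D(\mathcal A_Y,\mu|_{\mathcal A_Y})$ has a homogeneous basis $\theta_Y,\psi_Y,D_3,\dots,D_\ell$ with $D_3,\dots,D_\ell$ of polynomial degree $0$, $\theta_Y\notin\alpha_{H}\operatorname{Der}(S)$ and $\psi_Y\in\alpha_{H}\operatorname{Der}(S)$, and $\mu^*(Y)$ is the polynomial degree of $\theta_Y$. The class of *inductively free multiarrangements* is the smallest class of multiarrangements that contains the empty one in every finite-dimensional space, and contains $(\mathcal A,\mu)$ whenever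 for some $H\in\mathcal A$ it contains $(\mathcal A',\mu')$ and $(\mathcal A^{H},\mu^*)$ and $\exp(\mathcal A^{H},\mu^*)\subseteq\exp(\mathcal A',\mu')$ as multisets. For $H_0\in\mathcal A$, the *Ziegler restriction* of $\mathcal A$ on $H_0$ is the multiarrangement $(\mathcal A^{H_0},\kappa)$ in $H_0$ with $\kappa(Y)=|\mathcal A_Y|-1$ for $Y\in\mathcal A^{H_0}$. **Theorem.** If $\mathcal A$ is an inductively free arrangement in $V$, then for every $H_0\in\mathcal A$ the Ziegler restriction $(\mathcal A^{H_0},\kappa)$ is an inductively free multiarrangement. -/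

import Mathlib

open Module

universe u v

noncomputable section

namespace HypArr

/-! ### Polynomial functions and derivations -/

section Derivations

variable (K : Type u) [Field K] (V : Type v) [AddCommGroup V] [Module K V]

/-- The symmetric algebra `S = S(V*)` of the dual space of `V`. -/
abbrev CoordRing : Type (max u v) := SymmetricAlgebra K (Dual K V)

/-- The `S`-module `Der(S)` of `K`-derivations of `S = S(V*)`. -/
abbrev Der : Type (max u v) := Derivation K (CoordRing K V) (CoordRing K V)

variable {K V}

/-- A linear form on `V`, regarded as an element of `S = S(V*)`. -/
abbrev lin (α : Dual K V) : CoordRing K V := SymmetricAlgebra.ι K (Dual K V) α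

variable (K V) in
/-- The space `S_p` of homogeneous polynomials of degree `p` (along with `0`): the `p`-th power of
the space of linear forms inside `S`. -/
def homogPart (p : ℕ) : Submodule K (CoordRing K V) :=
  LinearMap.range (SymmetricAlgebra.ι K (Dual K V)) ^ p

/-- `θ` is homogeneous of polynomial degree `p`: all values of `θ` on linear forms lie in `S_p`
(equivalently, all coefficients `θ(x_i)` of `θ` with respect to a basis `x_i` of `V*` do). -/
def HasPdeg (θ : Der K V) (p : ℕ) : Prop :=
  ∀ α : Dual K V, θ (lin α) ∈ homogPart K V p

/-- The submodule `D` of `Der(S)` is free with multiset of exponents `E`: it has a basis of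
`dim V` homogeneous derivations whose polynomial degrees form the multiset `E`. -/
def HasExponents (D : Submodule (CoordRing K V) (Der K V)) (E : Multiset ℕ) : Prop :=
  ∃ (b : Basis (Fin (finrank K V)) (CoordRing K V) D) (d : Fin (finrank K V) → ℕ),
    (∀ i, HasPdeg (b i : Der K V) (d i)) ∧ E = Finset.univ.val.map d

end Derivations

/-- A (linear) hyperplane of `V`: the kernel of a non-zero linear form. -/
def IsHyperplane {K : Type u} [Field K] {V : Type v} [AddCommGroup V] [Module K V]
    (H : Submodule K V) : Prop :=
  ∃ α : Dual K V, α ≠ 0 ∧ LinearMap.ker α = H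

/-! ### Simple arrangements -/

/-- A hyperplane arrangement in `V`: a finite set of linear hyperplanes of `V`. -/
@[ext]
structure Arrangement (K : Type u) [Field K] (V : Type v) [AddCommGroup V] [Module K V] where
  /-- The hyperplanes of the arrangement. -/
  hyps : Finset (Submodule K V)
  /-- All members are hyperplanes. -/
  isHyperplane : ∀ H ∈ hyps, IsHyperplane H

namespace Arrangement

variable {K : Type u} [Field K] {V : Type v} [AddCommGroup V] [Module K V]

variable (K V) in
/-- The empty arrangement in `V`. -/
def empty : Arrangement K V where
  hyps := ∅
  isHyperplane := by simp

open scoped Classical in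
/-- The localization `𝒜_X`: the members of `𝒜` that contain `X`. -/
def localization (A : Arrangement K V) (X : Submodule K V) : Arrangement K V where
  hyps := A.hyps.filter fun H => X ≤ H
  isHyperplane := fun H hH => A.isHyperplane H (Finset.mem_filter.mp hH).1

open scoped Classical in
/-- The deletion `𝒜' = 𝒜 \ {H₀}`. -/
def deletion (A : Arrangement K V) (H₀ : Submodule K V) : Arrangement K V where
  hyps := A.hyps.erase H₀
  isHyperplane := fun H hH => A.isHyperplane H (Finset.mem_of_mem_erase hH)

open scoped Classical in
/-- The restriction `𝒜^X = {X ∩ H | H ∈ 𝒜 \ 𝒜_X}`, an arrangement in `X`. Here `X ∩ H` is written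
as the preimage of `H` under the inclusion of `X` into `V`. -/
def restriction (A : Arrangement K V) (X : Submodule K V) : Arrangement K X where
  hyps := (A.hyps.filter fun H => ¬ X ≤ H).image fun H => H.comap X.subtype
  isHyperplane := by
    intro Y hY
    obtain ⟨H, hH, rfl⟩ := Finset.mem_image.mp hY
    obtain ⟨hHA, hXH⟩ := Finset.mem_filter.mp hH
    obtain ⟨α, -, rfl⟩ := A.isHyperplane H hHA
    refine ⟨α ∘ₗ X.subtype, fun h0 => hXH fun x hx => ?_, LinearMap.ker_comp _ _⟩
    exact LinearMap.congr_fun h0 (⟨x, hx⟩ : X)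

/-- The module `D(𝒜) = {θ ∈ Der(S) | θ(α_H) ∈ α_H S for all H ∈ 𝒜}`. The condition does not depend
on the choice of the defining forms `α_H`, and is imposed for all of them. -/
def derModule (A : Arrangement K V) : Submodule (CoordRing K V) (Der K V) where
  carrier := {θ | ∀ H ∈ A.hyps, ∀ α : Dual K V, LinearMap.ker α = H → lin α ∣ θ (lin α)}
  add_mem' := fun hθ hη H hH α hα => by
    simpa using dvd_add (hθ H hH α hα) (hη H hH α hα)
  zero_mem' := fun H _ α _ => by simp
  smul_mem' := fun f θ hθ H hH α hα => by
    simpa using Dvd.dvd.mul_left (hθ H hH α hα) f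

end Arrangement

/-- The class of inductively free arrangements: the smallest class of arrangements (in all
finite-dimensional vector spaces) that contains all empty arrangements, and contains `𝒜` as soon as
for some `H₀ ∈ 𝒜` it contains `𝒜' = 𝒜 \ {H₀}` and `𝒜'' = 𝒜^{H₀}`, and `exp 𝒜'' ⊆ exp 𝒜'`
(as multisets). -/
inductive IsInductivelyFree (K : Type u) [Field K] :
    ∀ (V : Type v) [AddCommGroup V] [Module K V], Arrangement K V → Prop
  | empty (V : Type v) [AddCommGroup V] [Module K V] [FiniteDimensional K V] :
      IsInductivelyFree K V (Arrangement.empty K V)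
  | add (V : Type v) [AddCommGroup V] [Module K V] [FiniteDimensional K V]
      (A : Arrangement K V) (H₀ : Submodule K V) (hH₀ : H₀ ∈ A.hyps)
      (hdel : IsInductivelyFree K V (A.deletion H₀))
      (hres : IsInductivelyFree K H₀ (A.restriction H₀))
      (E' E'' : Multiset ℕ)
      (hE' : HasExponents (A.deletion H₀).derModule E')
      (hE'' : HasExponents (A.restriction H₀).derModule E'')
      (hE : E'' ≤ E') :
      IsInductivelyFree K V A

/-! ### Multiarrangements -/

/-- A multiarrangement `(𝒜, μ)` in `V`. It is given by the multiplicity function `μ`, extended by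
zero to all subspaces of `V`; the underlying arrangement `𝒜` is the support of `μ`, i.e. a
hyperplane of multiplicity zero is the same as a hyperplane that is absent. -/
@[ext]
structure Multiarrangement (K : Type u) [Field K] (V : Type v) [AddCommGroup V]
    [Module K V] where
  /-- The multiplicity function. -/
  mult : Submodule K V →₀ ℕ
  /-- All subspaces of positive multiplicity are hyperplanes. -/
  isHyperplane : ∀ H ∈ mult.support, IsHyperplane H

namespace Multiarrangement

variable {K : Type u} [Field K] {V : Type v} [AddCommGroup V] [Module K V]

variable (K V) in
/-- The empty multiarrangement in `V`. -/
def empty : Multiarrangement K V where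
  mult := 0
  isHyperplane := by simp

/-- The simple arrangement underlying a multiarrangement. -/
def toArrangement (M : Multiarrangement K V) : Arrangement K V where
  hyps := M.mult.support
  isHyperplane := M.isHyperplane

open scoped Classical in
/-- The localization `(𝒜_X, μ_X)`: the members of `𝒜` that contain `X`, with their
multiplicities. -/
def localization (M : Multiarrangement K V) (X : Submodule K V) : Multiarrangement K V where
  mult := M.mult.filter fun H => X ≤ H
  isHyperplane := fun H hH => M.isHyperplane H (by
    rw [Finsupp.support_filter] at hH
    exact (Finset.mem_filter.mp hH).1)

open scoped Classical in
/-- The deletion `(𝒜', μ')` with respect to `H₀`: the multiplicity of `H₀` is lowered by one, so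
that `H₀` is removed from the arrangement if it has multiplicity one. -/
def deletion (M : Multiarrangement K V) (H₀ : Submodule K V) : Multiarrangement K V where
  mult := M.mult.update H₀ (M.mult H₀ - 1)
  isHyperplane := fun H hH => M.isHyperplane H (by
    rw [Finsupp.mem_support_iff] at hH ⊢
    intro h0
    apply hH
    rw [Finsupp.update_apply]
    split_ifs with h
    · subst h; omega
    · exact h0)

/-- The module `D(𝒜, μ) = {θ ∈ Der(S) | θ(α_H) ∈ α_H ^ μ(H) S for all H ∈ 𝒜}`. -/
def derModule (M : Multiarrangement K V) : Submodule (CoordRing K V) (Der K V) where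
  carrier := {θ | ∀ H ∈ M.mult.support, ∀ α : Dual K V, LinearMap.ker α = H →
    lin α ^ M.mult H ∣ θ (lin α)}
  add_mem' := fun hθ hη H hH α hα => by
    simpa using dvd_add (hθ H hH α hα) (hη H hH α hα)
  zero_mem' := fun H _ α _ => by simp
  smul_mem' := fun f θ hθ H hH α hα => by
    simpa using Dvd.dvd.mul_left (hθ H hH α hα) f

/-- `d` is the Euler multiplicity at `Y` of the restriction of `(𝒜, μ)` to `H₀ = ker α₀`, where
`Y = H ∩ H₀` with `H ∈ 𝒜 \ {H₀}`: the module `D(𝒜_Y, μ_Y)` has a homogeneous basis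
`θ_Y, ψ_Y, D_3, …, D_ℓ` with `D_3, …, D_ℓ` of polynomial degree `0`,
`θ_Y ∉ α₀ Der(S)`, `ψ_Y ∈ α₀ Der(S)` and `pdeg θ_Y = d`. -/
def IsEulerMult (M : Multiarrangement K V) (H₀ Y : Submodule K V) (d : ℕ) : Prop :=
  ∃ (α₀ : Dual K V)
    (b : Basis (Fin (finrank K V)) (CoordRing K V) (M.localization Y).derModule)
    (i j : Fin (finrank K V)) (e : ℕ),
    LinearMap.ker α₀ = H₀ ∧ i ≠ j ∧
    HasPdeg (b i : Der K V) d ∧ HasPdeg (b j : Der K V) e ∧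
    (∀ k, k ≠ i → k ≠ j → HasPdeg (b k : Der K V) 0) ∧
    (¬ ∃ η : Der K V, (b i : Der K V) = lin α₀ • η) ∧
    (∃ η : Der K V, (b j : Der K V) = lin α₀ • η)

/-- `N` is the restriction `(𝒜'', μ*)` of `M = (𝒜, μ)` to `H₀ ∈ 𝒜`: the underlying arrangement is
`𝒜'' = 𝒜^{H₀}`, and the multiplicities are the Euler multiplicities. -/
def IsEulerRestriction (M : Multiarrangement K V) (H₀ : Submodule K V)
    (N : Multiarrangement K H₀) : Prop :=
  N.toArrangement = M.toArrangement.restriction H₀ ∧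
    ∀ Y ∈ N.mult.support, M.IsEulerMult H₀ (Y.map H₀.subtype) (N.mult Y)

end Multiarrangement

/-- The class of inductively free multiarrangements: the smallest class of multiarrangements (in all
finite-dimensional vector spaces) that contains all empty ones, and contains `(𝒜, μ)` as soon as for
some `H₀ ∈ 𝒜` it contains `(𝒜', μ')` and `(𝒜'', μ*)`, and `exp (𝒜'', μ*) ⊆ exp (𝒜', μ')`
(as multisets). -/
inductive IsInductivelyFreeMulti (K : Type u) [Field K] :
    ∀ (V : Type v) [AddCommGroup V] [Module K V], Multiarrangement K V → Prop
  | empty (V : Type v) [AddCommGroup V] [Module K V] [FiniteDimensional K V] :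
      IsInductivelyFreeMulti K V (Multiarrangement.empty K V)
  | add (V : Type v) [AddCommGroup V] [Module K V] [FiniteDimensional K V]
      (M : Multiarrangement K V) (H₀ : Submodule K V) (hH₀ : H₀ ∈ M.mult.support)
      (N : Multiarrangement K H₀) (hN : M.IsEulerRestriction H₀ N)
      (hdel : IsInductivelyFreeMulti K V (M.deletion H₀))
      (hres : IsInductivelyFreeMulti K H₀ N)
      (E' E'' : Multiset ℕ)
      (hE' : HasExponents (M.deletion H₀).derModule E')
      (hE'' : HasExponents N.derModule E'')
      (hE : E'' ≤ E') :
      IsInductivelyFreeMulti K V M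

/-! ### The Ziegler restriction -/

namespace Arrangement

variable {K : Type u} [Field K] {V : Type v} [AddCommGroup V] [Module K V]

open scoped Classical in
/-- The Ziegler restriction `(𝒜^{H₀}, κ)`, where `κ(Y) = |𝒜_Y| - 1` for `Y ∈ 𝒜^{H₀}`. For `H₀ ∈ 𝒜`
this value is positive, as `𝒜_Y` contains `H₀` and a further hyperplane. -/
def zieglerRestriction (A : Arrangement K V) (H₀ : Submodule K V) : Multiarrangement K H₀ where
  mult := Finsupp.onFinset (A.restriction H₀).hyps
    (fun Y => if Y ∈ (A.restriction H₀).hyps then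
      (A.localization (Y.map H₀.subtype)).hyps.card - 1 else 0)
    (fun Y hY => by
      by_contra h
      exact hY (if_neg h))
  isHyperplane := fun Y hY =>
    (A.restriction H₀).isHyperplane Y (Finsupp.support_onFinset_subset hY)

end Arrangement

end HypArr

end

/-! The induction that defines inductive freeness is run on a stronger statement,
`IsHereditarilyFree`: the arrangement itself, with all multiplicities one, and every Ziegler
restriction of it are inductively free multiarrangements. Both kinds are written `A.pull f` for an
injective linear map `f` onto `V` or onto a member of `A`, the multiplicity of `Y` being the number
of `H` in `A` with preimage `Y`. Working with maps rather than subspaces avoids comparing `H ∩ H₀`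
inside `H` with the same space inside `H₀`.

Let `A` arise from `A' = A \ {H}` and `A'' = A^H`. Terao's addition theorem (`addition`) provides a
homogeneous basis of `D(A)` all of whose members but one restrict to a basis of `D(A'')`. In
particular `D(A) → D(A'')` is onto.

If the image of `f` is not `H`, one adds the single hyperplane `f⁻¹(H)`. The deletion of `A.pull f`
is the pullback of `A'`, and its Euler restriction is the pullback of `A''`. The exponents are those
of `A'` and `A''`, with one exponent 1 removed from each when the image is a hyperplane (Ziegler's
theorem), so the inclusion of exponents persists.

If the image is `H`, the Ziegler multiplicity `κ` is reached from the simple arrangement `σ = A''`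
by raising multiplicities one at a time. Subtracting multiples of the Euler derivation from the
basis of `addition` gives a basis of `D(A'')` made of the Euler derivation and of members `η_i`
already in `D(κ)`. Hence for every `M` with `σ ≤ M ≤ κ`, the `η_i` together with `∏ α_Y ^ (M(Y) -
1)` times the Euler derivation form a basis of `D(M)`. Where `M(Y) ≥ 2`, the Euler restriction of
`M` to `Y` is the Ziegler restriction of `A''` to `Y`. Its exponents are the degrees of the `η_i`,
which are contained in the exponents of the deletion of `M`, and it is inductively free by the
induction hypothesis on `A''`.

Euler multiplicities are never computed from their definition in these arguments.
`isEulerRestriction_of_rel` recognizes `N` as the Euler restriction of `M` once the supports agree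
and restriction maps `D(M)` into and onto `D(N)`. It rests on an explicit basis for localizations of
rank two. All bases are certified by Saito's criterion. -/

noncomputable section

namespace HypArr

/-! ### Restriction of polynomial functions -/

section Res

variable {K V W X : Type*} [Field K] [AddCommGroup V] [Module K V] [AddCommGroup W] [Module K W]
  [AddCommGroup X] [Module K X]

/-- The pullback of polynomial functions along a linear map. -/
def res (f : W →ₗ[K] V) : CoordRing K V →ₐ[K] CoordRing K W :=
  SymmetricAlgebra.lift (SymmetricAlgebra.ι K (Dual K W) ∘ₗ f.dualMap)

theorem lin_zero : lin (0 : Dual K V) = 0 := map_zero _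

theorem lin_smul (c : K) (α : Dual K V) : lin (c • α) = c • lin α := map_smul _ _ _

theorem lin_add (α β : Dual K V) : lin (α + β) = lin α + lin β := map_add _ _ _

theorem lin_sub (α β : Dual K V) : lin (α - β) = lin α - lin β := map_sub _ _ _

theorem lin_sum {ι : Type*} (s : Finset ι) (α : ι → Dual K V) :
    lin (∑ i ∈ s, α i) = ∑ i ∈ s, lin (α i) := map_sum _ _ _

@[simp]
theorem res_lin (f : W →ₗ[K] V) (α : Dual K V) : res f (lin α) = lin (α ∘ₗ f) := by
  simp [res, lin, LinearMap.dualMap_apply']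

theorem res_comp (f : W →ₗ[K] V) (g : X →ₗ[K] W) (s : CoordRing K V) :
    res (f ∘ₗ g) s = res g (res f s) := by
  have : res (f ∘ₗ g) = (res g).comp (res f) := by
    apply SymmetricAlgebra.algHom_ext
    ext α
    change res (f ∘ₗ g) (lin α) = res g (res f (lin α))
    simp [LinearMap.comp_assoc]
  rw [this]; rfl

theorem res_id (s : CoordRing K V) : res (LinearMap.id : V →ₗ[K] V) s = s := by
  have : res (LinearMap.id : V →ₗ[K] V) = AlgHom.id K _ := by
    apply SymmetricAlgebra.algHom_ext
    ext α
    change res _ (lin α) = lin α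
    simp
  rw [this]; rfl

theorem exists_comp_eq {f : W →ₗ[K] V} (hf : Function.Injective f) (β : Dual K W) :
    ∃ α : Dual K V, α ∘ₗ f = β := by
  obtain ⟨r, hr⟩ := f.exists_leftInverse_of_injective (LinearMap.ker_eq_bot.mpr hf)
  exact ⟨β ∘ₗ r, by rw [LinearMap.comp_assoc, hr, LinearMap.comp_id]⟩

theorem res_surjective {f : W →ₗ[K] V} (hf : Function.Injective f) :
    Function.Surjective (res f) := by
  obtain ⟨r, hr⟩ := f.exists_leftInverse_of_injective (LinearMap.ker_eq_bot.mpr hf)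
  intro s
  exact ⟨res r s, by rw [← res_comp, hr, res_id]⟩

theorem exists_smul_of_ker_le {α β : Dual K V} (h : LinearMap.ker α ≤ LinearMap.ker β) :
    ∃ c : K, β = c • α := by
  have := (Submodule.mem_span_singleton (R := K) (x := β) (y := α)).mp ?_
  · obtain ⟨c, hc⟩ := this; exact ⟨c, hc.symm⟩
  · have := (mem_span_of_iInf_ker_le_ker (ι := Unit) (L := fun _ => α) (K := β) (by simpa using h))
    simpa using this

/-- For a retraction `r` of `f`, every form `β ∘ f ∘ r - β` vanishes on `ker α₀`, so `res r ∘ res f`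
is the identity modulo `lin α₀` on generators, hence everywhere. Thus the kernel of restriction to a
hyperplane is generated by its linear form. -/
theorem lin_dvd_of_res_eq_zero {f : W →ₗ[K] V} (hf : Function.Injective f) {α₀ : Dual K V}
    (hr : LinearMap.range f = LinearMap.ker α₀) {s : CoordRing K V} (hs : res f s = 0) :
    lin α₀ ∣ s := by
  obtain ⟨r, hr'⟩ := f.exists_leftInverse_of_injective (LinearMap.ker_eq_bot.mpr hf)
  have key : (Ideal.Quotient.mkₐ K (Ideal.span {lin α₀})).comp ((res r).comp (res f)) =
      Ideal.Quotient.mkₐ K (Ideal.span {lin α₀}) := by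
    apply SymmetricAlgebra.algHom_ext
    ext β
    change Ideal.Quotient.mk _ (res r (res f (lin β))) = Ideal.Quotient.mk _ (lin β)
    rw [Ideal.Quotient.eq, res_lin, res_lin, ← map_sub, Ideal.mem_span_singleton]
    obtain ⟨c, hc⟩ := exists_smul_of_ker_le (α := α₀) (β := (β ∘ₗ f) ∘ₗ r - β) (by
      rw [← hr]
      rintro _ ⟨w, rfl⟩
      have := LinearMap.congr_fun hr' w
      simp only [LinearMap.comp_apply, LinearMap.id_apply] at this
      simp [this])
    rw [hc, map_smul]
    exact dvd_smul_of_dvd c dvd_rfl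
  have := AlgHom.congr_fun key s
  simp only [AlgHom.comp_apply, hs, map_zero] at this
  rw [← Ideal.mem_span_singleton]
  exact Ideal.Quotient.eq_zero_iff_mem.mp this.symm

theorem lin_ne_zero {α : Dual K V} (h : α ≠ 0) : lin α ≠ 0 := by
  obtain ⟨v, hv⟩ : ∃ v, α v ≠ 0 := by
    by_contra! h'
    exact h (LinearMap.ext h')
  intro h0
  have := congrArg (SymmetricAlgebra.lift (Dual.eval K V v)) h0
  rw [map_zero, SymmetricAlgebra.lift_ι_apply] at this
  exact hv this

theorem res_lin_eq_zero {α₀ : Dual K V} {f : W →ₗ[K] V}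
    (hr : LinearMap.range f = LinearMap.ker α₀) : res f (lin α₀) = 0 := by
  have : α₀ ∘ₗ f = 0 := by
    ext w
    have : f w ∈ LinearMap.ker α₀ := hr ▸ LinearMap.mem_range_self f w
    simpa using this
  rw [res_lin, this, lin_zero]

theorem res_eq_zero_iff {f : W →ₗ[K] V} (hf : Function.Injective f) {α₀ : Dual K V}
    (hr : LinearMap.range f = LinearMap.ker α₀) {s : CoordRing K V} :
    res f s = 0 ↔ lin α₀ ∣ s := by
  refine ⟨lin_dvd_of_res_eq_zero hf hr, ?_⟩
  rintro ⟨t, rfl⟩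
  rw [map_mul, res_lin_eq_zero hr, zero_mul]

/-- The ideal of `lin α` is the kernel of restriction to `ker α`, whose target is a domain. -/
theorem prime_lin {α : Dual K V} (h : α ≠ 0) : Prime (lin α) := by
  have hr : LinearMap.range (LinearMap.ker α).subtype = LinearMap.ker α := Submodule.range_subtype _
  have key := fun s => res_eq_zero_iff (LinearMap.ker α).injective_subtype hr (s := s)
  refine ⟨lin_ne_zero h, fun hu => ?_, fun a b hab => ?_⟩
  · have := (key 1).mpr hu.dvd
    simp at this
  · rw [← key, map_mul] at hab
    rw [← key, ← key]
    exact mul_eq_zero.mp hab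

theorem lin_dvd_lin_iff {α β : Dual K V} :
    lin α ∣ lin β ↔ LinearMap.ker α ≤ LinearMap.ker β := by
  constructor
  · intro h
    have hr : LinearMap.range (LinearMap.ker α).subtype = LinearMap.ker α :=
      Submodule.range_subtype _
    have := (res_eq_zero_iff (LinearMap.ker α).injective_subtype hr (s := lin β)).mpr h
    rw [res_lin] at this
    intro v hv
    by_contra hne
    refine lin_ne_zero (fun h0 => hne ?_) this
    simpa using LinearMap.congr_fun h0 ⟨v, hv⟩
  · intro h
    obtain ⟨c, rfl⟩ := exists_smul_of_ker_le h
    rw [lin_smul]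
    exact dvd_smul_of_dvd c dvd_rfl

theorem associated_lin {α β : Dual K V} (h : LinearMap.ker α = LinearMap.ker β) :
    Associated (lin α) (lin β) :=
  associated_of_dvd_dvd (lin_dvd_lin_iff.mpr h.le) (lin_dvd_lin_iff.mpr h.ge)

theorem ker_eq_ker_of_le {α β : Dual K V} (hβ : β ≠ 0)
    (h : LinearMap.ker α ≤ LinearMap.ker β) : LinearMap.ker α = LinearMap.ker β := by
  obtain ⟨c, rfl⟩ := exists_smul_of_ker_le h
  have hc : c ≠ 0 := by rintro rfl; simp at hβ
  exact (LinearMap.ker_smul α c hc).symm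

instance [FiniteDimensional K V] : UniqueFactorizationMonoid (CoordRing K V) :=
  (SymmetricAlgebra.equivMvPolynomial
    (Free.chooseBasis K (Dual K V))).symm.toMulEquiv.uniqueFactorizationMonoid inferInstance

theorem isRelPrime_lin {α β : Dual K V} (hα : α ≠ 0) (hβ : β ≠ 0)
    (h : LinearMap.ker α ≠ LinearMap.ker β) : IsRelPrime (lin α) (lin β) := by
  rw [(prime_lin hα).irreducible.isRelPrime_iff_not_dvd, lin_dvd_lin_iff]
  exact fun h' => h (ker_eq_ker_of_le hβ h')

end Res

/-! ### Homogeneous components -/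

section Homog

variable {K V W : Type*} [Field K] [AddCommGroup V] [Module K V] [AddCommGroup W] [Module K W]

theorem lin_mem_homogPart (α : Dual K V) : lin α ∈ homogPart K V 1 := by
  rw [homogPart, pow_one]; exact LinearMap.mem_range_self _ _

theorem one_mem_homogPart : (1 : CoordRing K V) ∈ homogPart K V 0 := by
  rw [homogPart, pow_zero]; exact Submodule.one_le.mp le_rfl

theorem mul_mem_homogPart {p q : ℕ} {a b : CoordRing K V} (ha : a ∈ homogPart K V p)
    (hb : b ∈ homogPart K V q) : a * b ∈ homogPart K V (p + q) := by
  rw [homogPart, pow_add]; exact Submodule.mul_mem_mul ha hb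

theorem pow_mem_homogPart {p : ℕ} {a : CoordRing K V} (ha : a ∈ homogPart K V p) (n : ℕ) :
    a ^ n ∈ homogPart K V (n * p) := by
  induction n with
  | zero => simpa using one_mem_homogPart
  | succ n ih => rw [pow_succ, Nat.succ_mul]; exact mul_mem_homogPart ih ha

theorem prod_mem_homogPart {ι : Type*} (s : Finset ι) (a : ι → CoordRing K V) (d : ι → ℕ)
    (h : ∀ i ∈ s, a i ∈ homogPart K V (d i)) :
    ∏ i ∈ s, a i ∈ homogPart K V (∑ i ∈ s, d i) := by
  classical
  induction s using Finset.induction_on with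
  | empty => simpa using one_mem_homogPart
  | insert i s hi ih =>
    rw [Finset.prod_insert hi, Finset.sum_insert hi]
    exact mul_mem_homogPart (h i (Finset.mem_insert_self i s))
      (ih fun j hj => h j (Finset.mem_insert_of_mem hj))

theorem mem_homogPart_zero {a : CoordRing K V} :
    a ∈ homogPart K V 0 ↔ ∃ c : K, algebraMap K (CoordRing K V) c = a := by
  rw [homogPart, pow_zero, Submodule.mem_one]

theorem res_mem_homogPart (f : W →ₗ[K] V) {p : ℕ} {a : CoordRing K V}
    (ha : a ∈ homogPart K V p) : res f a ∈ homogPart K W p := by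
  have h1 : Submodule.map (res f).toLinearMap (homogPart K V p) ≤ homogPart K W p := by
    rw [homogPart, homogPart, Submodule.map_pow]
    refine pow_le_pow_left' ?_ p
    rintro _ ⟨_, ⟨α, rfl⟩, rfl⟩
    exact ⟨α ∘ₗ f, (res_lin f α).symm⟩
  exact h1 ⟨a, ha, rfl⟩

theorem exists_res_eq_of_mem_homogPart {f : W →ₗ[K] V} (hf : Function.Injective f) {p : ℕ}
    {b : CoordRing K W} (hb : b ∈ homogPart K W p) :
    ∃ a ∈ homogPart K V p, res f a = b := by
  obtain ⟨r, hr⟩ := f.exists_leftInverse_of_injective (LinearMap.ker_eq_bot.mpr hf)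
  exact ⟨res r b, res_mem_homogPart r hb, by rw [← res_comp, hr, res_id]⟩

/-- The homogeneous component of degree `p` of a polynomial function. -/
def hcomp (p : ℕ) : CoordRing K V →ₗ[K] CoordRing K V :=
  let e := SymmetricAlgebra.equivMvPolynomial (Free.chooseBasis K (Dual K V))
  e.symm.toLinearMap ∘ₗ MvPolynomial.homogeneousComponent p ∘ₗ e.toLinearMap

theorem mem_homogPart_iff {p : ℕ} {a : CoordRing K V} :
    a ∈ homogPart K V p ↔ (SymmetricAlgebra.equivMvPolynomial
      (Free.chooseBasis K (Dual K V)) a).IsHomogeneous p := by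
  set b := Free.chooseBasis K (Dual K V)
  set e := SymmetricAlgebra.equivMvPolynomial b
  have h1 : Submodule.map e.toLinearMap (homogPart K V 1) =
      MvPolynomial.homogeneousSubmodule _ K 1 := by
    rw [MvPolynomial.homogeneousSubmodule_one_eq_span_X, homogPart, pow_one,
      LinearMap.range_eq_map, ← b.span_eq, Submodule.map_span, Submodule.map_span]
    congr 1
    ext x
    simp only [Set.mem_image, Set.mem_range, exists_exists_eq_and]
    constructor
    · rintro ⟨i, rfl⟩
      exact ⟨i, (SymmetricAlgebra.equivMvPolynomial_ι_apply b i).symm⟩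
    · rintro ⟨i, rfl⟩
      exact ⟨i, (SymmetricAlgebra.equivMvPolynomial_ι_apply b i)⟩
  have h2 : Submodule.map e.toLinearMap (homogPart K V p) =
      MvPolynomial.homogeneousSubmodule _ K p := by
    rw [← MvPolynomial.homogeneousSubmodule_one_pow, ← h1, homogPart, homogPart, pow_one]
    exact Submodule.map_pow _ e.toAlgHom p
  rw [← MvPolynomial.mem_homogeneousSubmodule, ← h2]
  constructor
  · exact fun h => ⟨a, h, rfl⟩
  · rintro ⟨a', h, h'⟩
    rwa [← e.injective h']

theorem hcomp_mem (p : ℕ) (a : CoordRing K V) : hcomp p a ∈ homogPart K V p := by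
  rw [mem_homogPart_iff]
  simp only [hcomp, LinearMap.comp_apply, AlgEquiv.toLinearMap_apply, AlgEquiv.apply_symm_apply]
  exact MvPolynomial.homogeneousComponent_isHomogeneous _ _

theorem hcomp_of_mem {p : ℕ} {a : CoordRing K V} (h : a ∈ homogPart K V p) : hcomp p a = a := by
  rw [mem_homogPart_iff] at h
  simp only [hcomp, LinearMap.comp_apply, AlgEquiv.toLinearMap_apply]
  rw [MvPolynomial.homogeneousComponent_eq_self h, AlgEquiv.symm_apply_apply]

theorem hcomp_of_mem_ne {p q : ℕ} (hpq : p ≠ q) {a : CoordRing K V} (h : a ∈ homogPart K V q) :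
    hcomp p a = 0 := by
  rw [mem_homogPart_iff] at h
  simp only [hcomp, LinearMap.comp_apply, AlgEquiv.toLinearMap_apply]
  rw [MvPolynomial.homogeneousComponent_of_mem h, if_neg hpq, map_zero]

theorem exists_sum_hcomp (a : CoordRing K V) :
    ∃ N : ℕ, a = ∑ p ∈ Finset.range N, hcomp p a := by
  set e := SymmetricAlgebra.equivMvPolynomial (Free.chooseBasis K (Dual K V))
  refine ⟨(e a).totalDegree + 1, e.injective ?_⟩
  conv_lhs => rw [← MvPolynomial.sum_homogeneousComponent (e a)]
  rw [map_sum]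
  refine Finset.sum_congr rfl fun p _ => ?_
  simp [hcomp, e]

theorem hcomp_mul {p : ℕ} {a : CoordRing K V} (ha : a ∈ homogPart K V p) (b : CoordRing K V)
    (n : ℕ) : hcomp n (a * b) = if p ≤ n then a * hcomp (n - p) b else 0 := by
  obtain ⟨N, hN⟩ := exists_sum_hcomp b
  have h1 : ∀ q, hcomp n (a * hcomp q b) = if q + p = n then a * hcomp q b else 0 := fun q => by
    have hm := mul_mem_homogPart ha (hcomp_mem q b)
    split_ifs with h
    · subst h; rw [add_comm]; exact hcomp_of_mem hm
    · exact hcomp_of_mem_ne (by omega) hm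
  conv_lhs => rw [hN, Finset.mul_sum, map_sum, Finset.sum_congr rfl fun q _ => h1 q]
  split_ifs with hp
  · have h2 : ∀ q, hcomp (n - p) (hcomp q b) = if q = n - p then hcomp q b else 0 := fun q => by
      split_ifs with h
      · subst h; exact hcomp_of_mem (hcomp_mem _ b)
      · exact hcomp_of_mem_ne (Ne.symm h) (hcomp_mem _ b)
    conv_rhs => rw [hN, map_sum, Finset.sum_congr rfl fun q _ => h2 q, Finset.mul_sum]
    refine Finset.sum_congr rfl fun q _ => ?_
    have : q + p = n ↔ q = n - p := by omega
    simp only [this]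
    split_ifs <;> simp
  · refine Finset.sum_eq_zero fun q _ => if_neg (by omega)

/-- Taking the component of degree `n` of `a * b` shifts the degree on `b` by `p`, and `a` can be
cancelled. The product must be nonzero, since zero is homogeneous of every degree. -/
theorem mem_homogPart_of_mul {p n : ℕ} {a b : CoordRing K V} (ha : a ∈ homogPart K V p)
    (h0 : a * b ≠ 0) (hab : a * b ∈ homogPart K V n) : p ≤ n ∧ b ∈ homogPart K V (n - p) := by
  have h := hcomp_mul ha b n
  rw [hcomp_of_mem hab] at h
  split_ifs at h with hp
  · refine ⟨hp, ?_⟩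
    rw [mul_left_cancel₀ (left_ne_zero_of_mul h0) h]
    exact hcomp_mem _ _
  · exact absurd h h0

theorem eq_of_associated_of_mem_homogPart {p q : ℕ} {a b : CoordRing K V}
    (h : Associated a b) (h0 : a ≠ 0) (ha : a ∈ homogPart K V p) (hb : b ∈ homogPart K V q) :
    p = q := by
  have h0' : b ≠ 0 := (Associated.ne_zero_iff h).mp h0
  obtain ⟨s, rfl⟩ := h.dvd
  obtain ⟨t, ht⟩ := h.symm.dvd
  refine le_antisymm (mem_homogPart_of_mul ha h0' hb).1 ?_
  rw [ht] at ha h0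
  exact (mem_homogPart_of_mul hb h0 ha).1

end Homog

end HypArr

end

noncomputable section

namespace HypArr

/-! ### Derivations of the ring of polynomial functions -/

section Derivations

variable {K V W X : Type*} [Field K] [AddCommGroup V] [Module K V] [AddCommGroup W] [Module K W]
  [AddCommGroup X] [Module K X]

/-- The derivation with prescribed values on linear forms. -/
def mkDer (φ : Dual K V →ₗ[K] CoordRing K V) : Der K V :=
  let S := CoordRing K V
  -- A derivation is the second component of an algebra map into the dual numbers that lifts the
  -- identity. Such a map is free on its values at linear forms.
  let F : S →ₐ[K] TrivSqZeroExt S S := SymmetricAlgebra.lift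
    ((TrivSqZeroExt.inlAlgHom K S S).toLinearMap ∘ₗ SymmetricAlgebra.ι K (Dual K V) +
      (TrivSqZeroExt.inrHom S S).restrictScalars K ∘ₗ φ)
  have hF : (TrivSqZeroExt.fstHom K S S).comp F = AlgHom.id K S := by
    apply SymmetricAlgebra.algHom_ext
    ext α
    simp [F, S]
  have hF' : ∀ s, (F s).fst = s := fun s => AlgHom.congr_fun hF s
  Derivation.mk' (((TrivSqZeroExt.sndHom S S).restrictScalars K) ∘ₗ F.toLinearMap) (fun a b => by
    simp [hF', S, mul_comm])

@[simp]
theorem mkDer_lin (φ : Dual K V →ₗ[K] CoordRing K V) (α : Dual K V) :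
    mkDer φ (lin α) = φ α := by
  simp [mkDer, lin]

theorem der_ext {θ η : Der K V} (h : ∀ α : Dual K V, θ (lin α) = η (lin α)) : θ = η := by
  ext s
  induction s using SymmetricAlgebra.induction with
  | algebraMap r => simp
  | ι α => exact h α
  | mul a b ha hb => simp [ha, hb]
  | add a b ha hb => simp [ha, hb]

theorem der_ext_basis {ι : Type*} (x : Basis ι K (Dual K V)) {θ η : Der K V}
    (h : ∀ i, θ (lin (x i)) = η (lin (x i))) : θ = η := by
  refine der_ext fun α => ?_
  have : (θ : CoordRing K V →ₗ[K] CoordRing K V) ∘ₗ SymmetricAlgebra.ι K (Dual K V) =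
      (η : CoordRing K V →ₗ[K] CoordRing K V) ∘ₗ SymmetricAlgebra.ι K (Dual K V) :=
    x.ext h
  exact LinearMap.congr_fun this α

variable (K V) in
/-- The Euler derivation. -/
def eulerDer : Der K V := mkDer (SymmetricAlgebra.ι K (Dual K V))

@[simp]
theorem eulerDer_lin (α : Dual K V) : eulerDer K V (lin α) = lin α := mkDer_lin _ _

/-- The derivation sending `α` to `s * α v`. -/
def dirDer (s : CoordRing K V) (v : V) : Der K V :=
  s • mkDer (Algebra.linearMap K (CoordRing K V) ∘ₗ Dual.eval K V v)

@[simp]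
theorem dirDer_lin (s : CoordRing K V) (v : V) (α : Dual K V) :
    dirDer s v (lin α) = s * algebraMap K _ (α v) := by
  simp [dirDer]

theorem der_sum_smul_apply {ι : Type*} (s : Finset ι) (c : ι → CoordRing K V) (θ : ι → Der K V)
    (a : CoordRing K V) : (∑ i ∈ s, c i • θ i) a = ∑ i ∈ s, c i * θ i a := by
  rw [← Derivation.coeFnAddMonoidHom_apply, map_sum, Finset.sum_apply]
  simp

theorem hasPdeg_eulerDer : HasPdeg (eulerDer K V) 1 := fun α => by
  rw [eulerDer_lin]; exact lin_mem_homogPart α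

theorem HasPdeg.smul {θ : Der K V} {p q : ℕ} {c : CoordRing K V} (hc : c ∈ homogPart K V p)
    (h : HasPdeg θ q) : HasPdeg (c • θ) (p + q) := fun α => by
  rw [Derivation.smul_apply, smul_eq_mul]; exact mul_mem_homogPart hc (h α)

theorem HasPdeg.sub {θ η : Der K V} {p : ℕ} (h : HasPdeg θ p) (h' : HasPdeg η p) :
    HasPdeg (θ - η) p := fun α => by
  rw [Derivation.sub_apply]; exact Submodule.sub_mem _ (h α) (h' α)

theorem hasPdeg_zero (p : ℕ) : HasPdeg (0 : Der K V) p := fun α => by simp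

theorem exists_smul_eq_of_forall_dvd {c : CoordRing K V} (hc : c ≠ 0)
    {θ : Der K V} (h : ∀ α, c ∣ θ (lin α)) : ∃ η : Der K V, θ = c • η := by
  choose g hg using h
  refine ⟨mkDer ⟨⟨g, fun α β => ?_⟩, fun r α => ?_⟩, der_ext fun α => ?_⟩
  · apply mul_left_cancel₀ hc
    rw [mul_add, ← hg, ← hg, ← hg, lin_add, map_add]
  · apply mul_left_cancel₀ hc
    rw [RingHom.id_apply, mul_smul_comm, ← hg, ← hg, lin_smul, Derivation.map_smul]
  · simp [hg α]

/-- The derivation `η` on `W` is induced by the derivation `θ` on `V` along `f : W → V`. -/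
def Rel (f : W →ₗ[K] V) (θ : Der K V) (η : Der K W) : Prop :=
  ∀ α : Dual K V, η (lin (α ∘ₗ f)) = res f (θ (lin α))

theorem Rel.smul {f : W →ₗ[K] V} {θ : Der K V} {η : Der K W} (h : Rel f θ η)
    (c : CoordRing K V) : Rel f (c • θ) (res f c • η) := fun α => by simp [h α]

theorem Rel.add {f : W →ₗ[K] V} {θ θ' : Der K V} {η η' : Der K W} (h : Rel f θ η)
    (h' : Rel f θ' η') : Rel f (θ + θ') (η + η') := fun α => by simp [h α, h' α]

theorem Rel.sub {f : W →ₗ[K] V} {θ θ' : Der K V} {η η' : Der K W} (h : Rel f θ η)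
    (h' : Rel f θ' η') : Rel f (θ - θ') (η - η') := fun α => by simp [h α, h' α]

theorem rel_zero (f : W →ₗ[K] V) : Rel f 0 0 := fun α => by simp

theorem Rel.sum {ι : Type*} {f : W →ₗ[K] V} (s : Finset ι) {θ : ι → Der K V} {η : ι → Der K W}
    (h : ∀ i ∈ s, Rel f (θ i) (η i)) : Rel f (∑ i ∈ s, θ i) (∑ i ∈ s, η i) := by
  classical
  induction s using Finset.induction_on with
  | empty => simpa using rel_zero f
  | insert i s hi ih =>
    rw [Finset.sum_insert hi, Finset.sum_insert hi]
    exact (h i (Finset.mem_insert_self i s)).add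
      (ih fun j hj => h j (Finset.mem_insert_of_mem hj))

theorem rel_eulerDer (f : W →ₗ[K] V) : Rel f (eulerDer K V) (eulerDer K W) := fun α => by simp

theorem Rel.comp {f : W →ₗ[K] V} {g : X →ₗ[K] W} {θ : Der K V} {η : Der K W} {ζ : Der K X}
    (h : Rel f θ η) (h' : Rel g η ζ) : Rel (f ∘ₗ g) θ ζ := fun α => by
  rw [res_comp, ← h α, ← h', LinearMap.comp_assoc]

theorem Rel.of_comp {f : W →ₗ[K] V} (hf : Function.Injective f) {g : X →ₗ[K] W} {θ : Der K V}
    {η : Der K W} {ζ : Der K X} (h : Rel f θ η) (h' : Rel (f ∘ₗ g) θ ζ) : Rel g η ζ := fun β => by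
  obtain ⟨α, rfl⟩ := exists_comp_eq hf β
  rw [h α, ← res_comp, ← h' α, LinearMap.comp_assoc]

theorem Rel.unique {f : W →ₗ[K] V} (hf : Function.Injective f) {θ : Der K V} {η η' : Der K W}
    (h : Rel f θ η) (h' : Rel f θ η') : η = η' := der_ext fun β => by
  obtain ⟨α, rfl⟩ := exists_comp_eq hf β
  rw [h, h']

theorem Rel.hasPdeg {f : W →ₗ[K] V} (hf : Function.Injective f) {θ : Der K V} {η : Der K W}
    (h : Rel f θ η) {p : ℕ} (hp : HasPdeg θ p) : HasPdeg η p := fun β => by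
  obtain ⟨α, rfl⟩ := exists_comp_eq hf β
  rw [h]; exact res_mem_homogPart f (hp α)

/-- Extend a form on `W` to `V` by a retraction, apply `θ` and restrict. The hypothesis makes the
result independent of the extension. -/
theorem exists_rel {f : W →ₗ[K] V} (hf : Function.Injective f) {θ : Der K V}
    (h : ∀ α : Dual K V, α ∘ₗ f = 0 → res f (θ (lin α)) = 0) : ∃ η : Der K W, Rel f θ η := by
  obtain ⟨r, hr⟩ := f.exists_leftInverse_of_injective (LinearMap.ker_eq_bot.mpr hf)
  refine ⟨mkDer ((res f).toLinearMap ∘ₗ (θ : CoordRing K V →ₗ[K] CoordRing K V) ∘ₗ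
    SymmetricAlgebra.ι K (Dual K V) ∘ₗ r.dualMap), fun α => ?_⟩
  rw [mkDer_lin]
  change res f (θ (lin ((α ∘ₗ f) ∘ₗ r))) = _
  rw [← sub_eq_zero, ← map_sub, ← map_sub, ← lin_sub]
  apply h
  rw [LinearMap.sub_comp, LinearMap.comp_assoc, hr, LinearMap.comp_id, sub_self]

theorem exists_rel_of_dvd {f : W →ₗ[K] V} (hf : Function.Injective f) {θ : Der K V}
    {α₀ : Dual K V} (hr : LinearMap.range f = LinearMap.ker α₀)
    (h : lin α₀ ∣ θ (lin α₀)) : ∃ η : Der K W, Rel f θ η := by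
  refine exists_rel hf fun α hα => ?_
  obtain ⟨c, rfl⟩ := exists_smul_of_ker_le (α := α₀) (β := α) (by
    rw [← hr]
    rintro _ ⟨w, rfl⟩
    exact LinearMap.congr_fun hα w)
  rw [lin_smul, Derivation.map_smul, map_smul, (res_eq_zero_iff hf hr).mpr h, smul_zero]

theorem exists_rel_of_bijective {f : W →ₗ[K] V} (hf : Function.Bijective f) (θ : Der K V) :
    ∃ η : Der K W, Rel f θ η := by
  refine exists_rel hf.1 fun α hα => ?_
  have : α = 0 := by
    ext v
    obtain ⟨w, rfl⟩ := hf.2 v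
    exact LinearMap.congr_fun hα w
  rw [this, lin_zero, map_zero, map_zero]

theorem Rel.exists_eq_smul_of_zero {f : W →ₗ[K] V} (hf : Function.Injective f) {θ : Der K V}
    {α₀ : Dual K V} (h0 : α₀ ≠ 0) (hr : LinearMap.range f = LinearMap.ker α₀) (h : Rel f θ 0) :
    ∃ η : Der K V, θ = lin α₀ • η :=
  exists_smul_eq_of_forall_dvd (lin_ne_zero h0) fun α => by
    rw [← res_eq_zero_iff hf hr, ← h α, Derivation.zero_apply]

end Derivations

/-! ### Homogeneous bases -/

theorem linearIndependent_coe_basis {R N ι : Type*} [CommRing R] [AddCommGroup N] [Module R N]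
    {D : Submodule R N} (b : Basis ι R D) : LinearIndependent R fun i => (b i : N) :=
  b.linearIndependent.map' D.subtype (Submodule.ker_subtype D)

theorem span_range_coe_basis {R N ι : Type*} [CommRing R] [AddCommGroup N] [Module R N]
    {D : Submodule R N} (b : Basis ι R D) :
    Submodule.span R (Set.range fun i => (b i : N)) = D := by
  have := congrArg (Submodule.map D.subtype) b.span_eq
  rw [Submodule.map_span, ← Set.range_comp, Submodule.map_top, Submodule.range_subtype] at this
  exact this

theorem eq_of_sum_smul_eq {R N ι : Type*} [CommRing R] [AddCommGroup N] [Module R N] [Fintype ι]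
    {θ : ι → N} (h : LinearIndependent R θ) {a b : ι → R}
    (hab : ∑ i, a i • θ i = ∑ i, b i • θ i) : a = b := by
  funext i
  refine sub_eq_zero.mp (Fintype.linearIndependent_iff.mp h (fun i => a i - b i) ?_ i)
  simp [sub_smul, hab]

/-! ### Elementary transformations of independent families. -/

section Exchange

variable {R N ι : Type*} [CommRing R] [IsDomain R] [AddCommGroup N] [Module R N] [Fintype ι]
  [DecidableEq ι]

theorem linearIndependent_update_step {θ : ι → N} (h : LinearIndependent R θ) (j : ι) {a : R}
    (ha : a ≠ 0) (r : ι → R) :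
    LinearIndependent R (Function.update (fun i => θ i - r i • θ j) j (a • θ j)) ∧
    ∀ c : ι → R, ∑ i, c i • Function.update (fun i => θ i - r i • θ j) j (a • θ j) i =
      ∑ i ∈ Finset.univ.erase j, c i • θ i +
        (c j * a - ∑ i ∈ Finset.univ.erase j, c i * r i) • θ j := by
  set θ' := Function.update (fun i => θ i - r i • θ j) j (a • θ j) with hθ'
  have hj : θ' j = a • θ j := by simp [hθ']
  have hi : ∀ i, i ≠ j → θ' i = θ i - r i • θ j := fun i hi => by simp [hθ', hi]
  have hsum : ∀ c : ι → R, ∑ i, c i • θ' i =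
      ∑ i ∈ Finset.univ.erase j, c i • θ i +
        (c j * a - ∑ i ∈ Finset.univ.erase j, c i * r i) • θ j := fun c => by
    rw [← Finset.sum_erase_add _ _ (Finset.mem_univ j), hj,
      Finset.sum_congr rfl fun i h => by rw [hi i (Finset.ne_of_mem_erase h)]]
    simp only [smul_sub, Finset.sum_sub_distrib, sub_smul, Finset.sum_smul, mul_smul]
    abel
  refine ⟨?_, hsum⟩
  rw [Fintype.linearIndependent_iff]
  intro c hc0
  rw [hsum] at hc0
  have h0 : ∀ i, (if i = j then c j * a - ∑ i ∈ Finset.univ.erase j, c i * r i else c i) = 0 := by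
    refine Fintype.linearIndependent_iff.mp h _ ?_
    rw [← Finset.sum_erase_add _ _ (Finset.mem_univ j), if_pos rfl, ← hc0]
    congr 1
    exact Finset.sum_congr rfl fun i h => by rw [if_neg (Finset.ne_of_mem_erase h)]
  have h1 : ∀ i, i ≠ j → c i = 0 := fun i hij => by simpa [hij] using h0 i
  intro i
  by_cases hij : i = j
  · subst hij
    have := h0 i
    rw [if_pos rfl, Finset.sum_eq_zero fun k hk => by
      rw [h1 k (Finset.ne_of_mem_erase hk), zero_mul], sub_zero] at this
    exact (mul_eq_zero.mp this).resolve_right ha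
  · exact h1 i hij

/-- After subtracting suitable combinations of the `θ i - r i • θ j`, an element of `D'` becomes a
multiple of `θ j`. By `hc` that multiple is one of `a • θ j`. -/
theorem span_update_step {θ : ι → N} (h : LinearIndependent R θ) {D' : Submodule R N}
    (hD : D' ≤ Submodule.span R (Set.range θ)) (j : ι) {a : R} (ha : a ≠ 0) (r : ι → R)
    (hr : ∀ i, i ≠ j → θ i - r i • θ j ∈ D') (haj : a • θ j ∈ D')
    (hc : ∀ c : R, c • θ j ∈ D' → a ∣ c) :
    Submodule.span R (Set.range (Function.update (fun i => θ i - r i • θ j) j (a • θ j))) = D' := by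
  have hsum := (linearIndependent_update_step h j ha r).2
  refine le_antisymm ?_ ?_
  · rw [Submodule.span_le]
    rintro _ ⟨i, rfl⟩
    by_cases hij : i = j
    · subst hij; rw [Function.update_self]; exact haj
    · rw [Function.update_of_ne hij]; exact hr i hij
  · intro η hη
    obtain ⟨c, rfl⟩ := (Submodule.mem_span_range_iff_exists_fun R).mp (hD hη)
    have h1 : ∑ i ∈ Finset.univ.erase j, c i • (θ i - r i • θ j) ∈ D' :=
      Submodule.sum_mem _ fun i h => D'.smul_mem _ (hr i (Finset.ne_of_mem_erase h))
    have h2 : (c j + ∑ i ∈ Finset.univ.erase j, c i * r i) • θ j ∈ D' := by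
      have := D'.sub_mem hη h1
      rw [← Finset.sum_erase_add _ _ (Finset.mem_univ j)] at this
      convert this using 1
      simp only [smul_sub, Finset.sum_sub_distrib, add_smul, Finset.sum_smul, mul_smul]
      abel
    obtain ⟨b, hb⟩ := hc _ h2
    rw [Submodule.mem_span_range_iff_exists_fun]
    refine ⟨fun i => if i = j then b else c i, ?_⟩
    rw [hsum, if_pos rfl, mul_comm b, ← hb, ← Finset.sum_erase_add _ _ (Finset.mem_univ j)]
    congr 1
    · exact Finset.sum_congr rfl fun i h => by rw [if_neg (Finset.ne_of_mem_erase h)]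
    · congr 1
      rw [sub_eq_iff_eq_add]
      congr 1
      exact Finset.sum_congr rfl fun i h => by rw [if_neg (Finset.ne_of_mem_erase h)]

theorem linearIndependent_and_span_exchange {θ : ι → N} (h : LinearIndependent R θ) (j : ι) {η : N}
    {c : ι → R} (hη : η = ∑ i, c i • θ i) (hu : IsUnit (c j)) :
    LinearIndependent R (Function.update θ j η) ∧
      Submodule.span R (Set.range (Function.update θ j η)) = Submodule.span R (Set.range θ) := by
  obtain ⟨u, hu⟩ := hu
  have hsum : ∀ b : ι → R, ∑ i, b i • Function.update θ j η i =
      ∑ i ∈ Finset.univ.erase j, (b i + b j * c i) • θ i + (b j * c j) • θ j := fun b => by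
    rw [← Finset.sum_erase_add _ _ (Finset.mem_univ j), Function.update_self,
      Finset.sum_congr rfl fun i h => by rw [Function.update_of_ne (Finset.ne_of_mem_erase h)]]
    rw [hη, ← Finset.sum_erase_add _ _ (Finset.mem_univ j)]
    simp only [smul_add, Finset.smul_sum, add_smul, Finset.sum_add_distrib, mul_smul]
    abel
  refine ⟨?_, le_antisymm ?_ ?_⟩
  · rw [Fintype.linearIndependent_iff]
    intro b hb0
    rw [hsum] at hb0
    have h0 : ∀ i, (if i = j then b j * c j else b i + b j * c i) = 0 := by
      refine Fintype.linearIndependent_iff.mp h _ ?_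
      rw [← Finset.sum_erase_add _ _ (Finset.mem_univ j), if_pos rfl, ← hb0]
      congr 1
      exact Finset.sum_congr rfl fun i h => by rw [if_neg (Finset.ne_of_mem_erase h)]
    have hbj : b j = 0 := by
      have := h0 j
      rw [if_pos rfl] at this
      exact (mul_eq_zero.mp this).resolve_right (hu ▸ u.ne_zero)
    intro i
    by_cases hij : i = j
    · rw [hij, hbj]
    · simpa [hij, hbj] using h0 i
  · rw [Submodule.span_le]
    rintro _ ⟨i, rfl⟩
    by_cases hij : i = j
    · subst hij
      rw [Function.update_self, hη]
      exact Submodule.sum_mem _ fun i _ => Submodule.smul_mem _ _ (Submodule.subset_span ⟨i, rfl⟩)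
    · rw [Function.update_of_ne hij]; exact Submodule.subset_span ⟨i, rfl⟩
  · rw [Submodule.span_le]
    have hmem : ∀ i, i ≠ j → θ i ∈ Submodule.span R (Set.range (Function.update θ j η)) :=
      fun i hij => Submodule.subset_span ⟨i, by rw [Function.update_of_ne hij]⟩
    rintro _ ⟨i, rfl⟩
    by_cases hij : i = j
    · subst hij
      have h1 : θ i = (↑u⁻¹ : R) • (η - ∑ k ∈ Finset.univ.erase i, c k • θ k) := by
        rw [hη, ← Finset.sum_erase_add _ _ (Finset.mem_univ i), add_sub_cancel_left, ← hu,
          smul_smul, Units.inv_mul, one_smul]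
      rw [h1]
      refine Submodule.smul_mem _ _ (Submodule.sub_mem _ (Submodule.subset_span ⟨i, by simp⟩) ?_)
      exact Submodule.sum_mem _ fun k hk =>
        Submodule.smul_mem _ _ (hmem k (Finset.ne_of_mem_erase hk))
    · exact hmem i hij

end Exchange

/-! ### Homogeneous bases of submodules of `Der(S)`. -/

section HomBasis

variable {K V W : Type*} [Field K] [AddCommGroup V] [Module K V] [AddCommGroup W] [Module K W]
  {ι κ : Type*}

/-- The family `θ` is a basis of the submodule `D` of `Der(S)`, and its members are homogeneous of
polynomial degrees `d`. -/
structure HomBasis (D : Submodule (CoordRing K V) (Der K V)) (θ : ι → Der K V) (d : ι → ℕ) :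
    Prop where
  linInd : LinearIndependent (CoordRing K V) θ
  span_eq : Submodule.span (CoordRing K V) (Set.range θ) = D
  pdeg : ∀ i, HasPdeg (θ i) (d i)

variable {D : Submodule (CoordRing K V) (Der K V)} {θ : ι → Der K V} {d : ι → ℕ}

theorem HomBasis.mem (h : HomBasis D θ d) (i : ι) : θ i ∈ D :=
  h.span_eq ▸ Submodule.subset_span ⟨i, rfl⟩

theorem HomBasis.exists_sum [Fintype ι] (h : HomBasis D θ d) {η : Der K V} (hη : η ∈ D) :
    ∃ c : ι → CoordRing K V, η = ∑ i, c i • θ i := by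
  rw [← h.span_eq, Submodule.mem_span_range_iff_exists_fun] at hη
  obtain ⟨c, hc⟩ := hη
  exact ⟨c, hc.symm⟩

theorem HomBasis.eq_of_sum_eq [Fintype ι] (h : HomBasis D θ d) {a b : ι → CoordRing K V}
    (hab : ∑ i, a i • θ i = ∑ i, b i • θ i) : a = b := by
  exact eq_of_sum_smul_eq h.linInd hab

theorem HomBasis.reindex (h : HomBasis D θ d) (e : κ ≃ ι) : HomBasis D (θ ∘ e) (d ∘ e) where
  linInd := h.linInd.comp e e.injective
  span_eq := by rw [e.surjective.range_comp, h.span_eq]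
  pdeg i := h.pdeg (e i)

theorem HomBasis.exists_basis (h : HomBasis D θ d) :
    ∃ b : Basis ι (CoordRing K V) D, ∀ i, (b i : Der K V) = θ i := by
  refine ⟨(Basis.span h.linInd).map (LinearEquiv.ofEq _ _ h.span_eq), fun i => ?_⟩
  simp only [Basis.map_apply, LinearEquiv.coe_ofEq_apply]
  exact congrArg Subtype.val (Basis.span_apply h.linInd i)

theorem HomBasis.hasExponents [Fintype ι] (h : HomBasis D θ d)
    (hc : Fintype.card ι = finrank K V) : HasExponents D (Finset.univ.val.map d) := by
  let e : Fin (finrank K V) ≃ ι := (Fintype.equivFinOfCardEq hc).symm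
  obtain ⟨b, hb⟩ := (h.reindex e).exists_basis
  refine ⟨b, d ∘ e, fun i => ?_, ?_⟩
  · rw [hb]
    exact (h.reindex e).pdeg i
  · have := congrArg Finset.val (Finset.map_univ_equiv e)
    rw [Finset.map_val] at this
    rw [← this, Multiset.map_map]
    rfl

theorem exists_homBasis_of_hasExponents {E : Multiset ℕ} (h : HasExponents D E) {n : ℕ}
    (hn : finrank K V = n) : ∃ (θ : Fin n → Der K V) (d : Fin n → ℕ),
      HomBasis D θ d ∧ E = Finset.univ.val.map d := by
  subst hn
  obtain ⟨b, d, hd, rfl⟩ := h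
  refine ⟨fun i => b i, d, ⟨?_, ?_, hd⟩, rfl⟩
  · exact linearIndependent_coe_basis b
  · exact span_range_coe_basis b

theorem HomBasis.coeff_mem [Fintype ι] (h : HomBasis D θ d) {η : Der K V} {p : ℕ}
    (hp : HasPdeg η p) {c : ι → CoordRing K V} (hc : η = ∑ i, c i • θ i) (i : ι) :
    (d i ≤ p → c i ∈ homogPart K V (p - d i)) ∧ (¬ d i ≤ p → c i = 0) := by
  -- Keeping in each coefficient only the component of degree `p - d i` still represents `η`, so
  -- uniqueness of coefficients applies.
  have key : c = fun i => if d i ≤ p then hcomp (p - d i) (c i) else 0 := by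
    apply h.eq_of_sum_eq
    rw [← hc]
    refine der_ext fun α => ?_
    rw [der_sum_smul_apply, ← hcomp_of_mem (hp α), hc, der_sum_smul_apply, map_sum]
    refine Finset.sum_congr rfl fun i _ => ?_
    rw [mul_comm, hcomp_mul (h.pdeg i α)]
    split_ifs <;> ring
  constructor
  · intro hi
    rw [key]; simp only [if_pos hi]; exact hcomp_mem _ _
  · intro hi
    rw [key]; simp only [if_neg hi]

/-- The common mechanism for adding a hyperplane: clear the obstruction from all members but `θ j`
by multiples of `θ j`, and multiply `θ j` itself by `a`. With `a = 1` and `D' = D` it is a mere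
change of basis. -/
theorem HomBasis.step [Fintype ι] [DecidableEq ι] (h : HomBasis D θ d) {D' : Submodule (CoordRing K V) (Der K V)}
    (hD : D' ≤ D) (j : ι) {a : CoordRing K V} (ha : a ≠ 0) {p : ℕ} (hap : a ∈ homogPart K V p)
    (r : ι → CoordRing K V)
    (hr : ∀ i, i ≠ j → θ i - r i • θ j ∈ D') (haj : a • θ j ∈ D')
    (hc : ∀ c : CoordRing K V, c • θ j ∈ D' → a ∣ c)
    (hp : ∀ i, i ≠ j → HasPdeg (r i • θ j) (d i)) :
    HomBasis D' (Function.update (fun i => θ i - r i • θ j) j (a • θ j))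
      (Function.update d j (p + d j)) where
  linInd := (linearIndependent_update_step h.linInd j ha r).1
  span_eq := span_update_step h.linInd (hD.trans h.span_eq.ge) j ha r hr haj hc
  pdeg i := by
    by_cases hij : i = j
    · subst hij
      rw [Function.update_self, Function.update_self]
      exact (h.pdeg i).smul hap
    · rw [Function.update_of_ne hij, Function.update_of_ne hij]
      exact (h.pdeg i).sub (hp i hij)

/-- Exchange a basis element for a derivation in which it has an invertible coefficient. -/
theorem HomBasis.exchange [Fintype ι] [DecidableEq ι] (h : HomBasis D θ d) (j : ι) {η : Der K V}
    {c : ι → CoordRing K V} (hη : η = ∑ i, c i • θ i) (hu : IsUnit (c j)) (hp : HasPdeg η (d j)) :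
    HomBasis D (Function.update θ j η) d where
  linInd := (linearIndependent_and_span_exchange h.linInd j hη hu).1
  span_eq := (linearIndependent_and_span_exchange h.linInd j hη hu).2.trans h.span_eq
  pdeg i := by
    by_cases hij : i = j
    · subst hij; rw [Function.update_self]; exact hp
    · rw [Function.update_of_ne hij]; exact h.pdeg i

/-- Lifting a basis suffices, because the coefficients lift too: `res f` is onto. -/
theorem exists_lift_of_basis [Fintype κ] {f : W →ₗ[K] V} (hf : Function.Injective f)
    {D' : Submodule (CoordRing K W) (Der K W)} {η : κ → Der K W} {e : κ → ℕ}
    (h : HomBasis D' η e) {ψ : κ → Der K V} (hψ : ∀ k, ψ k ∈ D) (hrel : ∀ k, Rel f (ψ k) (η k))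
    {ζ : Der K W} (hζ : ζ ∈ D') : ∃ θ ∈ D, Rel f θ ζ := by
  obtain ⟨c, rfl⟩ := h.exists_sum hζ
  choose b hb using fun k => res_surjective hf (c k)
  refine ⟨∑ k, b k • ψ k, Submodule.sum_mem _ fun k _ => D.smul_mem _ (hψ k),
    Rel.sum _ fun k _ => ?_⟩
  rw [← hb]
  exact (hrel k).smul (b k)

end HomBasis

end HypArr

end

noncomputable section

namespace HypArr

/-! ### Defining forms and the modules of multiderivations -/

section Forms

variable {K V W : Type*} [Field K] [AddCommGroup V] [Module K V] [AddCommGroup W] [Module K W]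

open scoped Classical in
/-- A chosen defining form of a hyperplane. -/
def form (H : Submodule K V) : Dual K V := if h : IsHyperplane H then h.choose else 0

theorem form_ne_zero {H : Submodule K V} (h : IsHyperplane H) : form H ≠ 0 := by
  rw [form, dif_pos h]; exact h.choose_spec.1

theorem ker_form {H : Submodule K V} (h : IsHyperplane H) : LinearMap.ker (form H) = H := by
  rw [form, dif_pos h]; exact h.choose_spec.2

theorem IsHyperplane.ne_top {H : Submodule K V} (h : IsHyperplane H) : H ≠ ⊤ := by
  obtain ⟨α, h0, rfl⟩ := h
  rwa [Ne, LinearMap.ker_eq_top]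

theorem IsHyperplane.eq_of_le {H H' : Submodule K V} (h : IsHyperplane H) (h' : IsHyperplane H')
    (hle : H ≤ H') : H = H' := by
  obtain ⟨α, h0, rfl⟩ := h
  obtain ⟨β, h0', rfl⟩ := h'
  exact ker_eq_ker_of_le h0' hle

theorem IsHyperplane.comap {H : Submodule K V} (h : IsHyperplane H) {f : W →ₗ[K] V}
    (hf : H.comap f ≠ ⊤) : IsHyperplane (H.comap f) := by
  obtain ⟨α, h0, rfl⟩ := h
  refine ⟨α ∘ₗ f, fun h => hf ?_, LinearMap.ker_comp _ _⟩
  rw [← LinearMap.ker_comp, h, LinearMap.ker_zero]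

theorem dvd_of_ker_eq {α β : Dual K V} (h : LinearMap.ker α = LinearMap.ker β) {m : ℕ}
    {θ : Der K V} (hθ : lin α ^ m ∣ θ (lin α)) : lin β ^ m ∣ θ (lin β) := by
  obtain ⟨c, rfl⟩ := exists_smul_of_ker_le h.le
  refine (((associated_lin h).pow_pow (n := m)).symm.dvd).trans ?_
  rw [lin_smul, Derivation.map_smul]
  exact dvd_smul_of_dvd c hθ

namespace Multiarrangement

theorem mem_derModule_iff {M : Multiarrangement K V} {θ : Der K V} :
    θ ∈ M.derModule ↔ ∀ H ∈ M.mult.support, lin (form H) ^ M.mult H ∣ θ (lin (form H)) := by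
  constructor
  · intro h H hH
    exact h H hH _ (ker_form (M.isHyperplane H hH))
  · intro h H hH α hα
    exact dvd_of_ker_eq ((ker_form (M.isHyperplane H hH)).trans hα.symm) (h H hH)

theorem dvd_of_mem {M : Multiarrangement K V} {θ : Der K V} (h : θ ∈ M.derModule) {α : Dual K V}
    {H : Submodule K V} (hα : LinearMap.ker α = H) : lin α ^ M.mult H ∣ θ (lin α) := by
  by_cases hH : H ∈ M.mult.support
  · exact h H hH α hα
  · rw [Finsupp.notMem_support_iff.mp hH, pow_zero]; exact one_dvd _

/-- The defining polynomial `∏ α_H ^ μ(H)`. -/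
def defPoly (M : Multiarrangement K V) : CoordRing K V :=
  ∏ H ∈ M.mult.support, lin (form H) ^ M.mult H

theorem defPoly_ne_zero (M : Multiarrangement K V) : M.defPoly ≠ 0 :=
  Finset.prod_ne_zero_iff.mpr fun H hH =>
    pow_ne_zero _ (lin_ne_zero (form_ne_zero (M.isHyperplane H hH)))

theorem defPoly_mem (M : Multiarrangement K V) :
    M.defPoly ∈ homogPart K V (∑ H ∈ M.mult.support, M.mult H) :=
  prod_mem_homogPart _ _ _ fun H _ => by
    simpa using pow_mem_homogPart (lin_mem_homogPart (form H)) (M.mult H)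

theorem defPoly_dvd [FiniteDimensional K V] {M : Multiarrangement K V} {s : CoordRing K V}
    (h : ∀ H ∈ M.mult.support, lin (form H) ^ M.mult H ∣ s) : M.defPoly ∣ s := by
  refine Finset.prod_dvd_of_isRelPrime (fun H hH H' hH' hne => ?_) h
  have h1 := M.isHyperplane H hH
  have h2 := M.isHyperplane H' hH'
  refine IsRelPrime.pow (isRelPrime_lin (form_ne_zero h1) (form_ne_zero h2) ?_)
  rwa [ker_form h1, ker_form h2]

end Multiarrangement

namespace Arrangement

theorem mem_derModule_iff {A : Arrangement K V} {θ : Der K V} :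
    θ ∈ A.derModule ↔ ∀ H ∈ A.hyps, lin (form H) ∣ θ (lin (form H)) := by
  constructor
  · intro h H hH
    exact h H hH _ (ker_form (A.isHyperplane H hH))
  · intro h H hH α hα
    simpa using dvd_of_ker_eq (m := 1) ((ker_form (A.isHyperplane H hH)).trans hα.symm)
      (by simpa using h H hH)

theorem eulerDer_mem (A : Arrangement K V) : eulerDer K V ∈ A.derModule :=
  fun _ _ α _ => by rw [eulerDer_lin]

open scoped Classical in
/-- The pullback of an arrangement along a linear map, with its natural multiplicities. -/
def pull (A : Arrangement K V) (f : W →ₗ[K] V) : Multiarrangement K W where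
  mult := Finsupp.onFinset (A.hyps.image fun H => H.comap f)
    (fun Y => if Y = ⊤ then 0 else (A.hyps.filter fun H => H.comap f = Y).card)
    (fun Y hY => by
      by_contra h
      refine hY ?_
      split_ifs
      · rfl
      · rw [Finset.card_eq_zero, Finset.filter_eq_empty_iff]
        exact fun H hH hHY => h (Finset.mem_image.mpr ⟨H, hH, hHY⟩))
  isHyperplane := fun Y hY => by
    rw [Finsupp.mem_support_onFinset] at hY
    split_ifs at hY with hT
    · exact absurd rfl hY
    · obtain ⟨H, hH⟩ := Finset.card_ne_zero.mp hY
      obtain ⟨hHA, rfl⟩ := Finset.mem_filter.mp hH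
      exact (A.isHyperplane H hHA).comap hT

open scoped Classical in
theorem pull_mult (A : Arrangement K V) (f : W →ₗ[K] V) (Y : Submodule K W) :
    (A.pull f).mult Y = if Y = ⊤ then 0 else (A.hyps.filter fun H => H.comap f = Y).card := rfl

theorem mem_support_pull {A : Arrangement K V} {f : W →ₗ[K] V} {Y : Submodule K W} :
    Y ∈ (A.pull f).mult.support ↔ Y ≠ ⊤ ∧ ∃ H ∈ A.hyps, H.comap f = Y := by
  classical
  rw [Finsupp.mem_support_iff, pull_mult]
  split_ifs with h
  · simp [h]
  · simp [h, Finset.filter_eq_empty_iff]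

open scoped Classical in
theorem sum_mult_pull (A : Arrangement K V) (f : W →ₗ[K] V) :
    ∑ Y ∈ (A.pull f).mult.support, (A.pull f).mult Y =
      (A.hyps.filter fun H => H.comap f ≠ ⊤).card := by
  rw [Finset.card_eq_sum_card_fiberwise (f := fun H => H.comap f) (t := (A.pull f).mult.support)
    (fun H hH => by
      obtain ⟨h1, h2⟩ := Finset.mem_filter.mp hH
      exact mem_support_pull.mpr ⟨h2, H, h1, rfl⟩)]
  refine Finset.sum_congr rfl fun Y hY => ?_
  obtain ⟨hT, -⟩ := mem_support_pull.mp hY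
  rw [pull_mult, if_neg hT, Finset.filter_filter]
  congr 1
  refine Finset.filter_congr fun H _ => ⟨fun h => ⟨h ▸ hT, h⟩, fun h => h.2⟩

theorem mem_support_pull_id {A : Arrangement K V} {H : Submodule K V} :
    H ∈ (A.pull LinearMap.id).mult.support ↔ H ∈ A.hyps := by
  rw [mem_support_pull]
  constructor
  · rintro ⟨-, H', h, rfl⟩; simpa using h
  · exact fun h => ⟨(A.isHyperplane H h).ne_top, H, h, by simp⟩

theorem pull_id_mult {A : Arrangement K V} {H : Submodule K V} (h : H ∈ A.hyps) :
    (A.pull LinearMap.id).mult H = 1 := by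
  classical
  rw [pull_mult, if_neg (A.isHyperplane H h).ne_top, Finset.card_eq_one]
  refine ⟨H, ?_⟩
  ext H'
  simp only [Finset.mem_filter, Finset.mem_singleton]
  constructor
  · rintro ⟨-, h'⟩; simpa using h'
  · rintro rfl; exact ⟨h, by simp⟩

/-- Lets Saito's criterion, proved for multiarrangements, be applied to simple arrangements. -/
theorem derModule_pull_id (A : Arrangement K V) :
    (A.pull LinearMap.id).derModule = A.derModule := by
  ext θ
  rw [mem_derModule_iff, Multiarrangement.mem_derModule_iff]
  simp only [mem_support_pull_id]
  refine forall₂_congr fun H hH => ?_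
  rw [pull_id_mult hH, pow_one]

end Arrangement

end Forms

/-! ### Saito's criterion -/

section Saito

variable {K V : Type*} [Field K] [AddCommGroup V] [Module K V]
  {ι : Type*} [Fintype ι]

/-- The coefficient matrix of a family of derivations with respect to a basis of the dual space. -/
def sMat (x : Basis ι K (Dual K V)) (θ : ι → Der K V) : Matrix ι ι (CoordRing K V) :=
  Matrix.of fun i j => θ i (lin (x j))

theorem der_lin_eq_sum (x : Basis ι K (Dual K V)) (θ : Der K V) (α : Dual K V) :
    θ (lin α) = ∑ j, algebraMap K (CoordRing K V) (x.repr α j) * θ (lin (x j)) := by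
  conv_lhs => rw [← x.sum_repr α, lin_sum, map_sum]
  exact Finset.sum_congr rfl fun j _ => by rw [lin_smul, Derivation.map_smul, Algebra.smul_def]

variable [DecidableEq ι]

theorem isUnit_algebraMap {c : K} (hc : c ≠ 0) : IsUnit (algebraMap K (CoordRing K V) c) :=
  (IsUnit.mk0 c hc).map _

/-- Replacing a column on which `α` has nonzero coordinate by the values `θ i (lin α)` changes the
determinant only by a unit. -/
theorem dvd_det_sMat (x : Basis ι K (Dual K V)) (θ : ι → Der K V) {α : Dual K V} (h0 : α ≠ 0)
    {s : CoordRing K V} (h : ∀ i, s ∣ θ i (lin α)) : s ∣ (sMat x θ).det := by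
  obtain ⟨j, hj⟩ : ∃ j, x.repr α j ≠ 0 := by
    by_contra! h'
    exact h0 (x.repr.map_eq_zero_iff.mp (Finsupp.ext h'))
  have h1 := Matrix.det_updateCol_sum (sMat x θ) j
    (fun k => algebraMap K (CoordRing K V) (x.repr α k))
  have h2 : (fun i => ∑ k, algebraMap K (CoordRing K V) (x.repr α k) • sMat x θ i k) =
      fun i => θ i (lin α) := by
    funext i
    rw [der_lin_eq_sum x]
    rfl
  rw [h2] at h1
  choose g hg using h
  have h3 : (fun i => θ i (lin α)) = s • g := by funext i; simp [hg i]
  rw [h3, Matrix.det_updateCol_smul] at h1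
  have h4 : s ∣ algebraMap K (CoordRing K V) (x.repr α j) * (sMat x θ).det := by
    rw [← smul_eq_mul, ← h1]; exact dvd_mul_right _ _
  exact (isUnit_algebraMap hj).dvd_mul_left.mp h4

theorem defPoly_dvd_det [FiniteDimensional K V] {M : Multiarrangement K V}
    (x : Basis ι K (Dual K V)) {θ : ι → Der K V} (h : ∀ i, θ i ∈ M.derModule) :
    M.defPoly ∣ (sMat x θ).det :=
  Multiarrangement.defPoly_dvd fun H hH => dvd_det_sMat x θ
    (form_ne_zero (M.isHyperplane H hH)) fun i =>
      Multiarrangement.mem_derModule_iff.mp (h i) H hH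

theorem det_sMat_mem (x : Basis ι K (Dual K V)) {θ : ι → Der K V} {d : ι → ℕ}
    (h : ∀ i, HasPdeg (θ i) (d i)) : (sMat x θ).det ∈ homogPart K V (∑ i, d i) := by
  rw [Matrix.det_apply]
  refine Submodule.sum_mem _ fun σ _ => ?_
  have : ∏ i, sMat x θ (σ i) i ∈ homogPart K V (∑ i, d i) := by
    rw [← Equiv.sum_comp σ d]
    exact prod_mem_homogPart _ _ _ fun i _ => h (σ i) (x i)
  rcases Int.units_eq_one_or (Equiv.Perm.sign σ) with h' | h' <;> rw [h']
  · simpa using this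
  · simpa using this

/-- The determinant identity behind Cramer's rule for derivations. -/
theorem det_smul_eq_sum (x : Basis ι K (Dual K V)) (θ : ι → Der K V) (η : Der K V) :
    (sMat x θ).det • η = ∑ i, (sMat x (Function.update θ i η)).det • θ i := by
  refine der_ext_basis x fun j => ?_
  rw [der_sum_smul_apply, Derivation.smul_apply, smul_eq_mul]
  have h1 := congrFun (Matrix.mulVec_cramer (sMat x θ).transpose (fun k => η (lin (x k)))) j
  rw [Matrix.det_transpose, Pi.smul_apply, smul_eq_mul] at h1
  rw [← h1, Matrix.mulVec, dotProduct]
  refine Finset.sum_congr rfl fun i _ => ?_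
  rw [Matrix.cramer_transpose_apply, Matrix.transpose_apply, mul_comm]
  congr 2
  ext a b
  by_cases hab : a = i
  · subst hab; simp [sMat]
  · simp [sMat, hab]

theorem linearIndependent_of_det_ne_zero (x : Basis ι K (Dual K V)) {θ : ι → Der K V}
    (h : (sMat x θ).det ≠ 0) : LinearIndependent (CoordRing K V) θ := by
  rw [Fintype.linearIndependent_iff]
  intro c hc
  refine fun i => congrFun (Matrix.eq_zero_of_vecMul_eq_zero h (v := c) ?_) i
  funext j
  have := DFunLike.congr_fun hc (lin (x j))
  rw [der_sum_smul_apply] at this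
  simpa [Matrix.vecMul, dotProduct, sMat] using this

/-- By Cramer's rule the coefficients of `η` are quotients of determinants. Each numerator is the
determinant of a family in `D(𝒜, μ)`, hence divisible by the defining polynomial, which is the
denominator up to a unit. -/
theorem homBasis_of_det [FiniteDimensional K V] {M : Multiarrangement K V}
    (x : Basis ι K (Dual K V)) {θ : ι → Der K V} {d : ι → ℕ} (hmem : ∀ i, θ i ∈ M.derModule)
    (hdet : Associated (sMat x θ).det M.defPoly) (hd : ∀ i, HasPdeg (θ i) (d i)) :
    HomBasis M.derModule θ d := by
  have h0 : (sMat x θ).det ≠ 0 := (Associated.ne_zero_iff hdet).mpr M.defPoly_ne_zero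
  refine ⟨linearIndependent_of_det_ne_zero x h0, le_antisymm ?_ fun η hη => ?_, hd⟩
  · rw [Submodule.span_le]; rintro _ ⟨i, rfl⟩; exact hmem i
  · have h1 : ∀ i, (sMat x θ).det ∣ (sMat x (Function.update θ i η)).det := fun i => by
      refine hdet.dvd.trans (defPoly_dvd_det x fun k => ?_)
      by_cases hk : k = i
      · subst hk; rw [Function.update_self]; exact hη
      · rw [Function.update_of_ne hk]; exact hmem k
    choose c hc using h1
    have h2 : η = ∑ i, c i • θ i := by
      have := det_smul_eq_sum x θ η
      refine der_ext fun α => mul_left_cancel₀ h0 ?_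
      have h3 := DFunLike.congr_fun this (lin α)
      rw [der_sum_smul_apply, Derivation.smul_apply, smul_eq_mul] at h3
      rw [h3, der_sum_smul_apply, Finset.mul_sum]
      exact Finset.sum_congr rfl fun i _ => by rw [hc i]; ring
    rw [h2]
    exact Submodule.sum_mem _ fun i _ => Submodule.smul_mem _ _ (Submodule.subset_span ⟨i, rfl⟩)

theorem det_sMat_dvd (x : Basis ι K (Dual K V)) {θ δ : ι → Der K V}
    (h : ∀ i, δ i ∈ Submodule.span (CoordRing K V) (Set.range θ)) :
    (sMat x θ).det ∣ (sMat x δ).det := by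
  choose c hc using fun i => (Submodule.mem_span_range_iff_exists_fun _).mp (h i)
  have : sMat x δ = Matrix.of c * sMat x θ := by
    ext i j
    simp only [sMat, Matrix.of_apply, Matrix.mul_apply, ← hc]
    exact der_sum_smul_apply _ _ _ _
  rw [this, Matrix.det_mul]
  exact dvd_mul_left _ _

end Saito

end HypArr

end

noncomputable section

namespace HypArr

/-! ### Saito's criterion: the determinant of a basis, and the version by degrees. -/

section Saito

set_option linter.unusedSectionVars false

variable {K V : Type*} [Field K] [AddCommGroup V] [Module K V]
  {ι : Type*} [Fintype ι] [DecidableEq ι]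

theorem det_sMat_dvd_of_basis (x y : Basis ι K (Dual K V)) (θ : ι → Der K V) :
    (sMat x θ).det ∣ (sMat y θ).det := by
  have : sMat y θ = sMat x θ *
      Matrix.of fun j k => algebraMap K (CoordRing K V) (x.repr (y k) j) := by
    ext i k
    simp only [sMat, Matrix.of_apply, Matrix.mul_apply]
    rw [der_lin_eq_sum x]
    exact Finset.sum_congr rfl fun j _ => mul_comm _ _
  rw [this, Matrix.det_mul]
  exact dvd_mul_right _ _

theorem exists_basis_apply_eq (x : Basis ι K (Dual K V)) {α : Dual K V} (h0 : α ≠ 0) :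
    ∃ (y : Basis ι K (Dual K V)) (j : ι), y j = α := by
  obtain ⟨j, hj⟩ : ∃ j, x.repr α j ≠ 0 := by
    by_contra! h'
    exact h0 (x.repr.map_eq_zero_iff.mp (Finsupp.ext h'))
  obtain ⟨h1, h2⟩ := linearIndependent_and_span_exchange x.linearIndependent j
    (x.sum_repr α).symm (IsUnit.mk0 _ hj)
  refine ⟨Basis.mk h1 (by rw [h2, x.span_eq]), j, ?_⟩
  simp

/-- The partial derivatives with respect to a basis of the dual space. -/
def partialDer (x : Basis ι K (Dual K V)) (i : ι) : Der K V :=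
  mkDer (Algebra.linearMap K (CoordRing K V) ∘ₗ x.coord i)

theorem partialDer_lin (x : Basis ι K (Dual K V)) (i j : ι) :
    partialDer x i (lin (x j)) = if i = j then 1 else 0 := by
  rw [partialDer, mkDer_lin]
  simp only [LinearMap.comp_apply, Basis.coord_apply, Basis.repr_self, Algebra.linearMap_apply]
  rw [Finsupp.single_apply]
  split_ifs with h1 h2 h2
  · simp
  · exact absurd h1.symm h2
  · exact absurd h2.symm h1
  · simp

theorem hasPdeg_partialDer (x : Basis ι K (Dual K V)) (i : ι) : HasPdeg (partialDer x i) 0 :=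
  fun α => by
    rw [partialDer, mkDer_lin]
    exact mem_homogPart_zero.mpr ⟨_, rfl⟩

theorem det_sMat_smul_partialDer (x : Basis ι K (Dual K V)) (c : ι → CoordRing K V) :
    (sMat x fun i => c i • partialDer x i).det = ∏ i, c i := by
  rw [← Matrix.det_diagonal]
  congr 1
  ext i j
  simp only [sMat, Matrix.of_apply, Derivation.smul_apply, partialDer_lin, Matrix.diagonal_apply,
    smul_eq_mul]
  split_ifs <;> simp

/-- The coefficient matrix of a basis of `D(𝒜, μ)` has determinant `∏ α_H ^ μ(H)`, up to a
unit. -/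
theorem HomBasis.associated_det [FiniteDimensional K V] {M : Multiarrangement K V}
    (x : Basis ι K (Dual K V)) {θ : ι → Der K V} {d : ι → ℕ} (h : HomBasis M.derModule θ d) :
    Associated (sMat x θ).det M.defPoly := by
  classical
  obtain ⟨g, hg⟩ := defPoly_dvd_det x h.mem
  have hdvd : ∀ (y : Basis ι K (Dual K V)) (c : ι → CoordRing K V),
      (∀ i, c i • partialDer y i ∈ M.derModule) → M.defPoly * g ∣ ∏ i, c i := fun y c hc => by
    rw [← hg, ← det_sMat_smul_partialDer y]
    exact (det_sMat_dvd_of_basis x y θ).trans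
      (det_sMat_dvd y fun i => h.span_eq.ge (hc i))
  -- Every `Q ∂_i` lies in `D(𝒜, μ)`, and the determinant of this family is a power of `Q`. So only
  -- the forms of the arrangement can divide the surplus factor `g`.
  have h1 : g ∣ M.defPoly ^ Fintype.card ι := by
    refine (dvd_mul_left _ _).trans (hdvd x (fun _ => M.defPoly) fun i => ?_) |>.trans ?_
    · rw [Multiarrangement.mem_derModule_iff]
      intro H hH
      exact (Finset.dvd_prod_of_mem _ hH).trans (Dvd.intro _ rfl)
    · rw [Finset.prod_const, Finset.card_univ]
  have h2 : ∀ H ∈ M.mult.support, ¬ lin (form H) ∣ g := by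
    intro H hH hdg
    have hHyp := M.isHyperplane H hH
    obtain ⟨y, j, hy⟩ := exists_basis_apply_eq x (form_ne_zero hHyp)
    set R := ∏ H' ∈ M.mult.support.erase H, lin (form H') ^ M.mult H' with hR
    have hQ : M.defPoly = R * lin (form H) ^ M.mult H := by
      rw [Multiarrangement.defPoly, hR, Finset.prod_erase_mul _ _ hH]
    -- In coordinates with `y j = α_H`, the family `R ∂_i` for `i ≠ j` together with `R α_H ^ μ(H)
    -- ∂_j` lies in `D(𝒜, μ)`. Cancelling `α_H ^ μ(H)` leaves `R g ∣ R ^ n`, so `α_H ∣ g` would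
    -- force `α_H ∣ R`.
    have h3 := hdvd y (fun i => R * if i = j then lin (form H) ^ M.mult H else 1) fun i => by
      rw [Multiarrangement.mem_derModule_iff]
      intro H' hH'
      rw [Derivation.smul_apply, smul_eq_mul]
      by_cases hHH : H' = H
      · subst hHH
        rw [← hy, partialDer_lin]
        split_ifs with hij
        · rw [hy, mul_one]; exact dvd_mul_left _ _
        · rw [mul_zero]; exact dvd_zero _
      · rw [mul_assoc]
        exact (Finset.dvd_prod_of_mem _ (Finset.mem_erase.mpr ⟨hHH, hH'⟩)).mul_right _
    rw [Finset.prod_mul_distrib, Finset.prod_const, Finset.prod_ite_eq' Finset.univ j,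
      if_pos (Finset.mem_univ j), hQ, mul_right_comm] at h3
    have hne : lin (form H) ^ M.mult H ≠ 0 := pow_ne_zero _ (lin_ne_zero (form_ne_zero hHyp))
    have h4 := (mul_dvd_mul_iff_right hne).mp h3
    have hp := prime_lin (form_ne_zero hHyp)
    have h5 := hp.dvd_of_dvd_pow ((hdg.trans (dvd_mul_left _ _)).trans h4)
    obtain ⟨H', hH', h6⟩ := (hp.dvd_finsetProd_iff _).mp h5
    have h7 := lin_dvd_lin_iff.mp (hp.dvd_of_dvd_pow h6)
    have hHyp' := M.isHyperplane H' (Finset.mem_of_mem_erase hH')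
    rw [ker_form hHyp, ker_form hHyp'] at h7
    exact Finset.ne_of_mem_erase hH' (hHyp.eq_of_le hHyp' h7).symm
  have h3 : IsUnit g := by
    by_contra hu
    have hg0 : g ≠ 0 := by
      rintro rfl
      exact pow_ne_zero _ M.defPoly_ne_zero (zero_dvd_iff.mp h1)
    obtain ⟨p, hp, hpg⟩ := WfDvdMonoid.exists_irreducible_factor hu hg0
    have hp' := UniqueFactorizationMonoid.irreducible_iff_prime.mp hp
    obtain ⟨H, hH, h6⟩ := (hp'.dvd_finsetProd_iff _).mp
      (hp'.dvd_of_dvd_pow (hpg.trans h1))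
    have h7 := hp'.dvd_of_dvd_pow h6
    have h8 := hp.associated_of_dvd (prime_lin (form_ne_zero (M.isHyperplane H hH))).irreducible h7
    exact h2 H hH (h8.symm.dvd.trans hpg)
  rw [hg]
  exact (associated_mul_unit_left _ _ h3)

theorem HomBasis.sum_eq [FiniteDimensional K V] {M : Multiarrangement K V}
    (x : Basis ι K (Dual K V)) {θ : ι → Der K V} {d : ι → ℕ} (h : HomBasis M.derModule θ d) :
    ∑ i, d i = ∑ H ∈ M.mult.support, M.mult H :=
  eq_of_associated_of_mem_homogPart (h.associated_det x).symm M.defPoly_ne_zero M.defPoly_mem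
    (det_sMat_mem x h.pdeg) |>.symm

/-- Saito's criterion: independent homogeneous elements of `D(𝒜, μ)` whose degrees add up to `|μ|`
form a basis. -/
theorem homBasis_of_sum_eq [FiniteDimensional K V] {M : Multiarrangement K V}
    (x : Basis ι K (Dual K V)) {θ : ι → Der K V} {d : ι → ℕ} (hmem : ∀ i, θ i ∈ M.derModule)
    (hdet : (sMat x θ).det ≠ 0) (hd : ∀ i, HasPdeg (θ i) (d i))
    (hsum : ∑ i, d i = ∑ H ∈ M.mult.support, M.mult H) : HomBasis M.derModule θ d := by
  refine homBasis_of_det x hmem ?_ hd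
  obtain ⟨g, hg⟩ := defPoly_dvd_det x hmem
  -- The determinant and the defining polynomial have the same degree, so their quotient is a
  -- constant.
  have h1 := (mem_homogPart_of_mul M.defPoly_mem (hg ▸ hdet) (hg ▸ det_sMat_mem x hd)).2
  rw [hsum, Nat.sub_self] at h1
  obtain ⟨c, rfl⟩ := mem_homogPart_zero.mp h1
  rw [hg]
  refine associated_mul_unit_left _ _ (isUnit_algebraMap ?_)
  rintro rfl
  rw [map_zero, mul_zero] at hg
  exact hdet hg

theorem det_sMat_ne_zero (x : Basis ι K (Dual K V)) {θ : ι → Der K V}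
    (h : LinearIndependent (CoordRing K V) θ) : (sMat x θ).det ≠ 0 := by
  intro h0
  obtain ⟨c, hc, hc0⟩ := Matrix.exists_vecMul_eq_zero_iff.mpr h0
  refine hc (funext fun i => Fintype.linearIndependent_iff.mp h c (der_ext_basis x fun j => ?_) i)
  rw [der_sum_smul_apply, Derivation.zero_apply]
  exact congrFun hc0 j

/-- Saito's criterion: independent homogeneous elements of `D(𝒜, μ)` whose degrees add up to `|μ|`
form a basis. -/
theorem homBasis_of_linearIndependent [FiniteDimensional K V] {M : Multiarrangement K V}
    (x : Basis ι K (Dual K V)) {θ : ι → Der K V} {d : ι → ℕ} (hmem : ∀ i, θ i ∈ M.derModule)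
    (hli : LinearIndependent (CoordRing K V) θ) (hd : ∀ i, HasPdeg (θ i) (d i))
    (hsum : ∑ i, d i = ∑ H ∈ M.mult.support, M.mult H) : HomBasis M.derModule θ d :=
  homBasis_of_sum_eq x hmem (det_sMat_ne_zero x hli) hd hsum

variable (K V) in
theorem exists_dual_basis [FiniteDimensional K V] {κ : Type*} [Fintype κ]
    (hn : Fintype.card κ = finrank K V) : Nonempty (Basis κ K (Dual K V)) :=
  ⟨(finBasisOfFinrankEq K (Dual K V) Subspace.dual_finrank_eq).reindex
    (Fintype.equivFinOfCardEq hn).symm⟩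

end Saito

end HypArr

end

noncomputable section

namespace HypArr

/-! ### Restricting bases -/

section Restrict

variable {K V W : Type*} [Field K] [AddCommGroup V] [Module K V] [AddCommGroup W] [Module K W]

theorem finrank_add_one_of_range_eq [FiniteDimensional K V] {f : W →ₗ[K] V}
    (hf : Function.Injective f) {α₀ : Dual K V} (h0 : α₀ ≠ 0)
    (hr : LinearMap.range f = LinearMap.ker α₀) : finrank K W + 1 = finrank K V := by
  rw [← LinearMap.finrank_range_of_inj hf, hr]
  exact Dual.finrank_ker_add_one_of_ne_zero h0

/-- A relation between the restrictions lifts to a combination that restricts to zero, hence equals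
`α₀ ζ`. By `hD` the factor `ζ` lies in `D`; expanding it in the basis shows that the lifted
coefficients are divisible by `α₀`, so the original ones vanish. -/
theorem linearIndependent_of_rel {ι κ : Type*} [Fintype ι] [Fintype κ] {f : W →ₗ[K] V}
    (hf : Function.Injective f) {α₀ : Dual K V} (h0 : α₀ ≠ 0)
    (hr : LinearMap.range f = LinearMap.ker α₀) {D : Submodule (CoordRing K V) (Der K V)}
    {θ : ι → Der K V} {d : ι → ℕ} (h : HomBasis D θ d) {g : κ → ι} (hg : Function.Injective g)
    {η : κ → Der K W} (hrel : ∀ k, Rel f (θ (g k)) (η k))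
    (hD : ∀ ζ : Der K V, lin α₀ • ζ ∈ Submodule.span (CoordRing K V) (Set.range (θ ∘ g)) →
      ζ ∈ D) : LinearIndependent (CoordRing K W) η := by
  classical
  rw [Fintype.linearIndependent_iff]
  intro c hc
  choose b hb using fun k => res_surjective hf (c k)
  have h1 : Rel f (∑ k, b k • θ (g k)) (∑ k, c k • η k) := Rel.sum _ fun k _ => by
    rw [← hb]; exact (hrel k).smul (b k)
  rw [hc] at h1
  obtain ⟨ζ, hζ⟩ := h1.exists_eq_smul_of_zero hf h0 hr
  have h2 : ζ ∈ D := hD ζ (hζ ▸ Submodule.sum_mem _ fun k _ =>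
    Submodule.smul_mem _ _ (Submodule.subset_span ⟨k, rfl⟩))
  obtain ⟨e, rfl⟩ := h.exists_sum h2
  have h3 : ∑ i, (∑ k, if g k = i then b k else 0) • θ i = ∑ i, (lin α₀ * e i) • θ i := by
    have h4 : ∑ k, b k • θ (g k) = ∑ i, (∑ k, if g k = i then b k else 0) • θ i := by
      simp_rw [Finset.sum_smul]
      rw [Finset.sum_comm]
      refine Finset.sum_congr rfl fun k _ => ?_
      rw [Finset.sum_eq_single (g k)]
      · rw [if_pos rfl]
      · intro i _ hi; rw [if_neg (Ne.symm hi), zero_smul]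
      · intro h; exact absurd (Finset.mem_univ _) h
    rw [← h4, hζ, Finset.smul_sum]
    exact Finset.sum_congr rfl fun i _ => smul_smul _ _ _
  intro k
  have h5 := congrFun (h.eq_of_sum_eq h3) (g k)
  rw [Finset.sum_eq_single k (fun k' _ hk' => if_neg fun h => hk' (hg h))
    (fun h => absurd (Finset.mem_univ _) h), if_pos rfl] at h5
  rw [← hb, h5, map_mul, res_lin_eq_zero hr, zero_mul]

/-- A derivation in `D(𝒜)` that is tangent to `W` in the strong sense restricts to the pulled back
multiarrangement. -/
theorem mem_derModule_pull [FiniteDimensional K V] {A : Arrangement K V} {f : W →ₗ[K] V}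
    {θ : Der K V} {η : Der K W} (hθ : θ ∈ A.derModule) (hrel : Rel f θ η)
    (h0 : ∀ α : Dual K V, α ∘ₗ f = 0 → θ (lin α) = 0) : η ∈ (A.pull f).derModule := by
  classical
  rw [Multiarrangement.mem_derModule_iff]
  intro Y hY
  obtain ⟨hT, H₁, hH₁, hY₁⟩ := Arrangement.mem_support_pull.mp hY
  have hYh := (A.pull f).isHyperplane Y hY
  have hker : ∀ H ∈ A.hyps, H.comap f = Y →
      LinearMap.ker (form H ∘ₗ f) = LinearMap.ker (form Y) := fun H hH h => by
    rw [LinearMap.ker_comp, ker_form (A.isHyperplane H hH), h, ker_form hYh]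
  set F := A.hyps.filter fun H => H.comap f = Y with hF
  -- All forms in the fibre over `Y` agree with multiples of `form H₁` up to forms vanishing on the
  -- image of `f`, which `θ` kills. So each of these pairwise coprime forms divides the same value.
  have h1 : ∏ H ∈ F, lin (form H) ∣ θ (lin (form H₁)) := by
    refine Finset.prod_dvd_of_isRelPrime (fun H hH H' hH' hne => ?_) fun H hH => ?_
    · have hH := A.isHyperplane H (Finset.mem_filter.mp hH).1
      have hH' := A.isHyperplane H' (Finset.mem_filter.mp hH').1
      refine isRelPrime_lin (form_ne_zero hH) (form_ne_zero hH') ?_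
      rwa [ker_form hH, ker_form hH']
    · obtain ⟨hHA, hHY⟩ := Finset.mem_filter.mp hH
      obtain ⟨c, hc⟩ := exists_smul_of_ker_le
        ((hker H hHA hHY).trans (hker H₁ hH₁ hY₁).symm).le
      have h2 := h0 (form H₁ - c • form H) (by
        rw [LinearMap.sub_comp, hc, LinearMap.smul_comp, sub_self])
      rw [lin_sub, map_sub, lin_smul, Derivation.map_smul, sub_eq_zero] at h2
      rw [h2]
      exact dvd_smul_of_dvd c (Arrangement.mem_derModule_iff.mp hθ H hHA)
  have h2 := map_dvd (res f) h1
  rw [map_prod, ← hrel] at h2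
  have h3 : (A.pull f).mult Y = F.card := by rw [Arrangement.pull_mult, if_neg hT]
  rw [h3]
  have h4 : Associated (∏ H ∈ F, lin (form Y)) (∏ H ∈ F, res f (lin (form H))) :=
    Associated.prod _ _ _ fun H hH => by
      rw [res_lin]
      exact associated_lin (hker H (Finset.mem_filter.mp hH).1 (Finset.mem_filter.mp hH).2).symm
  have h5 := h4.dvd.trans h2
  rw [Finset.prod_const] at h5
  obtain ⟨c, hc⟩ := exists_smul_of_ker_le (hker H₁ hH₁ hY₁).le
  have h6 : η (lin (form Y)) = c • η (lin (form H₁ ∘ₗ f)) := by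
    rw [hc, lin_smul, Derivation.map_smul]
  rw [h6]
  exact dvd_smul_of_dvd c h5

/-- Weak form: the restriction of `θ ∈ D(𝒜)` lies in the module of the underlying simple
arrangement. -/
theorem lin_dvd_of_rel {A : Arrangement K V} {f : W →ₗ[K] V} {θ : Der K V} {η : Der K W}
    (hθ : θ ∈ A.derModule) (hrel : Rel f θ η) {H : Submodule K V} (hH : H ∈ A.hyps) {β : Dual K W}
    (hβ : LinearMap.ker β = H.comap f) : lin β ∣ η (lin β) := by
  have h1 : lin (form H ∘ₗ f) ∣ η (lin (form H ∘ₗ f)) := by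
    rw [hrel, ← res_lin]
    exact map_dvd (res f) (Arrangement.mem_derModule_iff.mp hθ H hH)
  have h2 : LinearMap.ker (form H ∘ₗ f) = LinearMap.ker β := by
    rw [LinearMap.ker_comp, ker_form (A.isHyperplane H hH), hβ]
  simpa using dvd_of_ker_eq (m := 1) h2 (by simpa using h1)

theorem mem_derModule_restriction {A : Arrangement K V} {X : Submodule K V} {θ : Der K V}
    {η : Der K X} (hθ : θ ∈ A.derModule) (hrel : Rel X.subtype θ η) :
    η ∈ (A.restriction X).derModule := by
  classical
  intro Y hY β hβ
  obtain ⟨H, hH, rfl⟩ := Finset.mem_image.mp hY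
  exact lin_dvd_of_rel hθ hrel (Finset.mem_filter.mp hH).1 hβ

theorem HomBasis.arrangement_sum_eq [FiniteDimensional K V] {A : Arrangement K V} {ι : Type*}
    [Fintype ι] (hι : Fintype.card ι = finrank K V) {θ : ι → Der K V} {d : ι → ℕ}
    (h : HomBasis A.derModule θ d) : ∑ i, d i = A.hyps.card := by
  classical
  obtain ⟨x⟩ := exists_dual_basis K V hι
  rw [← Arrangement.derModule_pull_id] at h
  rw [h.sum_eq x, Arrangement.sum_mult_pull]
  congr 1
  exact Finset.filter_true_of_mem fun H hH => by simpa using (A.isHyperplane H hH).ne_top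

/-- Homogeneous bases are transported along isomorphisms. -/
theorem HomBasis.pull_of_bijective [FiniteDimensional K V] {A : Arrangement K V} {ι : Type*}
    [Fintype ι] (hι : Fintype.card ι = finrank K V) {θ : ι → Der K V} {d : ι → ℕ}
    (h : HomBasis A.derModule θ d) {f : W →ₗ[K] V} (hf : Function.Bijective f) :
    ∃ η : ι → Der K W, (∀ i, Rel f (θ i) (η i)) ∧ HomBasis (A.pull f).derModule η d := by
  classical
  let e := LinearEquiv.ofBijective f hf
  have : FiniteDimensional K W := e.symm.finiteDimensional
  have hW : Fintype.card ι = finrank K W := hι.trans e.finrank_eq.symm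
  obtain ⟨x⟩ := exists_dual_basis K W hW
  choose η hη using fun i => exists_rel_of_bijective hf (θ i)
  have hinj : ∀ α : Dual K V, α ∘ₗ f = 0 → α = 0 := fun α hα => by
    ext v
    obtain ⟨w, rfl⟩ := hf.2 v
    exact LinearMap.congr_fun hα w
  refine ⟨η, hη, homBasis_of_linearIndependent x (fun i => ?_) ?_
    (fun i => (hη i).hasPdeg hf.1 (h.pdeg i)) ?_⟩
  · exact mem_derModule_pull (h.mem i) (hη i) fun α hα => by rw [hinj α hα, lin_zero, map_zero]
  · rw [Fintype.linearIndependent_iff]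
    intro c hc
    choose b hb using fun k => res_surjective hf.1 (c k)
    have hres : ∀ s : CoordRing K V, res f s = 0 → s = 0 := fun s hs => by
      have h1 := res_comp e.symm.toLinearMap f
      have h2 := res_comp f e.symm.toLinearMap s
      rw [hs, map_zero] at h2
      have h3 : f ∘ₗ e.symm.toLinearMap = LinearMap.id := by
        ext v; exact e.apply_symm_apply v
      rwa [h3, res_id] at h2
    have h1 : Rel f (∑ k, b k • θ k) (∑ k, c k • η k) := Rel.sum _ fun k _ => by
      rw [← hb]; exact (hη k).smul (b k)
    rw [hc] at h1
    have h2 : ∑ k, b k • θ k = 0 := der_ext fun α => hres _ (by rw [← h1 α]; simp)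
    intro i
    rw [← hb, Fintype.linearIndependent_iff.mp h.linInd b h2 i, map_zero]
  · rw [h.arrangement_sum_eq hι, Arrangement.sum_mult_pull]
    congr 1
    refine (Finset.filter_true_of_mem fun H hH (hT : H.comap f = ⊤) =>
      (A.isHyperplane H hH).ne_top ?_).symm
    rw [eq_top_iff]
    intro v _
    obtain ⟨w, rfl⟩ := hf.2 v
    have : w ∈ H.comap f := hT ▸ Submodule.mem_top
    exact this

/-- The coefficient of the Euler derivation at some basis element of degree one is invertible. -/
theorem HomBasis.exists_isUnit_coeff {A : Arrangement K V} {H₀ : Submodule K V}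
    (hH₀ : H₀ ∈ A.hyps) {ι : Type*} [Fintype ι] {θ : ι → Der K V} {d : ι → ℕ}
    (h : HomBasis A.derModule θ d) {c : ι → CoordRing K V}
    (hc : eulerDer K V = ∑ i, c i • θ i) : ∃ j, d j = 1 ∧ IsUnit (c j) := by
  by_contra! hcon
  have h0 := form_ne_zero (A.isHyperplane H₀ hH₀)
  refine lin_ne_zero h0 ?_
  rw [← eulerDer_lin, hc, der_sum_smul_apply]
  refine Finset.sum_eq_zero fun i _ => ?_
  have h1 := h.coeff_mem hasPdeg_eulerDer hc i
  rcases Nat.lt_trichotomy (d i) 1 with hd | hd | hd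
  · have h2 : θ i (lin (form H₀)) = 0 := by
      obtain ⟨s, hs⟩ := Arrangement.mem_derModule_iff.mp (h.mem i) H₀ hH₀
      by_contra hne
      have h3 := h.pdeg i (form H₀)
      rw [hs] at hne h3
      have := (mem_homogPart_of_mul (lin_mem_homogPart (form H₀)) hne h3).1
      omega
    rw [h2, mul_zero]
  · have h2 := h1.1 hd.le
    rw [hd, Nat.sub_self] at h2
    obtain ⟨b, hb⟩ := mem_homogPart_zero.mp h2
    have hb0 : b = 0 := by
      by_contra hb0
      exact hcon i hd (hb ▸ isUnit_algebraMap hb0)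
    rw [← hb, hb0, map_zero, zero_mul]
  · rw [h1.2 (by omega), zero_mul]

/-- A homogeneous basis of `D(𝒜)` that contains the Euler derivation, the other members being
modified by multiples of it as prescribed. -/
theorem HomBasis.exists_euler {A : Arrangement K V} {H₀ : Submodule K V}
    (hH₀ : H₀ ∈ A.hyps) {ι : Type*} [Fintype ι] [DecidableEq ι] {θ : ι → Der K V} {d : ι → ℕ}
    (h : HomBasis A.derModule θ d) :
    ∃ j, d j = 1 ∧ ∀ r : ι → CoordRing K V, (∀ i, HasPdeg (r i • eulerDer K V) (d i)) →
      HomBasis A.derModule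
        (Function.update (fun i => θ i - r i • eulerDer K V) j (eulerDer K V)) d := by
  obtain ⟨c, hc⟩ := h.exists_sum A.eulerDer_mem
  obtain ⟨j, hj, hu⟩ := h.exists_isUnit_coeff hH₀ hc
  refine ⟨j, hj, fun r hr => ?_⟩
  have h1 := h.exchange j hc hu (hj ▸ hasPdeg_eulerDer)
  have h2 := h1.step le_rfl j one_ne_zero one_mem_homogPart r
    (fun i hi => A.derModule.sub_mem (h1.mem i) (A.derModule.smul_mem _ (h1.mem j)))
    (A.derModule.smul_mem _ (h1.mem j)) (fun c _ => one_dvd c)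
    (fun i hi => by rw [Function.update_self]; exact hr i)
  convert h2 using 1
  · funext i
    by_cases hij : i = j
    · subst hij; simp
    · simp [hij]
  · simp

/-- Ziegler's theorem. -/
theorem HomBasis.ziegler [FiniteDimensional K V] {A : Arrangement K V} {H₀ : Submodule K V}
    (hH₀ : H₀ ∈ A.hyps) {f : W →ₗ[K] V} (hf : Function.Injective f) (hr : LinearMap.range f = H₀)
    {ι : Type*} [Fintype ι] [DecidableEq ι] (hι : Fintype.card ι = finrank K V)
    {θ : ι → Der K V} {d : ι → ℕ} (h : HomBasis A.derModule θ d) :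
    ∃ j, d j = 1 ∧ ∃ (ψ : {i // i ≠ j} → Der K V) (η : {i // i ≠ j} → Der K W),
      (∀ i, ψ i ∈ A.derModule ∧ ψ i (lin (form H₀)) = 0) ∧ (∀ i, Rel f (ψ i) (η i)) ∧
      HomBasis (A.pull f).derModule η (fun i => d i) := by
  classical
  have hHyp := A.isHyperplane H₀ hH₀
  have h0 := form_ne_zero hHyp
  have hr' : LinearMap.range f = LinearMap.ker (form H₀) := hr.trans (ker_form hHyp).symm
  have : FiniteDimensional K W := FiniteDimensional.of_injective f hf
  obtain ⟨j, hj, H⟩ := h.exists_euler hH₀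
  choose r hrd using fun i => Arrangement.mem_derModule_iff.mp (h.mem i) H₀ hH₀
  -- As `θ i (α) = α r i`, subtracting `r i` times the Euler derivation makes the value at `α` zero.
  have h1 := H r fun i => by
    by_cases hz : r i = 0
    · rw [hz, zero_smul]; exact hasPdeg_zero _
    · have h2 := mem_homogPart_of_mul (lin_mem_homogPart (form H₀))
        (mul_ne_zero (lin_ne_zero h0) hz) (hrd i ▸ h.pdeg i (form H₀))
      have h3 := hasPdeg_eulerDer.smul h2.2
      rwa [Nat.sub_add_cancel h2.1] at h3
  set θ' := Function.update (fun i => θ i - r i • eulerDer K V) j (eulerDer K V) with hθ'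
  have hψ : ∀ i : {i // i ≠ j}, θ' i (lin (form H₀)) = 0 := fun i => by
    rw [hθ', Function.update_of_ne i.2]
    simp [hrd, mul_comm]
  have hker : ∀ α : Dual K V, α ∘ₗ f = 0 → ∃ c : K, α = c • form H₀ := fun α hα =>
    exists_smul_of_ker_le (by
      rw [← hr']
      rintro _ ⟨w, rfl⟩
      exact LinearMap.congr_fun hα w)
  choose η hη using fun i : {i // i ≠ j} =>
    exists_rel_of_dvd hf hr' (θ := θ' i) (by rw [hψ i]; exact dvd_zero _)
  have hfr := finrank_add_one_of_range_eq hf h0 hr'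
  have hcard : Fintype.card {i // i ≠ j} = finrank K W := by
    rw [Fintype.card_subtype_compl, Fintype.card_subtype_eq, hι]; omega
  obtain ⟨x⟩ := exists_dual_basis K W hcard
  refine ⟨j, hj, fun i => θ' i, η, fun i => ⟨h1.mem i, hψ i⟩, hη,
    homBasis_of_linearIndependent x (fun i => ?_) ?_
    (fun i => (hη i).hasPdeg hf (h1.pdeg i)) ?_⟩
  · refine mem_derModule_pull (h1.mem i) (hη i) fun α hα => ?_
    obtain ⟨c, rfl⟩ := hker α hα
    rw [lin_smul, Derivation.map_smul, hψ, smul_zero]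
  · refine linearIndependent_of_rel hf h0 hr' h1 (g := Subtype.val) Subtype.val_injective hη ?_
    intro ζ hζ
    have h2 : lin (form H₀) • ζ ∈ A.derModule := by
      refine Submodule.span_le.mpr ?_ hζ
      rintro _ ⟨i, rfl⟩; exact h1.mem i
    -- Combinations of the modified members kill `α₀`. This supplies the condition at `H₀` that
    -- division by `α₀` could otherwise destroy.
    have h3 : ζ (lin (form H₀)) = 0 := by
      obtain ⟨c, hc⟩ := (Submodule.mem_span_range_iff_exists_fun _).mp hζ
      have h4 := DFunLike.congr_fun hc (lin (form H₀))
      rw [der_sum_smul_apply, Finset.sum_eq_zero fun i _ => by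
        rw [Function.comp_apply, hψ i, mul_zero], Derivation.smul_apply, smul_eq_mul] at h4
      exact (mul_eq_zero.mp h4.symm).resolve_left (lin_ne_zero h0)
    rw [Arrangement.mem_derModule_iff] at h2 ⊢
    intro H' hH'
    by_cases hHH : H' = H₀
    · rw [hHH, h3]; exact dvd_zero _
    · have hHyp' := A.isHyperplane H' hH'
      have h4 := h2 H' hH'
      rw [Derivation.smul_apply, smul_eq_mul] at h4
      refine (isRelPrime_lin (form_ne_zero hHyp') h0 ?_).dvd_of_dvd_mul_left h4
      rwa [ker_form hHyp', ker_form hHyp]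
  · have h2 : ∑ i, d i = d j + ∑ i : {i // i ≠ j}, d i := Fintype.sum_eq_add_sum_subtype_ne d j
    have h3 := h.arrangement_sum_eq hι
    rw [Arrangement.sum_mult_pull]
    have h4 : A.hyps.filter (fun H => H.comap f ≠ ⊤) = A.hyps.erase H₀ := by
      ext H'
      rw [Finset.mem_filter, Finset.mem_erase, and_comm]
      refine and_congr_left fun hH' => not_congr ?_
      constructor
      · intro hT
        refine (hHyp.eq_of_le (A.isHyperplane H' hH') ?_).symm
        rw [← hr]
        rintro _ ⟨w, rfl⟩
        exact hT.ge (Submodule.mem_top (x := w))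
      · rintro rfl
        rw [eq_top_iff]
        intro w _
        exact hr.le (LinearMap.mem_range_self f w)
    rw [h4, Finset.card_erase_of_mem hH₀]
    omega

end Restrict

end HypArr

end

noncomputable section

namespace HypArr

/-! ### The addition theorem -/

section Addition

variable {K V W : Type*} [Field K] [AddCommGroup V] [Module K V] [AddCommGroup W] [Module K W]

theorem comap_eq_top_iff_of_range_eq {H H' : Submodule K V} {f : W →ₗ[K] V}
    (hr : LinearMap.range f = H) : H'.comap f = ⊤ ↔ H ≤ H' := by
  rw [← hr, LinearMap.range_eq_map, Submodule.map_le_iff_le_comap, top_le_iff]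

open scoped Classical in
theorem filter_comap_ne_top {A : Arrangement K V} {H : Submodule K V} (hH : H ∈ A.hyps)
    {f : W →ₗ[K] V} (hr : LinearMap.range f = H) :
    A.hyps.filter (fun H' => H'.comap f ≠ ⊤) = A.hyps.erase H := by
  ext H'
  rw [Finset.mem_filter, Finset.mem_erase, and_comm]
  refine and_congr_left fun hH' => not_congr ?_
  rw [comap_eq_top_iff_of_range_eq hr]
  exact ⟨fun h => ((A.isHyperplane H hH).eq_of_le (A.isHyperplane H' hH') h).symm,
    fun h => h.ge⟩

theorem mem_restriction {A : Arrangement K V} {X : Submodule K V} {Y : Submodule K X} :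
    Y ∈ (A.restriction X).hyps ↔ ∃ H ∈ A.hyps, ¬ X ≤ H ∧ H.comap X.subtype = Y := by
  classical
  rw [Arrangement.restriction, Finset.mem_image]
  simp only [Finset.mem_filter, and_assoc]

theorem support_pull_subtype (A : Arrangement K V) (X : Submodule K V) :
    (A.pull X.subtype).mult.support = (A.restriction X).hyps := by
  ext Y
  rw [Arrangement.mem_support_pull, mem_restriction]
  constructor
  · rintro ⟨hT, H, hH, rfl⟩
    exact ⟨H, hH, fun h => hT ((comap_eq_top_iff_of_range_eq X.range_subtype).mpr h), rfl⟩
  · rintro ⟨H, hH, hX, rfl⟩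
    exact ⟨fun h => hX ((comap_eq_top_iff_of_range_eq X.range_subtype).mp h), H, hH, rfl⟩

theorem mem_deletion {A : Arrangement K V} {H H' : Submodule K V} :
    H' ∈ (A.deletion H).hyps ↔ H' ≠ H ∧ H' ∈ A.hyps := by
  classical
  rw [Arrangement.deletion, Finset.mem_erase]

theorem mem_derModule_of_mem_deletion {A : Arrangement K V} {H : Submodule K V}
    {θ : Der K V} (hθ : θ ∈ (A.deletion H).derModule) (h : lin (form H) ∣ θ (lin (form H))) :
    θ ∈ A.derModule := by
  rw [Arrangement.mem_derModule_iff] at hθ ⊢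
  intro H' hH'
  by_cases hHH : H' = H
  · rw [hHH]; exact h
  · exact hθ H' (mem_deletion.mpr ⟨hHH, hH'⟩)

theorem mem_deletion_of_mem_derModule {A : Arrangement K V} {H : Submodule K V}
    {θ : Der K V} (hθ : θ ∈ A.derModule) : θ ∈ (A.deletion H).derModule := by
  rw [Arrangement.mem_derModule_iff] at hθ ⊢
  exact fun H' hH' => hθ H' (mem_deletion.mp hH').2

theorem mem_deletion_of_smul [FiniteDimensional K V] {A : Arrangement K V} {H : Submodule K V}
    (hH : H ∈ A.hyps) {ζ : Der K V} (h : lin (form H) • ζ ∈ (A.deletion H).derModule) :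
    ζ ∈ (A.deletion H).derModule := by
  rw [Arrangement.mem_derModule_iff] at h ⊢
  intro H' hH'
  have h1 := A.isHyperplane H hH
  obtain ⟨hne, hA'⟩ := mem_deletion.mp hH'
  have h2 := A.isHyperplane H' hA'
  have h4 := h H' hH'
  rw [Derivation.smul_apply, smul_eq_mul] at h4
  refine (isRelPrime_lin (form_ne_zero h2) (form_ne_zero h1) ?_).dvd_of_dvd_mul_left h4
  rwa [ker_form h2, ker_form h1]

/-- Terao's polynomial: for `θ ∈ D(𝒜 \ {H})` the polynomial `θ(α_H)` is, modulo `α_H`, divisible by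
`∏ α_Y ^ (|𝒜_Y| - 2)`. -/
theorem prod_dvd_res_apply [FiniteDimensional K V] {A : Arrangement K V} {H : Submodule K V}
    (hH : H ∈ A.hyps) {f : W →ₗ[K] V} (hf : Function.Injective f) (hr : LinearMap.range f = H)
    {θ : Der K V} (hθ : θ ∈ (A.deletion H).derModule) :
    ∏ Y ∈ (A.pull f).mult.support, lin (form Y) ^ ((A.pull f).mult Y - 1) ∣
      res f (θ (lin (form H))) := by
  classical
  have : FiniteDimensional K W := FiniteDimensional.of_injective f hf
  have hHyp := A.isHyperplane H hH
  have hr' : LinearMap.range f = LinearMap.ker (form H) := hr.trans (ker_form hHyp).symm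
  refine Finset.prod_dvd_of_isRelPrime (fun Y hY Y' hY' hne => ?_) fun Y hY => ?_
  · have h1 := (A.pull f).isHyperplane Y hY
    have h2 := (A.pull f).isHyperplane Y' hY'
    refine IsRelPrime.pow (isRelPrime_lin (form_ne_zero h1) (form_ne_zero h2) ?_)
    rwa [ker_form h1, ker_form h2]
  obtain ⟨hT, H₁, hH₁, hY₁⟩ := Arrangement.mem_support_pull.mp hY
  have hYh := (A.pull f).isHyperplane Y hY
  set F := A.hyps.filter fun H => H.comap f = Y with hF
  have hcard : (A.pull f).mult Y - 1 = (F.erase H₁).card := by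
    rw [Arrangement.pull_mult, if_neg hT,
      Finset.card_erase_of_mem (Finset.mem_filter.mpr ⟨hH₁, hY₁⟩)]
  have hker : ∀ H ∈ A.hyps, H.comap f = Y →
      LinearMap.ker (form H ∘ₗ f) = LinearMap.ker (form Y) := fun H hH h => by
    rw [LinearMap.ker_comp, ker_form (A.isHyperplane H hH), h, ker_form hYh]
  have hneH : ∀ H', H'.comap f = Y → H' ≠ H := by
    rintro _ h rfl
    exact hT (h ▸ (comap_eq_top_iff_of_range_eq hr).mpr le_rfl)
  obtain ⟨h, hh⟩ := Arrangement.mem_derModule_iff.mp hθ H₁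
    (mem_deletion.mpr ⟨hneH H₁ hY₁, hH₁⟩)
  -- Write `α_{H'} = c α_{H₁} + a α_H` with `a ≠ 0`. Applying `θ` and reducing modulo `α_{H'}` shows
  -- that `θ(α_H) ≡ h α_H`, with the same `h` for all `H'` in the fibre.
  have h1 : ∏ H' ∈ F.erase H₁, lin (form H') ∣ θ (lin (form H)) - h * lin (form H) := by
    refine Finset.prod_dvd_of_isRelPrime (fun H hH H' hH' hne => ?_) fun H' hH' => ?_
    · have hH := A.isHyperplane H (Finset.mem_filter.mp (Finset.mem_of_mem_erase hH)).1
      have hH' := A.isHyperplane H' (Finset.mem_filter.mp (Finset.mem_of_mem_erase hH')).1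
      refine isRelPrime_lin (form_ne_zero hH) (form_ne_zero hH') ?_
      rwa [ker_form hH, ker_form hH']
    · obtain ⟨hne, hH'F⟩ := Finset.mem_erase.mp hH'
      obtain ⟨hHA, hHY⟩ := Finset.mem_filter.mp hH'F
      obtain ⟨c, hc⟩ := exists_smul_of_ker_le
        ((hker H₁ hH₁ hY₁).trans (hker H' hHA hHY).symm).le
      obtain ⟨a, ha⟩ := exists_smul_of_ker_le (α := form H) (β := form H' - c • form H₁) (by
        rw [← hr']
        rintro _ ⟨w, rfl⟩
        have := LinearMap.congr_fun hc w
        simp only [LinearMap.comp_apply, LinearMap.smul_apply] at this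
        simp [this])
      have ha0 : a ≠ 0 := by
        rintro rfl
        rw [zero_smul, sub_eq_zero] at ha
        have h2 : LinearMap.ker (form H₁) ≤ LinearMap.ker (form H') := by
          rw [ha]; intro v hv
          rw [LinearMap.mem_ker] at hv ⊢
          rw [LinearMap.smul_apply, hv, smul_zero]
        rw [ker_form (A.isHyperplane _ hH₁), ker_form (A.isHyperplane _ hHA)] at h2
        exact hne ((A.isHyperplane _ hH₁).eq_of_le (A.isHyperplane _ hHA) h2).symm
      obtain ⟨t, ht⟩ := Arrangement.mem_derModule_iff.mp hθ H'
        (mem_deletion.mpr ⟨hneH H' hHY, hHA⟩)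
      have h3 : lin (form H') = c • lin (form H₁) + a • lin (form H) := by
        rw [← lin_smul, ← lin_smul, ← lin_add, ← ha]; congr 1; abel
      have h4 := congrArg θ h3
      rw [map_add, Derivation.map_smul, Derivation.map_smul, ht, hh] at h4
      have h5 : a • (θ (lin (form H)) - h * lin (form H)) = lin (form H') * (t - h) := by
        rw [mul_sub, h4]
        conv_rhs => rw [h3]
        simp only [Algebra.smul_def]
        ring
      have h6 : θ (lin (form H)) - h * lin (form H) = a⁻¹ • (lin (form H') * (t - h)) := by
        rw [← h5, smul_smul, inv_mul_cancel₀ ha0, one_smul]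
      rw [h6]
      exact dvd_smul_of_dvd _ (Dvd.intro _ rfl)
  have h2 := map_dvd (res f) h1
  rw [map_prod, map_sub, map_mul, res_lin_eq_zero hr', mul_zero, sub_zero] at h2
  rw [hcard, ← Finset.prod_const]
  refine Dvd.dvd.trans (Associated.dvd (Associated.prod _ _ _ fun H' hH' => ?_)) h2
  obtain ⟨hHA, hHY⟩ := Finset.mem_filter.mp (Finset.mem_of_mem_erase hH')
  rw [res_lin]
  exact associated_lin (hker H' hHA hHY).symm

/-- This computes the degree of Terao's polynomial: `|𝒜| - 1 - |𝒜^H|`. -/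
theorem sum_pull_mult_sub_one {A : Arrangement K V} {H : Submodule K V} (hH : H ∈ A.hyps)
    {f : W →ₗ[K] V} (hr : LinearMap.range f = H) :
    ∑ Y ∈ (A.pull f).mult.support, ((A.pull f).mult Y - 1) + (A.pull f).mult.support.card + 1 =
      A.hyps.card := by
  classical
  have h1 := A.sum_mult_pull f
  rw [filter_comap_ne_top hH hr] at h1
  rw [Finset.card_eq_sum_ones, ← Finset.sum_add_distrib,
    Finset.sum_congr rfl fun Y hY => Nat.sub_add_cancel
      (Nat.one_le_iff_ne_zero.mpr (Finsupp.mem_support_iff.mp hY)), h1]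
  exact Finset.card_erase_add_one hH

theorem homBasis_arrangement [FiniteDimensional K V] {A : Arrangement K V} {ι : Type*}
    [Fintype ι] (hι : Fintype.card ι = finrank K V) {θ : ι → Der K V} {d : ι → ℕ}
    (hmem : ∀ i, θ i ∈ A.derModule) (hli : LinearIndependent (CoordRing K V) θ)
    (hd : ∀ i, HasPdeg (θ i) (d i)) (hsum : ∑ i, d i = A.hyps.card) :
    HomBasis A.derModule θ d := by
  classical
  obtain ⟨x⟩ := exists_dual_basis K V hι
  rw [← Arrangement.derModule_pull_id] at hmem ⊢
  refine homBasis_of_linearIndependent x hmem hli hd ?_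
  rw [hsum, Arrangement.sum_mult_pull]
  congr 1
  exact (Finset.filter_true_of_mem fun H hH => by simpa using (A.isHyperplane H hH).ne_top).symm

theorem card_le_of_linearIndependent_of_mem_span {R N ι κ : Type*} [CommRing R] [Nontrivial R]
    [AddCommGroup N] [Module R N] [Fintype ι] [Fintype κ] {v : ι → N} {w : κ → N}
    (hv : LinearIndependent R v) (h : ∀ i, v i ∈ Submodule.span R (Set.range w)) :
    Fintype.card ι ≤ Fintype.card κ := by
  classical
  have h1 := linearIndependent_le_span' v hv (Set.range w) (by rintro _ ⟨i, rfl⟩; exact h i)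
  have h2 : Fintype.card (Set.range w) ≤ Fintype.card κ := Fintype.card_range_le w
  rw [Cardinal.mk_fintype] at h1
  exact (Nat.cast_le.mp h1).trans h2

/-- Terao's addition theorem. -/
theorem addition [FiniteDimensional K V] {A : Arrangement K V} {H : Submodule K V}
    (hH : H ∈ A.hyps) {E' E'' : Multiset ℕ} (hE' : HasExponents (A.deletion H).derModule E')
    (hE'' : HasExponents (A.restriction H).derModule E'') (hE : E'' ≤ E') :
    ∃ (θ : Fin (finrank K V) → Der K V) (d : Fin (finrank K V) → ℕ) (j : Fin (finrank K V))
      (η : {i // i ≠ j} → Der K H), HomBasis A.derModule θ d ∧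
      (∀ i : {i // i ≠ j}, Rel H.subtype (θ i) (η i)) ∧
      HomBasis (A.restriction H).derModule η (fun i => d i) := by
  classical
  have hHyp := A.isHyperplane H hH
  have h0 := form_ne_zero hHyp
  have hr : LinearMap.range H.subtype = LinearMap.ker (form H) := by
    rw [Submodule.range_subtype, ker_form hHyp]
  have hf := H.injective_subtype
  have hfr := finrank_add_one_of_range_eq hf h0 hr
  obtain ⟨θ, d, hθ, hd⟩ := exists_homBasis_of_hasExponents hE' rfl
  obtain ⟨φ, e, hφ, he⟩ := exists_homBasis_of_hasExponents hE'' rfl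
  have hsumd := hθ.arrangement_sum_eq (by simp)
  have hsume := hφ.arrangement_sum_eq (by simp)
  have hcd : (A.deletion H).hyps.card + 1 = A.hyps.card := Finset.card_erase_add_one hH
  obtain ⟨t, ht⟩ := Multiset.le_iff_exists_add.mp hE
  have hcE' : Multiset.card E' = finrank K V := by rw [hd]; simp
  have hcE'' : Multiset.card E'' = finrank K H := by rw [he]; simp
  obtain ⟨p, rfl⟩ : ∃ p, t = {p} := by
    rw [← Multiset.card_eq_one]
    have := congrArg Multiset.card ht
    rw [Multiset.card_add] at this
    omega
  set B := ∏ Y ∈ (A.pull H.subtype).mult.support,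
    lin (form Y) ^ ((A.pull H.subtype).mult Y - 1) with hB
  have hBp : B ∈ homogPart K H p := by
    have h1 : B ∈ homogPart K H (∑ Y ∈ (A.pull H.subtype).mult.support,
        ((A.pull H.subtype).mult Y - 1)) :=
      prod_mem_homogPart _ _ _ fun Y _ => by
        simpa using pow_mem_homogPart (lin_mem_homogPart (form Y)) ((A.pull H.subtype).mult Y - 1)
    have h2 := sum_pull_mult_sub_one hH H.range_subtype
    rw [support_pull_subtype A H] at h2
    have h3 := congrArg Multiset.sum ht
    rw [Multiset.sum_add, Multiset.sum_singleton, hd, he] at h3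
    change ∑ i, d i = ∑ i, e i + p at h3
    rw [support_pull_subtype A H] at h1
    -- Both sides are `|𝒜'| - |𝒜''|`, the right one because `E' = E'' + {p}`.
    have h4 : ∑ Y ∈ (A.restriction H).hyps, ((A.pull H.subtype).mult Y - 1) = p := by omega
    rwa [h4] at h1
  have hBdvd : ∀ ζ ∈ (A.deletion H).derModule, B ∣ res H.subtype (ζ (lin (form H))) :=
    fun ζ hζ => prod_dvd_res_apply hH hf H.range_subtype hζ
  have hB0 : B ≠ 0 := Finset.prod_ne_zero_iff.mpr fun Y hY =>
    pow_ne_zero _ (lin_ne_zero (form_ne_zero ((A.pull H.subtype).isHyperplane Y hY)))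
  have hquot : ∀ i, ∃ q, res H.subtype (θ i (lin (form H))) = B * q ∧
      (q ≠ 0 → p ≤ d i ∧ q ∈ homogPart K H (d i - p)) := fun i => by
    obtain ⟨q, hq⟩ := hBdvd _ (hθ.mem i)
    refine ⟨q, hq, fun hq0 => ?_⟩
    have := res_mem_homogPart H.subtype (hθ.pdeg i (form H))
    rw [hq] at this
    exact mem_homogPart_of_mul hBp (mul_ne_zero hB0 hq0) this
  have hmemA : ∀ ζ ∈ (A.deletion H).derModule, res H.subtype (ζ (lin (form H))) = 0 →
      ζ ∈ A.derModule := fun ζ hζ hz =>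
    mem_derModule_of_mem_deletion hζ ((res_eq_zero_iff hf hr).mp hz)
  have hrelA : ∀ ζ ∈ A.derModule, ∃ η, Rel H.subtype ζ η := fun ζ hζ =>
    exists_rel_of_dvd hf hr (Arrangement.mem_derModule_iff.mp hζ H hH)
  have hsat : ∀ (s : Set (Der K V)) (ζ : Der K V), s ⊆ (A.deletion H).derModule →
      lin (form H) • ζ ∈ Submodule.span (CoordRing K V) s → ζ ∈ (A.deletion H).derModule :=
    fun s ζ hs hζ => mem_deletion_of_smul hH (Submodule.span_le.mpr hs hζ)
  -- Otherwise all `θ i` with `d i ≤ p` lie in `D(𝒜)`. Their restrictions are independent and, for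
  -- degree reasons, lie in the span of the `φ k` with `e k ≤ p`. But `E'` has one more exponent `≤
  -- p` than `E''`.
  obtain ⟨j, hjp, hjA⟩ : ∃ j, d j = p ∧ θ j ∉ A.derModule := by
    by_contra! hcon
    have hI : ∀ i : {i // d i ≤ p}, θ i ∈ A.derModule := fun i => by
      rcases eq_or_lt_of_le i.2 with hi | hi
      · exact hcon i hi
      · obtain ⟨q, hq, hq'⟩ := hquot i
        have hq0 : q = 0 := by
          by_contra hq0
          have := (hq' hq0).1
          omega
        exact hmemA _ (hθ.mem i) (by rw [hq, hq0, mul_zero])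
    choose η hη using fun i => hrelA _ (hI i)
    have hli := linearIndependent_of_rel hf h0 hr hθ (g := Subtype.val) Subtype.val_injective hη
      fun ζ hζ => hsat _ ζ (by rintro _ ⟨i, rfl⟩; exact hθ.mem _) hζ
    have hle := card_le_of_linearIndependent_of_mem_span (w := fun k : {k // e k ≤ p} => φ k) hli
      fun i => by
        obtain ⟨c, hc⟩ := hφ.exists_sum (mem_derModule_restriction (hI i) (hη i))
        rw [hc]
        refine Submodule.sum_mem _ fun k _ => ?_
        by_cases hk : e k ≤ p
        · exact Submodule.smul_mem _ _ (Submodule.subset_span ⟨⟨k, hk⟩, rfl⟩)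
        · have := (hφ.coeff_mem ((hη i).hasPdeg hf (hθ.pdeg i)) hc k).2
            (fun h => hk (h.trans i.2))
          rw [this, zero_smul]
          exact Submodule.zero_mem _
    have hcount := congrArg (Multiset.countP (· ≤ p)) ht
    rw [Multiset.countP_add, hd, he, Multiset.countP_map, Multiset.countP_map] at hcount
    rw [Fintype.card_subtype, Fintype.card_subtype] at hle
    have h1 : Multiset.countP (· ≤ p) {p} = 1 := by
      simp [← Multiset.cons_zero]
    rw [h1] at hcount
    have h2 : (Finset.univ.filter fun i => d i ≤ p).card =
      (Finset.univ.filter fun k => e k ≤ p).card + 1 := hcount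
    omega
  obtain ⟨q, hq, hq'⟩ := hquot j
  have hq0 : q ≠ 0 := fun h => hjA (hmemA _ (hθ.mem j) (by rw [hq, h, mul_zero]))
  have hq1 := (hq' hq0).2
  rw [hjp, Nat.sub_self] at hq1
  obtain ⟨c, rfl⟩ := mem_homogPart_zero.mp hq1
  have hc0 : c ≠ 0 := by rintro rfl; simp at hq0
  -- Since `θ j (α_H)` restricts to a nonzero constant times `B`, it can cancel the restriction of
  -- every other `θ i (α_H)`.
  have hr_ex : ∀ i, ∃ r, res H.subtype (θ i (lin (form H))) =
      res H.subtype (r * θ j (lin (form H))) ∧ HasPdeg (r • θ j) (d i) := fun i => by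
    obtain ⟨q, hq₁, hq₂⟩ := hquot i
    by_cases hqz : q = 0
    · exact ⟨0, by rw [hq₁, hqz, mul_zero, zero_mul, map_zero],
        by rw [zero_smul]; exact hasPdeg_zero _⟩
    · obtain ⟨hle, hmem⟩ := hq₂ hqz
      obtain ⟨r, hr₁, hr₂⟩ := exists_res_eq_of_mem_homogPart hf
        (Submodule.smul_mem _ c⁻¹ hmem)
      refine ⟨r, ?_, ?_⟩
      · rw [map_mul, hr₂, hq, hq₁, Algebra.smul_def]
        have : algebraMap K (CoordRing K H) c⁻¹ * algebraMap K (CoordRing K H) c = 1 := by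
          rw [← map_mul, inv_mul_cancel₀ hc0, map_one]
        linear_combination (- B * q) * this
      · have := (hθ.pdeg j).smul hr₁
        rwa [hjp, Nat.sub_add_cancel hle] at this
  choose r hr₁ hr₂ using hr_ex
  have hmem : ∀ i, θ i - r i • θ j ∈ A.derModule := fun i => by
    refine hmemA _ (Submodule.sub_mem _ (hθ.mem i) (Submodule.smul_mem _ _ (hθ.mem j))) ?_
    rw [Derivation.sub_apply, map_sub, hr₁, Derivation.smul_apply, smul_eq_mul, sub_self]
  -- The changed family is needed as a basis of `D(𝒜')`, without the factor `α_H`: a derivation `ζ`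
  -- with `α_H ζ` in the span is only known to lie in `D(𝒜')`, and independence of the restrictions
  -- is tested there.
  have hb1 := hθ.step le_rfl j one_ne_zero one_mem_homogPart r
    (fun i _ => mem_deletion_of_mem_derModule (hmem i)) (by rw [one_smul]; exact hθ.mem j)
    (fun c _ => one_dvd c) (fun i _ => hr₂ i)
  have hb2 := hθ.step (fun ζ hζ => mem_deletion_of_mem_derModule hζ) j (lin_ne_zero h0)
    (lin_mem_homogPart (form H)) r (fun i _ => hmem i)
    (mem_derModule_of_mem_deletion (Submodule.smul_mem _ _ (hθ.mem j))
      (by rw [Derivation.smul_apply, smul_eq_mul]; exact dvd_mul_right _ _))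
    (fun c hc => by
      have h1 := Arrangement.mem_derModule_iff.mp hc H hH
      rw [Derivation.smul_apply, smul_eq_mul] at h1
      exact ((prime_lin h0).dvd_or_dvd h1).resolve_right
        fun h => hjA (mem_derModule_of_mem_deletion (hθ.mem j) h))
    (fun i _ => hr₂ i)
  choose η hη using fun i : {i // i ≠ j} => hrelA _ (hmem i)
  refine ⟨_, _, j, η, hb2, fun i => ?_, ?_⟩
  · rw [Function.update_of_ne i.2]; exact hη i
  · have hdeg : (fun i : {i // i ≠ j} => Function.update d j (1 + d j) i) =
        fun i : {i // i ≠ j} => d i := funext fun i => Function.update_of_ne i.2 _ _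
    rw [hdeg]
    refine homBasis_arrangement ?_ (fun i => mem_derModule_restriction (hmem i) (hη i)) ?_
      (fun i => (hη i).hasPdeg hf ((hθ.pdeg i).sub (hr₂ i))) ?_
    · rw [Fintype.card_subtype_compl, Fintype.card_subtype_eq, Fintype.card_fin]; omega
    · refine linearIndependent_of_rel hf h0 hr hb1 (g := Subtype.val) Subtype.val_injective
        (fun i => ?_) fun ζ hζ => hsat _ ζ (by rintro _ ⟨i, rfl⟩; exact hb1.mem _) hζ
      rw [Function.update_of_ne i.2]; exact hη i
    · have h2 : ∑ i, d i = d j + ∑ i : {i // i ≠ j}, d i := Fintype.sum_eq_add_sum_subtype_ne d j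
      have h3 := congrArg Multiset.sum ht
      rw [Multiset.sum_add, Multiset.sum_singleton, hd, he] at h3
      change ∑ i, d i = ∑ i, e i + p at h3
      omega

end Addition

end HypArr

end

noncomputable section

namespace HypArr

/-! ### Multiarrangements of rank two -/

section RankTwo

variable {K V : Type*} [Field K] [AddCommGroup V] [Module K V]

/-! ### Binary forms in two independent linear forms `y` and `α`. -/

section Binary

variable {P : Submodule K (CoordRing K V)} {α y : Dual K V}

/-- A binary form is its leading term in `y` plus a multiple of `α`. The cofactor is tracked inside
the powers of `P` because the ambient ring may have further variables. -/
theorem exists_eq_of_mem_pow (hy : lin y ∈ P)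
    (hP : ∀ p ∈ P, ∃ c c' : K, p = c • lin y + c' • lin α) (d : ℕ) {g : CoordRing K V}
    (hg : g ∈ P ^ d) :
    ∃ c : K, ∃ q, g = c • lin y ^ d + lin α * q ∧ (d = 0 → q = 0) ∧
      ∀ e, d = e + 1 → q ∈ P ^ e := by
  induction d generalizing g with
  | zero =>
    rw [pow_zero, Submodule.mem_one] at hg
    obtain ⟨c, rfl⟩ := hg
    exact ⟨c, 0, by rw [mul_zero, add_zero, pow_zero, Algebra.algebraMap_eq_smul_one],
      fun _ => rfl, fun e he => by omega⟩
  | succ d ih =>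
    rw [pow_succ'] at hg
    induction hg using Submodule.mul_induction_on' with
    | mem_mul_mem p hp q hq =>
      obtain ⟨c, c', rfl⟩ := hP p hp
      obtain ⟨b, q₁, hq₁, hq0, hqs⟩ := ih hq
      refine ⟨c * b, c • (lin y * q₁) + c' • q, ?_, by omega, fun e he => ?_⟩
      · rw [Algebra.smul_def] at hq₁
        simp only [Algebra.smul_def, map_mul]
        linear_combination (algebraMap K (CoordRing K V) c * lin y) * hq₁
      · obtain rfl : e = d := by omega
        refine Submodule.add_mem _ (Submodule.smul_mem _ _ ?_) (Submodule.smul_mem _ _ hq)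
        rcases e with _ | e
        · rw [hq0 rfl, mul_zero]; exact Submodule.zero_mem _
        · rw [pow_succ']
          exact Submodule.mul_mem_mul hy (hqs e rfl)
    | add p _ q _ hp hq =>
      obtain ⟨c, p₁, h1, -, h2⟩ := hp
      obtain ⟨c', q₁, h3, -, h4⟩ := hq
      refine ⟨c + c', p₁ + q₁, ?_, by omega, fun e he =>
        Submodule.add_mem _ (h2 e he) (h4 e he)⟩
      rw [h1, h3, add_smul, mul_add]
      abel

theorem exists_eq_pow_mul_of_mem_pow (hα0 : α ≠ 0) (hαy : ¬ lin α ∣ lin y)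
    (hy : lin y ∈ P) (hP : ∀ p ∈ P, ∃ c c' : K, p = c • lin y + c' • lin α) (m : ℕ) {d : ℕ}
    {g : CoordRing K V} (hg : g ∈ P ^ d) (hdvd : lin α ^ m ∣ g) :
    g = 0 ∨ (m ≤ d ∧ ∃ q ∈ P ^ (d - m), g = lin α ^ m * q) := by
  induction m generalizing d g with
  | zero => exact Or.inr ⟨Nat.zero_le _, g, hg, by rw [pow_zero, one_mul]⟩
  | succ m ih =>
    by_cases hg0 : g = 0
    · exact Or.inl hg0
    obtain ⟨c, q, rfl, hq0, hqs⟩ := exists_eq_of_mem_pow hy hP d hg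
    have hp := prime_lin hα0
    have h1 : lin α ∣ c • lin y ^ d :=
      (dvd_add_left (dvd_mul_right _ _)).mp ((dvd_pow_self _ (Nat.succ_ne_zero m)).trans hdvd)
    have hc : c = 0 := by
      by_contra hc
      have h2 : lin α ∣ lin y ^ d := by
        have := dvd_smul_of_dvd c⁻¹ h1
        rwa [smul_smul, inv_mul_cancel₀ hc, one_smul] at this
      exact hαy (hp.dvd_of_dvd_pow h2)
    rw [hc, zero_smul, zero_add] at hg0 hdvd ⊢
    rcases d with _ | d
    · rw [hq0 rfl, mul_zero] at hg0; exact absurd rfl hg0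
    have hq := hqs d rfl
    rw [pow_succ', mul_dvd_mul_iff_left hp.ne_zero] at hdvd
    rcases ih hq hdvd with h | ⟨hle, t, ht, h⟩
    · rw [h, mul_zero] at hg0; exact absurd rfl hg0
    · refine Or.inr ⟨by omega, t, by rwa [Nat.succ_sub_succ], ?_⟩
      rw [h, pow_succ', mul_assoc]

/-- The constant `c` is the obstruction to one more factor `α`. The last clause protects the
exponent `d - m` from truncated subtraction. -/
theorem exists_quotient_of_mem_pow (hα0 : α ≠ 0) (hαy : ¬ lin α ∣ lin y)
    (hy : lin y ∈ P) (hP : ∀ p ∈ P, ∃ c c' : K, p = c • lin y + c' • lin α) {m d : ℕ}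
    {g : CoordRing K V} (hg : g ∈ P ^ d) (hdvd : lin α ^ m ∣ g) :
    ∃ (q : CoordRing K V) (c : K), g = lin α ^ m * q ∧ lin α ∣ q - c • lin y ^ (d - m) ∧
      (c ≠ 0 → m ≤ d) := by
  rcases exists_eq_pow_mul_of_mem_pow hα0 hαy hy hP m hg hdvd with rfl | ⟨hle, q, hq, h⟩
  · exact ⟨0, 0, by rw [mul_zero], by rw [zero_smul, sub_zero]; exact dvd_zero _, by simp⟩
  · obtain ⟨c, t, ht, -⟩ := exists_eq_of_mem_pow hy hP _ hq
    refine ⟨q, c, h, ?_, fun _ => hle⟩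
    rw [ht, add_sub_cancel_left]
    exact dvd_mul_right _ _

end Binary

variable {ι : Type*} [Fintype ι] [DecidableEq ι]

/-- A homogeneous basis of `D(𝒜, μ)`, adapted to coordinates in which all hyperplanes of `𝒜` contain
the subspace `x_i = x_j = 0`. -/
structure RankTwoBasis (x : Basis ι K (Dual K V)) (i j : ι) (M : Multiarrangement K V)
    (θ : ι → Der K V) (d : ι → ℕ) : Prop where
  hom : HomBasis M.derModule θ d
  eq_partialDer : ∀ k, k ≠ i → k ≠ j → θ k = partialDer x k ∧ d k = 0
  apply_eq_zero : ∀ a, a = i ∨ a = j → ∀ k, k ≠ i → k ≠ j → θ a (lin (x k)) = 0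
  mem_pow : ∀ a, a = i ∨ a = j → ∀ β ∈ Submodule.span K {x i, x j},
    θ a (lin β) ∈ (Submodule.span K {lin (x i), lin (x j)}) ^ d a

/-! ### Deletion of multiarrangements and their modules of derivations. -/

namespace Multiarrangement

theorem deletion_mult_self (M : Multiarrangement K V) (H : Submodule K V) :
    (M.deletion H).mult H = M.mult H - 1 := by
  classical
  simp [deletion, Finsupp.update_apply]

theorem deletion_mult_of_ne (M : Multiarrangement K V) {H H' : Submodule K V} (h : H' ≠ H) :
    (M.deletion H).mult H' = M.mult H' := by
  classical
  simp [deletion, Finsupp.update_apply, h]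

theorem mem_support_of_mem_support_deletion {M : Multiarrangement K V} {H H' : Submodule K V}
    (h : H' ∈ (M.deletion H).mult.support) : H' ∈ M.mult.support := by
  rw [Finsupp.mem_support_iff] at h ⊢
  by_cases hH : H' = H
  · rw [hH, deletion_mult_self] at h; rw [hH]; omega
  · rwa [deletion_mult_of_ne M hH] at h

theorem degree_deletion {M : Multiarrangement K V} {H : Submodule K V} (h : H ∈ M.mult.support) :
    ∑ H' ∈ (M.deletion H).mult.support, (M.deletion H).mult H' + 1 =
      ∑ H' ∈ M.mult.support, M.mult H' := by
  classical
  have h1 : M.mult = (M.deletion H).mult + Finsupp.single H 1 := by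
    ext H'
    rw [Finsupp.add_apply, Finsupp.single_apply]
    split_ifs with hH
    · rw [← hH, deletion_mult_self]
      have := Finsupp.mem_support_iff.mp h
      omega
    · rw [deletion_mult_of_ne M (Ne.symm hH), add_zero]
  have h2 := congrArg Finsupp.degree h1
  rw [map_add, Finsupp.degree_single] at h2
  exact h2.symm

theorem mem_derModule_of_mem_deletion {M : Multiarrangement K V} {H : Submodule K V}
    {θ : Der K V} (h : θ ∈ (M.deletion H).derModule)
    (hH : lin (form H) ^ M.mult H ∣ θ (lin (form H))) : θ ∈ M.derModule := by
  rw [mem_derModule_iff]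
  intro H' hH'
  by_cases hHH : H' = H
  · rw [hHH]; exact hH
  · have := dvd_of_mem h (ker_form (M.isHyperplane H' hH'))
    rwa [deletion_mult_of_ne M hHH] at this

theorem mem_deletion_of_mem_derModule {M : Multiarrangement K V} {H : Submodule K V}
    {θ : Der K V} (h : θ ∈ M.derModule) : θ ∈ (M.deletion H).derModule := by
  rw [mem_derModule_iff]
  intro H' hH'
  have hH := mem_support_of_mem_support_deletion hH'
  refine (pow_dvd_pow _ ?_).trans (dvd_of_mem h (ker_form (M.isHyperplane H' hH)))
  by_cases hHH : H' = H
  · rw [hHH, deletion_mult_self]; omega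
  · rw [deletion_mult_of_ne M hHH]

theorem mem_deletion_of_smul [FiniteDimensional K V] {M : Multiarrangement K V}
    {H : Submodule K V} (hH : H ∈ M.mult.support) {θ : Der K V}
    (h : lin (form H) • θ ∈ M.derModule) : θ ∈ (M.deletion H).derModule := by
  rw [mem_derModule_iff] at h ⊢
  intro H' hH'
  have hH'M := mem_support_of_mem_support_deletion hH'
  have h1 := h H' hH'M
  rw [Derivation.smul_apply, smul_eq_mul] at h1
  have hHyp := M.isHyperplane H hH
  have hHyp' := M.isHyperplane H' hH'M
  by_cases hHH : H' = H
  · subst hHH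
    have h2 : M.mult H' = M.mult H' - 1 + 1 := by
      have := Finsupp.mem_support_iff.mp hH
      omega
    rw [h2, pow_succ', mul_dvd_mul_iff_left (lin_ne_zero (form_ne_zero hHyp))] at h1
    rwa [deletion_mult_self]
  · rw [deletion_mult_of_ne M hHH]
    refine IsRelPrime.dvd_of_dvd_mul_left (IsRelPrime.pow_left ?_) h1
    refine isRelPrime_lin (form_ne_zero hHyp') (form_ne_zero hHyp) ?_
    rwa [ker_form hHyp', ker_form hHyp]

end Multiarrangement

/-- Members of a basis are primitive: compare the coefficient at `a` after expanding `η`. -/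
theorem HomBasis.isUnit_of_eq_smul {D : Submodule (CoordRing K V) (Der K V)} {θ : ι → Der K V}
    {d : ι → ℕ} (h : HomBasis D θ d) {a : ι} {s : CoordRing K V} {η : Der K V} (hη : η ∈ D)
    (he : θ a = s • η) : IsUnit s := by
  obtain ⟨c, rfl⟩ := h.exists_sum hη
  have h1 : ∑ k, (if k = a then (1 : CoordRing K V) else 0) • θ k = ∑ k, (s * c k) • θ k := by
    rw [Finset.sum_eq_single a (fun k _ hk => by rw [if_neg hk, zero_smul])
      (fun h => absurd (Finset.mem_univ _) h), if_pos rfl, one_smul, he, Finset.smul_sum]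
    exact Finset.sum_congr rfl fun k _ => smul_smul _ _ _
  have h2 := congrFun (h.eq_of_sum_eq h1) a
  rw [if_pos rfl] at h2
  exact IsUnit.of_mul_eq_one _ h2.symm

theorem lin_mem_span_pair {β u v : Dual K V} (h : β ∈ Submodule.span K {u, v}) :
    lin β ∈ Submodule.span K {lin u, lin v} := by
  obtain ⟨a, b, rfl⟩ := Submodule.mem_span_pair.mp h
  rw [lin_add, lin_smul, lin_smul]
  exact Submodule.mem_span_pair.mpr ⟨a, b, rfl⟩

/-- Two independent elements of a plane span it. -/
theorem exists_eq_add_of_mem_span_pair {u v α y : Dual K V} (hα0 : α ≠ 0)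
    (hα : α ∈ Submodule.span K {u, v}) (hy : y ∈ Submodule.span K {u, v})
    (hαy : ¬ ∃ c : K, y = c • α) {β : Dual K V} (hβ : β ∈ Submodule.span K {u, v}) :
    ∃ c c' : K, β = c • y + c' • α := by
  obtain ⟨a, b, rfl⟩ := Submodule.mem_span_pair.mp hα
  obtain ⟨a', b', rfl⟩ := Submodule.mem_span_pair.mp hy
  obtain ⟨s, t, rfl⟩ := Submodule.mem_span_pair.mp hβ
  by_cases hD : a * b' - b * a' = 0
  · exfalso
    apply hαy
    by_cases ha : a = 0
    · have hb : b ≠ 0 := by rintro rfl; simp [ha] at hα0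
      refine ⟨b' / b, ?_⟩
      have ha' : a' = 0 := by
        rw [ha, zero_mul, zero_sub, neg_eq_zero] at hD
        exact (mul_eq_zero.mp hD).resolve_left hb
      simp only [ha, ha', zero_smul, zero_add, smul_smul, div_mul_cancel₀ _ hb]
    · refine ⟨a' / a, ?_⟩
      rw [smul_add, smul_smul, smul_smul, div_mul_cancel₀ _ ha]
      congr 2
      field_simp
      linear_combination hD
  · refine ⟨(a * t - b * s) / (a * b' - b * a'), (s * b' - t * a') / (a * b' - b * a'), ?_⟩
    have h1 : s = (a * t - b * s) / (a * b' - b * a') * a' +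
        (s * b' - t * a') / (a * b' - b * a') * a := by field_simp; ring
    have h2 : t = (a * t - b * s) / (a * b' - b * a') * b' +
        (s * b' - t * a') / (a * b' - b * a') * b := by field_simp; ring
    generalize (a * t - b * s) / (a * b' - b * a') = A at h1 h2 ⊢
    generalize (s * b' - t * a') / (a * b' - b * a') = B at h1 h2 ⊢
    rw [h1, h2]
    module

theorem exists_eq_add_of_lin {u v α y : Dual K V} (hα0 : α ≠ 0)
    (hα : α ∈ Submodule.span K {u, v}) (hy : y ∈ Submodule.span K {u, v})
    (hαy : ¬ lin α ∣ lin y) : ∀ p ∈ Submodule.span K {lin u, lin v},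
      ∃ c c' : K, p = c • lin y + c' • lin α := by
  intro p hp
  obtain ⟨s, t, rfl⟩ := Submodule.mem_span_pair.mp hp
  obtain ⟨c, c', h⟩ := exists_eq_add_of_mem_span_pair hα0 hα hy (by
    rintro ⟨c, rfl⟩
    exact hαy (by rw [lin_smul]; exact dvd_smul_of_dvd c dvd_rfl))
    (Submodule.mem_span_pair.mpr ⟨s, t, rfl⟩)
  refine ⟨c, c', ?_⟩
  rw [← lin_smul, ← lin_smul, ← lin_smul, ← lin_smul, ← lin_add, ← lin_add, h]

theorem apply_eq_zero_of_mem_span_pair {u v : Dual K V} {θ : Der K V} (hu : θ (lin u) = 0)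
    (hv : θ (lin v) = 0) {β : Dual K V} (hβ : β ∈ Submodule.span K {u, v}) : θ (lin β) = 0 := by
  obtain ⟨s, t, rfl⟩ := Submodule.mem_span_pair.mp hβ
  rw [lin_add, lin_smul, lin_smul, map_add, Derivation.map_smul, Derivation.map_smul, hu, hv,
    smul_zero, smul_zero, add_zero]

-- In rank two the addition step is always possible. Modulo `α`, the two relevant quotients `θ(α) /
-- α ^ m` are multiples of powers of one form `y`, so the one of lower degree cancels the other. The
-- conclusion also separates the member divisible by `α_H` from the one that is not, as the
-- definition of the Euler multiplicity requires.
set_option maxHeartbeats 1000000 in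
theorem RankTwoBasis.exists_step [FiniteDimensional K V] {x : Basis ι K (Dual K V)} {i j : ι}
    (hij : i ≠ j) {M : Multiarrangement K V} {H : Submodule K V} (hH : H ∈ M.mult.support)
    (hspan : form H ∈ Submodule.span K {x i, x j}) {θ : ι → Der K V} {d : ι → ℕ}
    (h : RankTwoBasis x i j (M.deletion H) θ d) :
    ∃ (θ' : ι → Der K V) (d' : ι → ℕ) (a b : ι), (a = i ∧ b = j ∨ a = j ∧ b = i) ∧
      RankTwoBasis x i j M θ' d' ∧ (∃ η, θ' b = lin (form H) • η) ∧
      (¬ ∃ η, θ' a = lin (form H) • η) := by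
  have hHyp := M.isHyperplane H hH
  have h0 := form_ne_zero hHyp
  have hp := prime_lin h0
  have hm : M.mult H = (M.deletion H).mult H + 1 := by
    rw [Multiarrangement.deletion_mult_self]
    have := Finsupp.mem_support_iff.mp hH
    omega
  set m := (M.deletion H).mult H with hm_def
  set P := Submodule.span K {lin (x i), lin (x j)} with hP_def
  set α := form H with hα_def
  have hxi : x i ∈ Submodule.span K {x i, x j} := Submodule.subset_span (by simp)
  have hxj : x j ∈ Submodule.span K {x i, x j} := Submodule.subset_span (by simp)
  obtain ⟨y, hy, hαy⟩ : ∃ y ∈ Submodule.span K {x i, x j}, ¬ lin α ∣ lin y := by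
    by_contra! hcon
    obtain ⟨c, hc⟩ := exists_smul_of_ker_le (lin_dvd_lin_iff.mp (hcon _ hxi))
    obtain ⟨c', hc'⟩ := exists_smul_of_ker_le (lin_dvd_lin_iff.mp (hcon _ hxj))
    have hc0 : c ≠ 0 := by
      rintro rfl
      exact x.ne_zero i (by rw [hc, zero_smul])
    have h1 : x j = (c' * c⁻¹) • x i := by
      rw [hc, smul_smul, mul_assoc, inv_mul_cancel₀ hc0, mul_one, hc']
    have h2 := congrArg (fun v => x.repr v j) h1
    simp [hij] at h2
  have hPα : lin α ∈ P := lin_mem_span_pair hspan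
  have hPy : lin y ∈ P := lin_mem_span_pair hy
  have hP := exists_eq_add_of_lin h0 hspan hy hαy
  have hq : ∀ a, a = i ∨ a = j → ∃ (q : CoordRing K V) (c : K), θ a (lin α) = lin α ^ m * q ∧
      lin α ∣ q - c • lin y ^ (d a - m) ∧ (c ≠ 0 → m ≤ d a) := fun a ha =>
    exists_quotient_of_mem_pow h0 hαy hPy hP (h.mem_pow a ha α hspan)
      (Multiarrangement.dvd_of_mem (h.hom.mem a) (ker_form hHyp))
  obtain ⟨qi, ci, hqi⟩ := hq i (Or.inl rfl)
  obtain ⟨qj, cj, hqj⟩ := hq j (Or.inr rfl)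
  have hconst : ∀ k, k ≠ i → k ≠ j → θ k (lin α) = 0 := fun k hki hkj => by
    rw [(h.eq_partialDer k hki hkj).1]
    exact apply_eq_zero_of_mem_span_pair (by rw [partialDer_lin, if_neg hki])
      (by rw [partialDer_lin, if_neg hkj]) hspan
  have hmemM : ∀ ζ ∈ (M.deletion H).derModule, lin α ^ (m + 1) ∣ ζ (lin α) → ζ ∈ M.derModule :=
    fun ζ hζ hd => Multiarrangement.mem_derModule_of_mem_deletion hζ (by rw [hm]; exact hd)
  -- If both obstructions vanish, the modules for `M` and its deletion coincide. The degrees of one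
  -- basis would then have two different sums.
  have hnot : ¬ (ci = 0 ∧ cj = 0) := by
    rintro ⟨rfl, rfl⟩
    have h1 : ∀ k, θ k ∈ M.derModule := fun k => by
      refine hmemM _ (h.hom.mem k) ?_
      rw [pow_succ]
      by_cases hki : k = i
      · subst hki
        have := hqi.2.1
        rw [zero_smul, sub_zero] at this
        rw [hqi.1]; exact mul_dvd_mul_left _ this
      by_cases hkj : k = j
      · subst hkj
        have := hqj.2.1
        rw [zero_smul, sub_zero] at this
        rw [hqj.1]; exact mul_dvd_mul_left _ this
      · rw [hconst k hki hkj]; exact dvd_zero _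
    have h2 : M.derModule = (M.deletion H).derModule := by
      refine le_antisymm (fun ζ hζ => Multiarrangement.mem_deletion_of_mem_derModule hζ) ?_
      rw [← h.hom.span_eq, Submodule.span_le]
      rintro _ ⟨k, rfl⟩; exact h1 k
    have h3 : HomBasis M.derModule θ d := h2 ▸ h.hom
    have h4 := h3.sum_eq x
    have h5 := h.hom.sum_eq x
    have h6 := Multiarrangement.degree_deletion hH
    omega
  -- Let `b` be an index with nonzero obstruction, of least degree if both are nonzero.
  obtain ⟨a, b, hab, qa, qb, ca, cb, hqa, hqb, hcb, hle⟩ : ∃ a b,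
      (a = i ∧ b = j ∨ a = j ∧ b = i) ∧ ∃ (qa qb : CoordRing K V) (ca cb : K),
      (θ a (lin α) = lin α ^ m * qa ∧ lin α ∣ qa - ca • lin y ^ (d a - m) ∧ (ca ≠ 0 → m ≤ d a)) ∧
      (θ b (lin α) = lin α ^ m * qb ∧ lin α ∣ qb - cb • lin y ^ (d b - m) ∧ (cb ≠ 0 → m ≤ d b)) ∧
      cb ≠ 0 ∧ (ca ≠ 0 → d b ≤ d a) := by
    by_cases hci : ci = 0
    · exact ⟨i, j, Or.inl ⟨rfl, rfl⟩, qi, qj, ci, cj, hqi, hqj, fun h => hnot ⟨hci, h⟩,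
        fun h => absurd hci h⟩
    · by_cases hcj : cj = 0
      · exact ⟨j, i, Or.inr ⟨rfl, rfl⟩, qj, qi, cj, ci, hqj, hqi, hci, fun h => absurd hcj h⟩
      · rcases le_total (d i) (d j) with hd | hd
        · exact ⟨j, i, Or.inr ⟨rfl, rfl⟩, qj, qi, cj, ci, hqj, hqi, hci, fun _ => hd⟩
        · exact ⟨i, j, Or.inl ⟨rfl, rfl⟩, qi, qj, ci, cj, hqi, hqj, hcj, fun _ => hd⟩
  have hane : a ≠ b := by rcases hab with ⟨rfl, rfl⟩ | ⟨rfl, rfl⟩ <;> [exact hij; exact hij.symm]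
  have ha : a = i ∨ a = j := by tauto
  have hb : b = i ∨ b = j := by tauto
  have hother : ∀ k, k ≠ a → k ≠ b → k ≠ i ∧ k ≠ j := by
    intro k hka hkb
    rcases hab with ⟨rfl, rfl⟩ | ⟨rfl, rfl⟩
    · exact ⟨hka, hkb⟩
    · exact ⟨hkb, hka⟩
  set ra : CoordRing K V := (ca * cb⁻¹) • lin y ^ (d a - d b) with hra
  let r : ι → CoordRing K V := fun k => if k = a then ra else 0
  have hr_a : r a = ra := if_pos rfl
  have hr_k : ∀ k, k ≠ a → r k = 0 := fun k hk => if_neg hk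
  have hraP : ∀ g ∈ P ^ d b, ra * g ∈ P ^ d a := fun g hg => by
    by_cases hca : ca = 0
    · rw [hra, hca, zero_mul, zero_smul, zero_mul]; exact Submodule.zero_mem _
    · have h1 := Submodule.mul_mem_mul (Submodule.pow_mem_pow P hPy (d a - d b)) hg
      rw [← pow_add, Nat.sub_add_cancel (hle hca)] at h1
      rw [hra, smul_mul_assoc]
      exact Submodule.smul_mem _ _ h1
  have hrpdeg : ∀ k, HasPdeg (r k • θ b) (d k) := fun k => by
    by_cases hk : k = a
    · subst hk
      rw [hr_a]
      by_cases hca : ca = 0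
      · rw [hra, hca, zero_mul, zero_smul, zero_smul]; exact hasPdeg_zero _
      · have h1 : ra ∈ homogPart K V (d k - d b) := Submodule.smul_mem _ _ (by
          simpa using pow_mem_homogPart (lin_mem_homogPart y) (d k - d b))
        have h2 := (h.hom.pdeg b).smul h1
        rwa [Nat.sub_add_cancel (hle hca)] at h2
    · rw [hr_k k hk, zero_smul]; exact hasPdeg_zero _
  have hmem' : ∀ k, k ≠ b → θ k - r k • θ b ∈ M.derModule := fun k hkb => by
    refine hmemM _ (Submodule.sub_mem _ (h.hom.mem k) (Submodule.smul_mem _ _ (h.hom.mem b))) ?_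
    rw [Derivation.sub_apply, Derivation.smul_apply, smul_eq_mul]
    by_cases hk : k = a
    · subst hk
      rw [hr_a, hqa.1, hqb.1, pow_succ]
      have h1 : lin α ^ m * qa - ra * (lin α ^ m * qb) = lin α ^ m * (qa - ra * qb) := by ring
      rw [h1]
      refine mul_dvd_mul_left _ ?_
      have h2 : ca • lin y ^ (d k - m) = ra * (cb • lin y ^ (d b - m)) := by
        by_cases hca : ca = 0
        · rw [hra, hca, zero_mul, zero_smul, zero_smul, zero_mul]
        · have hdeg : d k - m = d k - d b + (d b - m) := by
            have := hle hca
            have := hqb.2.2 hcb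
            omega
          rw [hra, hdeg, pow_add, smul_mul_smul_comm, mul_assoc, inv_mul_cancel₀ hcb, mul_one]
      have h3 : qa - ra * qb = (qa - ca • lin y ^ (d k - m)) -
          ra * (qb - cb • lin y ^ (d b - m)) := by rw [mul_sub, ← h2]; ring
      rw [h3]
      exact dvd_sub hqa.2.1 (hqb.2.1.mul_left _)
    · obtain ⟨h1, h2⟩ := hother k hk hkb
      rw [hr_k k hk, hconst k h1 h2, zero_mul, sub_zero]
      exact dvd_zero _
  have hαb : lin α • θ b ∈ M.derModule := by
    refine hmemM _ (Submodule.smul_mem _ _ (h.hom.mem b)) ?_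
    rw [Derivation.smul_apply, smul_eq_mul, hqb.1, ← mul_assoc, ← pow_succ']
    exact dvd_mul_right _ _
  -- As `θ b (α) = α ^ m qb` with `α ∤ qb`, the missing factor `α` must come from `c`.
  have hcoef : ∀ c : CoordRing K V, c • θ b ∈ M.derModule → lin α ∣ c := fun c hc => by
    have h1 := Multiarrangement.dvd_of_mem hc (ker_form hHyp)
    rw [Derivation.smul_apply, smul_eq_mul, hqb.1, hm, mul_left_comm, pow_succ,
      mul_dvd_mul_iff_left (pow_ne_zero _ hp.ne_zero)] at h1
    refine (hp.dvd_or_dvd h1).resolve_right fun h2 => hαy ?_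
    have h3 := (dvd_sub_right h2).mp hqb.2.1
    have h4 := dvd_smul_of_dvd cb⁻¹ h3
    rw [smul_smul, inv_mul_cancel₀ hcb, one_smul] at h4
    exact hp.dvd_of_dvd_pow h4
  have hb1 := h.hom.step le_rfl b one_ne_zero one_mem_homogPart r
    (fun k hk => Multiarrangement.mem_deletion_of_mem_derModule (hmem' k hk))
    (by rw [one_smul]; exact h.hom.mem b) (fun c _ => one_dvd c) (fun k _ => hrpdeg k)
  have hb2 := h.hom.step (fun ζ hζ => Multiarrangement.mem_deletion_of_mem_derModule hζ) b
    hp.ne_zero (lin_mem_homogPart α) r hmem' hαb hcoef (fun k _ => hrpdeg k)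
  refine ⟨_, _, a, b, hab, ⟨hb2, fun k hki hkj => ?_, fun k hk l hli hlj => ?_,
    fun k hk β hβ => ?_⟩, ⟨θ b, Function.update_self _ _ _⟩, ?_⟩
  · have hkb : k ≠ b := by rcases hb with rfl | rfl <;> assumption
    have hka : k ≠ a := by rcases ha with rfl | rfl <;> assumption
    rw [Function.update_of_ne hkb, Function.update_of_ne hkb, hr_k k hka, zero_smul, sub_zero]
    exact h.eq_partialDer k hki hkj
  · by_cases hkb : k = b
    · subst hkb
      rw [Function.update_self, Derivation.smul_apply, h.apply_eq_zero k hk l hli hlj, smul_zero]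
    · rw [Function.update_of_ne hkb, Derivation.sub_apply, Derivation.smul_apply,
        h.apply_eq_zero k hk l hli hlj, h.apply_eq_zero b hb l hli hlj, smul_zero, sub_zero]
  · by_cases hkb : k = b
    · subst hkb
      rw [Function.update_self, Function.update_self, Derivation.smul_apply, smul_eq_mul,
        add_comm, pow_succ']
      exact Submodule.mul_mem_mul hPα (h.mem_pow k hk β hβ)
    · have hka : k = a := by
        by_contra hka
        obtain ⟨h1, h2⟩ := hother k hka hkb
        tauto
      subst hka
      rw [Function.update_of_ne hkb, Function.update_of_ne hkb, Derivation.sub_apply,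
        Derivation.smul_apply, smul_eq_mul, hr_a]
      exact Submodule.sub_mem _ (h.mem_pow k hk β hβ) (hraP _ (h.mem_pow b hb β hβ))
  -- Here `η` would lie in the module of the deletion, where the same derivation belongs to the
  -- basis `hb1`. That would make `α` a unit.
  · rintro ⟨η, hη⟩
    have h1 : lin α • η ∈ M.derModule := hη ▸ hb2.mem a
    have h2 := Multiarrangement.mem_deletion_of_smul hH h1
    refine hp.not_isUnit (hb1.isUnit_of_eq_smul (a := a) h2 ?_)
    rw [Function.update_of_ne hane] at hη ⊢
    exact hη

theorem exists_rankTwoBasis [FiniteDimensional K V] {x : Basis ι K (Dual K V)} {i j : ι}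
    (hij : i ≠ j) (n : ℕ) : ∀ (M : Multiarrangement K V),
    (∑ H ∈ M.mult.support, M.mult H = n) →
    (∀ H ∈ M.mult.support, form H ∈ Submodule.span K {x i, x j}) →
    ∃ θ d, RankTwoBasis x i j M θ d := by
  induction n with
  | zero =>
    intro M hM _
    have h0 : M.mult.support = ∅ := by
      rw [Finset.eq_empty_iff_forall_notMem]
      intro H hH
      have := Finset.sum_eq_zero_iff.mp hM H hH
      exact Finsupp.mem_support_iff.mp hH this
    refine ⟨partialDer x, fun _ => 0, homBasis_of_linearIndependent x (fun k => ?_) ?_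
      (hasPdeg_partialDer x) (by rw [hM]; simp), fun k _ _ => ⟨rfl, rfl⟩, fun a ha k hki hkj => ?_,
      fun a ha β hβ => ?_⟩
    · intro H hH
      rw [h0] at hH
      exact absurd hH (Finset.notMem_empty H)
    · refine linearIndependent_of_det_ne_zero x ?_
      have := det_sMat_smul_partialDer x (fun _ => 1)
      simp only [one_smul, Finset.prod_const_one] at this
      rw [this]
      exact one_ne_zero
    · rw [partialDer_lin, if_neg]
      rintro rfl
      tauto
    · rw [pow_zero, Submodule.mem_one, partialDer, mkDer_lin]
      exact ⟨_, rfl⟩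
  | succ n ih =>
    intro M hM hspan
    obtain ⟨H, hH⟩ : M.mult.support.Nonempty := by
      rw [Finset.nonempty_iff_ne_empty]
      intro h0
      rw [h0, Finset.sum_empty] at hM
      omega
    have h1 := Multiarrangement.degree_deletion hH
    obtain ⟨θ, d, h⟩ := ih (M.deletion H) (by omega) fun H' hH' =>
      hspan H' (Multiarrangement.mem_support_of_mem_support_deletion hH')
    obtain ⟨θ', d', -, -, -, h', -⟩ := h.exists_step hij hH (hspan H hH)
    exact ⟨θ', d', h'⟩

end RankTwo

end HypArr

end

noncomputable section

namespace HypArr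

/-! ### Euler restrictions -/

section EulerRestriction

variable {K V : Type*} [Field K] [AddCommGroup V] [Module K V]

namespace Multiarrangement

open scoped Classical in
theorem localization_mult (M : Multiarrangement K V) (X H : Submodule K V) :
    (M.localization X).mult H = if X ≤ H then M.mult H else 0 := by
  rw [localization, Finsupp.filter_apply]

theorem mem_support_localization {M : Multiarrangement K V} {X H : Submodule K V} :
    H ∈ (M.localization X).mult.support ↔ X ≤ H ∧ H ∈ M.mult.support := by
  classical
  rw [Finsupp.mem_support_iff, Finsupp.mem_support_iff, localization_mult]
  split_ifs with h <;> simp [h]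

theorem mem_localization_of_mem {M : Multiarrangement K V} (X : Submodule K V) {θ : Der K V}
    (h : θ ∈ M.derModule) : θ ∈ (M.localization X).derModule := by
  classical
  rw [mem_derModule_iff] at h ⊢
  intro H hH
  obtain ⟨h1, h2⟩ := mem_support_localization.mp hH
  rw [localization_mult, if_pos h1]
  exact h H h2

/-- The structure of `D(𝒜_X, μ_X)` for `X = Y ∩ ker z` of codimension two. -/
theorem exists_localization_basis [FiniteDimensional K V] {M : Multiarrangement K V}
    {Y : Submodule K V} (hY : Y ∈ M.mult.support) {z : Dual K V} (hz : ¬ lin (form Y) ∣ lin z) :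
    ∃ (b : Basis (Fin (finrank K V)) (CoordRing K V)
        (M.localization (Y ⊓ LinearMap.ker z)).derModule)
      (i j : Fin (finrank K V)) (d e : ℕ) (c : K), i ≠ j ∧
      HasPdeg (b i : Der K V) d ∧ HasPdeg (b j : Der K V) e ∧
      (∀ k, k ≠ i → k ≠ j → HasPdeg (b k : Der K V) 0 ∧ (b k : Der K V) (lin z) = 0) ∧
      (¬ ∃ η : Der K V, (b i : Der K V) = lin (form Y) • η) ∧
      (∃ η : Der K V, (b j : Der K V) = lin (form Y) • η) ∧
      c ≠ 0 ∧ lin (form Y) ∣ (b i : Der K V) (lin z) - c • lin z ^ d := by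
  classical
  have hHyp := M.isHyperplane Y hY
  have h0 := form_ne_zero hHyp
  obtain ⟨x₀⟩ := exists_dual_basis K V (Fintype.card_fin (finrank K V))
  obtain ⟨x₁, i, hi⟩ := exists_basis_apply_eq x₀ h0
  obtain ⟨j, hji, hj⟩ : ∃ j, j ≠ i ∧ x₁.repr z j ≠ 0 := by
    by_contra! hcon
    apply hz
    have h1 := x₁.sum_repr z
    rw [Finset.sum_eq_single i (fun k _ hk => by rw [hcon k hk, zero_smul])
      (fun h => absurd (Finset.mem_univ _) h), hi] at h1
    rw [← h1, lin_smul]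
    exact dvd_smul_of_dvd _ dvd_rfl
  obtain ⟨h1, h2⟩ := linearIndependent_and_span_exchange x₁.linearIndependent j
    (x₁.sum_repr z).symm (IsUnit.mk0 _ hj)
  let x := Basis.mk h1 (by rw [h2, x₁.span_eq])
  have hxi : x i = form Y := by
    simp only [x, Basis.coe_mk]; rw [Function.update_of_ne hji.symm, hi]
  have hxj : x j = z := by
    simp only [x, Basis.coe_mk]; rw [Function.update_self]
  set X := Y ⊓ LinearMap.ker z with hX
  have hspan : ∀ H ∈ (M.localization X).mult.support,
      form H ∈ Submodule.span K {x i, x j} := fun H hH => by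
    obtain ⟨h3, h4⟩ := mem_support_localization.mp hH
    have h5 := mem_span_of_iInf_ker_le_ker (ι := Fin 2) (L := ![form Y, z]) (K := form H) (by
      intro v hv
      rw [ker_form (M.isHyperplane H h4)]
      rw [Submodule.mem_iInf] at hv
      refine h3 ⟨?_, hv 1⟩
      have := hv 0
      rw [← ker_form hHyp]
      exact this)
    rw [hxi, hxj]
    simpa [Matrix.range_cons, Matrix.range_empty, Set.pair_comm] using h5
  have hYX : Y ∈ (M.localization X).mult.support :=
    mem_support_localization.mpr ⟨inf_le_left, hY⟩
  have hYspan := hspan Y hYX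
  have hzspan : z ∈ Submodule.span K {x i, x j} := Submodule.subset_span (by rw [hxj]; simp)
  -- The multiplicity of `Y` is raised last, so that the final step gives the required divisibility
  -- by `α_Y`.
  obtain ⟨θ₀, d₀, hθ₀⟩ := exists_rankTwoBasis hji.symm _ ((M.localization X).deletion Y) rfl
    fun H hH => hspan H (mem_support_of_mem_support_deletion hH)
  obtain ⟨θ, d, a, b, hab, hθ, hb, ha⟩ := hθ₀.exists_step hji.symm hYX hYspan
  have haij : a = i ∨ a = j := by tauto
  have hne : a ≠ b := by
    rcases hab with ⟨rfl, rfl⟩ | ⟨rfl, rfl⟩ <;> [exact hji.symm; exact hji]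
  have hother : ∀ k, k ≠ a → k ≠ b → k ≠ i ∧ k ≠ j := by
    intro k hka hkb
    rcases hab with ⟨rfl, rfl⟩ | ⟨rfl, rfl⟩
    · exact ⟨hka, hkb⟩
    · exact ⟨hkb, hka⟩
  obtain ⟨B, hB⟩ := hθ.hom.exists_basis
  obtain ⟨c, q, hcq, -⟩ := exists_eq_of_mem_pow (lin_mem_span_pair hzspan)
    (exists_eq_add_of_lin h0 hYspan hzspan hz) _ (hθ.mem_pow a haij z hzspan)
  have hY1 : (M.localization X).mult Y ≠ 0 := Finsupp.mem_support_iff.mp hYX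
  have hdY : lin (form Y) ∣ θ a (lin (form Y)) :=
    (dvd_pow_self _ hY1).trans (dvd_of_mem (hθ.hom.mem a) (ker_form hHyp))
  refine ⟨B, a, b, d a, d b, c, hne, hB a ▸ hθ.hom.pdeg a, hB b ▸ hθ.hom.pdeg b,
    fun k hka hkb => ?_, by rwa [hB a], by rwa [hB b], ?_, ?_⟩
  · obtain ⟨h3, h4⟩ := hother k hka hkb
    obtain ⟨h5, h6⟩ := hθ.eq_partialDer k h3 h4
    refine ⟨?_, ?_⟩
    · have := hθ.hom.pdeg k
      rw [h6] at this
      rwa [hB k]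
    · rw [hB k, h5, ← hxj, partialDer_lin, if_neg h4]
  · rintro rfl
    apply ha
    -- If `c = 0`, then `α_Y` divides the values of `θ a` on all coordinates, so `θ a` would be a
    -- multiple of `α_Y`.
    have key : ∀ k, lin (form Y) ∣ θ a (lin (x k)) := fun k => by
      by_cases hki : k = i
      · rw [hki, hxi]; exact hdY
      by_cases hkj : k = j
      · rw [hkj, hxj, hcq, zero_smul, zero_add]; exact dvd_mul_right _ _
      · rw [hθ.apply_eq_zero a haij k hki hkj]; exact dvd_zero _
    refine exists_smul_eq_of_forall_dvd (lin_ne_zero h0) fun β => ?_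
    rw [der_lin_eq_sum x]
    exact Finset.dvd_sum fun k _ => (key k).mul_left _
  · rw [hB a, hcq, add_sub_cancel_left]
    exact dvd_mul_right _ _

/-- If the derivations of `(𝒜, μ)` restrict onto those of `N`, then `N` is the Euler restriction. -/
theorem isEulerRestriction_of_rel [FiniteDimensional K V] {M : Multiarrangement K V}
    {Y : Submodule K V} (hY : Y ∈ M.mult.support) {N : Multiarrangement K Y}
    (hN : N.toArrangement = M.toArrangement.restriction Y)
    (hMN : ∀ θ ∈ M.derModule, ∀ η, Rel Y.subtype θ η → η ∈ N.derModule)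
    (hNM : ∀ η ∈ N.derModule, ∃ θ ∈ M.derModule, Rel Y.subtype θ η) :
    M.IsEulerRestriction Y N := by
  classical
  refine ⟨hN, fun Z hZ => ?_⟩
  have hHyp := M.isHyperplane Y hY
  have hr : LinearMap.range Y.subtype = LinearMap.ker (form Y) := by
    rw [Submodule.range_subtype, ker_form hHyp]
  have hf := Y.injective_subtype
  have hZ' : Z ∈ (M.toArrangement.restriction Y).hyps := hN ▸ hZ
  obtain ⟨H', hH', hYH', hZH'⟩ := mem_restriction.mp hZ'
  have hHyp' := M.isHyperplane H' hH'
  have hz : ¬ lin (form Y) ∣ lin (form H') := by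
    rw [lin_dvd_lin_iff, ker_form hHyp, ker_form hHyp']; exact hYH'
  set z := form H' with hz_def
  have hX : Z.map Y.subtype = Y ⊓ LinearMap.ker z := by
    rw [← hZH', Submodule.map_comap_subtype, ker_form hHyp']
  have hloc := exists_localization_basis hY hz
  have hXY : Y ⊓ LinearMap.ker z ≤ Y := inf_le_left
  generalize Y ⊓ LinearMap.ker z = X at hX hloc hXY
  obtain ⟨b, i, j, d, e, c, hij, hdi, hdj, hk, hi, hj, hc, hzd⟩ := hloc
  have hmul : M.IsEulerMult Y (Z.map Y.subtype) d := by
    rw [hX]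
    exact ⟨form Y, b, i, j, e, ker_form hHyp, hij, hdi, hdj, fun k hki hkj => (hk k hki hkj).1,
      hi, hj⟩
  suffices h : N.mult Z = d by rw [h]; exact hmul
  set zb := z ∘ₗ Y.subtype with hzb
  have hkz : LinearMap.ker zb = Z := by
    rw [hzb, LinearMap.ker_comp, ker_form hHyp', hZH']
  have hzb0 : zb ≠ 0 := by
    intro h
    have := (N.isHyperplane Z hZ).ne_top
    rw [← hkz, h, LinearMap.ker_zero] at this
    exact this rfl
  have hp := prime_lin hzb0
  have hresz : res Y.subtype (lin z) = lin zb := res_lin _ _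
  have hresi : res Y.subtype ((b i : Der K V) (lin z)) = c • lin zb ^ d := by
    have := (res_eq_zero_iff hf hr).mpr hzd
    rw [map_sub, sub_eq_zero, map_smul, map_pow, hresz] at this
    exact this
  apply le_antisymm
  -- Upper bound: multiplying the local derivation by the forms of the hyperplanes not containing
  -- `X` gives an element of `D(𝒜, μ)`. Its restriction to `Y` takes the value `c g z̄ ^ d` at `z̄`,
  -- with `g` restricted to `Y` prime to `z̄`.
  · set g := ∏ H ∈ M.mult.support.filter (fun H => ¬ X ≤ H), lin (form H) ^ M.mult H with hg
    have hgM : g • (b i : Der K V) ∈ M.derModule := by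
      rw [mem_derModule_iff]
      intro H hH
      rw [Derivation.smul_apply, smul_eq_mul]
      by_cases hXH : X ≤ H
      · have h1 := dvd_of_mem (b i).2 (ker_form (M.isHyperplane H hH))
        rw [localization_mult, if_pos hXH] at h1
        exact h1.mul_left _
      · exact (Finset.dvd_prod_of_mem (fun H => lin (form H) ^ M.mult H)
          (Finset.mem_filter.mpr ⟨hH, hXH⟩)).mul_right _
    have hYX : Y ∈ (M.localization X).mult.support :=
      mem_support_localization.mpr ⟨hXY, hY⟩
    obtain ⟨η, hη⟩ := exists_rel_of_dvd hf hr (θ := (b i : Der K V))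
      ((dvd_pow_self _ (Finsupp.mem_support_iff.mp hYX)).trans
        (dvd_of_mem (b i).2 (ker_form hHyp)))
    have h1 := dvd_of_mem (hMN _ hgM _ (hη.smul g)) hkz
    rw [Derivation.smul_apply, smul_eq_mul, hzb, hη, ← hzb, hresi] at h1
    have h2 : ¬ lin zb ∣ res Y.subtype g := by
      rw [hg, map_prod]
      intro hd
      obtain ⟨H, hH, h3⟩ := (hp.dvd_finsetProd_iff _).mp hd
      obtain ⟨hHM, hXH⟩ := Finset.mem_filter.mp hH
      rw [map_pow, res_lin] at h3
      have h4 := lin_dvd_lin_iff.mp (hp.dvd_of_dvd_pow h3)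
      rw [hkz, LinearMap.ker_comp, ker_form (M.isHyperplane H hHM)] at h4
      apply hXH
      rw [← hX]
      exact Submodule.map_le_iff_le_comap.mpr h4
    have h3 : lin zb ^ N.mult Z ∣ c • lin zb ^ d :=
      IsRelPrime.dvd_of_dvd_mul_left
        (IsRelPrime.pow_left (hp.irreducible.isRelPrime_iff_not_dvd.mpr h2)) h1
    have h4 := dvd_smul_of_dvd c⁻¹ h3
    rw [smul_smul, inv_mul_cancel₀ hc, one_smul] at h4
    exact (pow_dvd_pow_iff hp.ne_zero hp.not_isUnit).mp h4
  · obtain ⟨v, hv⟩ : ∃ v, zb v = 1 := by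
      obtain ⟨w, hw⟩ : ∃ w, zb w ≠ 0 := by
        by_contra! h'
        exact hzb0 (LinearMap.ext h')
      exact ⟨(zb w)⁻¹ • w, by rw [map_smul, smul_eq_mul, inv_mul_cancel₀ hw]⟩
    set R := ∏ Z' ∈ N.mult.support.erase Z, lin (form Z') ^ N.mult Z' with hR
    -- Lower bound: a test derivation with value `R z̄ ^ N(Z)` at `z̄`, where `R` is prime to `z̄`.
    -- Once it is lifted and expanded in the local basis, only the term of `b i` survives at `z` on
    -- `Y`, and it contributes a factor `z̄ ^ d`.
    have hηN : dirDer (R * lin zb ^ N.mult Z) v ∈ N.derModule := by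
      rw [mem_derModule_iff]
      intro Z' hZ'
      by_cases hZZ : Z' = Z
      · subst hZZ
        refine dvd_of_ker_eq (hkz.trans (ker_form (N.isHyperplane Z' hZ)).symm) ?_
        rw [dirDer_lin]
        exact (dvd_mul_left _ _).mul_right _
      · rw [dirDer_lin, mul_assoc]
        exact (Finset.dvd_prod_of_mem (fun Z' => lin (form Z') ^ N.mult Z')
          (Finset.mem_erase.mpr ⟨hZZ, hZ'⟩)).mul_right _
    obtain ⟨θ, hθ, hrel⟩ := hNM _ hηN
    have h1 : (⟨θ, mem_localization_of_mem X hθ⟩ : (M.localization X).derModule) =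
        ∑ k, b.repr ⟨θ, mem_localization_of_mem X hθ⟩ k • b k := (b.sum_repr _).symm
    set f := b.repr ⟨θ, mem_localization_of_mem X hθ⟩ with hf_def
    have h2 : θ = ∑ k, f k • (b k : Der K V) := by
      have := congrArg Subtype.val h1
      rw [AddSubmonoidClass.coe_finsetSum] at this
      exact this
    have h3 := hrel z
    rw [← hzb, dirDer_lin, hv, map_one, mul_one, h2, der_sum_smul_apply, map_sum] at h3
    have h4 : lin zb ^ d ∣ R * lin zb ^ N.mult Z := by
      rw [h3]
      refine Finset.dvd_sum fun k _ => ?_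
      rw [map_mul]
      by_cases hki : k = i
      · rw [hki, hresi]
        exact (dvd_smul_of_dvd c dvd_rfl).mul_left _
      by_cases hkj : k = j
      · obtain ⟨η, hη⟩ := hj
        rw [hkj, hη, Derivation.smul_apply, smul_eq_mul, map_mul, res_lin_eq_zero hr, zero_mul,
          mul_zero]
        exact dvd_zero _
      · rw [(hk k hki hkj).2, map_zero, mul_zero]
        exact dvd_zero _
    have h5 : ¬ lin zb ∣ R := by
      intro hd
      obtain ⟨Z', hZ', h6⟩ := (hp.dvd_finsetProd_iff _).mp hd
      have h7 := lin_dvd_lin_iff.mp (hp.dvd_of_dvd_pow h6)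
      have hZh' := N.isHyperplane Z' (Finset.mem_of_mem_erase hZ')
      rw [hkz, ker_form hZh'] at h7
      exact Finset.ne_of_mem_erase hZ' ((N.isHyperplane Z hZ).eq_of_le hZh' h7).symm
    have h6 := IsRelPrime.dvd_of_dvd_mul_left
      (IsRelPrime.pow_left (hp.irreducible.isRelPrime_iff_not_dvd.mpr h5)) h4
    exact (pow_dvd_pow_iff hp.ne_zero hp.not_isUnit).mp h6

end Multiarrangement

end EulerRestriction

end HypArr

end

noncomputable section

namespace HypArr

/-! ### Restrictions of pulled back arrangements -/

section Pull

variable {K V W X : Type*} [Field K] [AddCommGroup V] [Module K V] [AddCommGroup W] [Module K W]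
  [AddCommGroup X] [Module K X]

theorem map_univ_val_eq_cons {ι : Type*} [Fintype ι] [DecidableEq ι] (d : ι → ℕ) (j : ι) :
    (Finset.univ.val.map d : Multiset ℕ) =
      d j ::ₘ (Finset.univ.val.map fun i : {i // i ≠ j} => d i) := by
  have key : ∀ {κ : Type _} [Fintype κ] (e : κ → ℕ),
      (Finset.univ.val.map e : Multiset ℕ) = ∑ i, ({e i} : Multiset ℕ) := fun e => by
    rw [← Multiset.sum_map_singleton (Finset.univ.val.map e), Multiset.map_map]; rfl
  rw [key d, Fintype.sum_eq_add_sum_subtype_ne _ j, ← key fun i : {i // i ≠ j} => d i,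
    Multiset.singleton_add]

theorem apply_eq_zero_of_ker_le {α β : Dual K V} {θ : Der K V}
    (h : LinearMap.ker α ≤ LinearMap.ker β) (hα : θ (lin α) = 0) : θ (lin β) = 0 := by
  obtain ⟨c, rfl⟩ := exists_smul_of_ker_le h
  rw [lin_smul, Derivation.map_smul, hα, smul_zero]

theorem range_le_ker_of_comp_eq_zero {f : W →ₗ[K] V} {α : Dual K V} (h : α ∘ₗ f = 0) :
    LinearMap.range f ≤ LinearMap.ker α := by
  rintro _ ⟨w, rfl⟩
  exact LinearMap.congr_fun h w

theorem eq_zero_of_comp_eq_zero {f : W →ₗ[K] V} (hf : LinearMap.range f = ⊤) {α : Dual K V}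
    (h : α ∘ₗ f = 0) : α = 0 :=
  LinearMap.ker_eq_top.mp (top_le_iff.mp (hf ▸ range_le_ker_of_comp_eq_zero h))

/-- The derivation `θ` annihilates all linear forms that vanish on the image of `f`. -/
def KillsConormal (f : W →ₗ[K] V) (θ : Der K V) : Prop :=
  ∀ α : Dual K V, α ∘ₗ f = 0 → θ (lin α) = 0

theorem killsConormal_of_range_eq_top {f : W →ₗ[K] V} (hf : LinearMap.range f = ⊤)
    (θ : Der K V) : KillsConormal f θ := fun α hα => by
  rw [eq_zero_of_comp_eq_zero hf hα, lin_zero, map_zero]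

theorem killsConormal_of_apply_eq_zero {f : W →ₗ[K] V} {α₀ : Dual K V}
    (hr : LinearMap.range f = LinearMap.ker α₀) {θ : Der K V} (h : θ (lin α₀) = 0) :
    KillsConormal f θ := fun _ hα =>
  apply_eq_zero_of_ker_le (hr ▸ range_le_ker_of_comp_eq_zero hα) h

theorem KillsConormal.exists_rel {f : W →ₗ[K] V} (hf : Function.Injective f) {θ : Der K V}
    (h : KillsConormal f θ) : ∃ η, Rel f θ η :=
  HypArr.exists_rel hf fun α hα => by rw [h α hα, map_zero]

/-- The derivations of the pulled back multiarrangement all come from derivations of `𝒜`. -/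
def PullLifts (A : Arrangement K V) (f : W →ₗ[K] V) : Prop :=
  ∀ η ∈ (A.pull f).derModule, ∃ θ ∈ A.derModule, KillsConormal f θ ∧ Rel f θ η

theorem exps_pull_of_range_eq_top [FiniteDimensional K V] {A : Arrangement K V} {E : Multiset ℕ}
    (h : HasExponents A.derModule E) {f : W →ₗ[K] V} (hf : Function.Injective f)
    (hr : LinearMap.range f = ⊤) : HasExponents (A.pull f).derModule E ∧ PullLifts A f := by
  obtain ⟨θ, d, hθ, rfl⟩ := exists_homBasis_of_hasExponents h rfl
  have hbij : Function.Bijective f := ⟨hf, LinearMap.range_eq_top.mp hr⟩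
  obtain ⟨η, hη, hb⟩ := hθ.pull_of_bijective (by simp) hbij
  refine ⟨hb.hasExponents ?_, fun ζ hζ => ?_⟩
  · rw [Fintype.card_fin]
    exact (LinearEquiv.ofBijective f hbij).finrank_eq.symm
  · obtain ⟨ξ, hξ, hrel⟩ := exists_lift_of_basis hf hb hθ.mem hη hζ
    exact ⟨ξ, hξ, killsConormal_of_range_eq_top hr ξ, hrel⟩

/-- By Ziegler's theorem the Euler derivation accounts for the lost exponent 1; the other basis
members kill `α_H`, and so does every combination of them used as a lift. -/
theorem exps_pull_of_range_mem [FiniteDimensional K V] {A : Arrangement K V} {E : Multiset ℕ}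
    (h : HasExponents A.derModule E) {f : W →ₗ[K] V} (hf : Function.Injective f)
    {H : Submodule K V} (hH : H ∈ A.hyps) (hr : LinearMap.range f = H) :
    HasExponents (A.pull f).derModule (E.erase 1) ∧ PullLifts A f := by
  classical
  have hHyp := A.isHyperplane H hH
  have hr' := hr.trans (ker_form hHyp).symm
  obtain ⟨θ, d, hθ, rfl⟩ := exists_homBasis_of_hasExponents h rfl
  obtain ⟨j, hj, ψ, η, hψ, hrel, hb⟩ := hθ.ziegler hH hf hr (by simp)
  have hfr := finrank_add_one_of_range_eq hf (form_ne_zero hHyp) hr'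
  constructor
  · rw [map_univ_val_eq_cons d j, hj, Multiset.erase_cons_head]
    refine hb.hasExponents ?_
    rw [Fintype.card_subtype_compl, Fintype.card_subtype_eq, Fintype.card_fin]; omega
  · intro ζ hζ
    obtain ⟨ξ, hξ, hrel'⟩ := exists_lift_of_basis
      (D := Submodule.span (CoordRing K V) (Set.range ψ)) hf hb
      (fun i => Submodule.subset_span ⟨i, rfl⟩) hrel hζ
    refine ⟨ξ, ?_, killsConormal_of_apply_eq_zero hr' ?_, hrel'⟩
    · refine Submodule.span_le.mpr ?_ hξ
      rintro _ ⟨i, rfl⟩; exact (hψ i).1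
    · obtain ⟨c, rfl⟩ := (Submodule.mem_span_range_iff_exists_fun _).mp hξ
      rw [der_sum_smul_apply]
      exact Finset.sum_eq_zero fun i _ => by rw [(hψ i).2, mul_zero]

/-- Modify a derivation by a multiple of the Euler derivation so that it annihilates `α_H`. -/
theorem exists_sub_smul_eulerDer {A : Arrangement K V} {H : Submodule K V} (hH : H ∈ A.hyps)
    {θ : Der K V} (hθ : θ ∈ A.derModule) : ∃ s, θ - s • eulerDer K V ∈ A.derModule ∧
      (θ - s • eulerDer K V) (lin (form H)) = 0 ∧ θ (lin (form H)) = s * lin (form H) := by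
  obtain ⟨s, hs⟩ := Arrangement.mem_derModule_iff.mp hθ H hH
  refine ⟨s, Submodule.sub_mem _ hθ (Submodule.smul_mem _ _ A.eulerDer_mem), ?_, ?_⟩
  · rw [Derivation.sub_apply, Derivation.smul_apply, eulerDer_lin, hs, smul_eq_mul, mul_comm,
      sub_self]
  · rw [hs, mul_comm]

theorem support_pull_comp (A : Arrangement K V) (f : W →ₗ[K] V) (Y : Submodule K W) :
    (A.pull (f ∘ₗ Y.subtype)).toArrangement = (A.pull f).toArrangement.restriction Y := by
  ext Z
  change Z ∈ (A.pull (f ∘ₗ Y.subtype)).mult.support ↔ _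
  rw [Arrangement.mem_support_pull, mem_restriction]
  constructor
  · rintro ⟨hT, H, hH, rfl⟩
    have h1 : ¬ Y ≤ H.comap f := fun h => hT (by
      rw [Submodule.comap_comp]
      exact (comap_eq_top_iff_of_range_eq Y.range_subtype).mpr h)
    exact ⟨H.comap f, Arrangement.mem_support_pull.mpr ⟨fun h => h1 (h ▸ le_top), H, hH, rfl⟩, h1,
      (Submodule.comap_comp _ _ _).symm⟩
  · rintro ⟨H', hH', hY, rfl⟩
    obtain ⟨-, H, hH, rfl⟩ := Arrangement.mem_support_pull.mp hH'
    exact ⟨fun h => hY ((comap_eq_top_iff_of_range_eq Y.range_subtype).mp h), H, hH,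
      Submodule.comap_comp _ _ _⟩

theorem support_restriction_pull (A : Arrangement K V) (H : Submodule K V) (g : W →ₗ[K] H) :
    ((A.restriction H).pull g).mult.support = (A.pull (H.subtype ∘ₗ g)).mult.support := by
  ext Z
  rw [Arrangement.mem_support_pull, Arrangement.mem_support_pull]
  refine and_congr_right fun hT => ?_
  constructor
  · rintro ⟨H', hH', rfl⟩
    obtain ⟨H₁, h1, -, rfl⟩ := mem_restriction.mp hH'
    exact ⟨H₁, h1, Submodule.comap_comp _ _ _⟩
  · rintro ⟨H₁, h1, rfl⟩
    refine ⟨H₁.comap H.subtype, mem_restriction.mpr ⟨H₁, h1, fun h => hT ?_, rfl⟩,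
      (Submodule.comap_comp _ _ _).symm⟩
    rw [Submodule.comap_comp, (comap_eq_top_iff_of_range_eq H.range_subtype).mpr h,
      Submodule.comap_top]

theorem pull_deletion {A : Arrangement K V} {H : Submodule K V} (hH : H ∈ A.hyps)
    {f : W →ₗ[K] V} (hT : H.comap f ≠ ⊤) :
    (A.pull f).deletion (H.comap f) = (A.deletion H).pull f := by
  classical
  ext Y
  by_cases hY : Y = H.comap f
  · subst hY
    have hm : H ∈ A.hyps.filter fun H' => H'.comap f = H.comap f :=
      Finset.mem_filter.mpr ⟨hH, rfl⟩
    rw [Multiarrangement.deletion_mult_self, Arrangement.pull_mult, Arrangement.pull_mult,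
      if_neg hT, if_neg hT, Arrangement.deletion, Finset.filter_erase, Finset.card_erase_of_mem hm]
  · rw [Multiarrangement.deletion_mult_of_ne _ hY, Arrangement.pull_mult, Arrangement.pull_mult]
    split_ifs with h
    · rfl
    · rw [Arrangement.deletion, Finset.filter_erase, Finset.erase_eq_of_notMem]
      intro h'
      exact hY (Finset.mem_filter.mp h').2.symm

/-- The localization at `Y` consists of `H` and the hyperplanes that meet `H` exactly in `Y`;
subtracting one discards `H`. -/
theorem zieglerRestriction_eq_pull {A : Arrangement K V} {H : Submodule K V} (hH : H ∈ A.hyps) :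
    A.zieglerRestriction H = A.pull H.subtype := by
  classical
  ext Y
  change (if Y ∈ (A.restriction H).hyps then _ else 0) = _
  rw [← support_pull_subtype]
  split_ifs with hY
  · obtain ⟨hT, -⟩ := Arrangement.mem_support_pull.mp hY
    have hYh := (A.pull H.subtype).isHyperplane Y hY
    have h1 : (A.localization (Y.map H.subtype)).hyps =
        insert H (A.hyps.filter fun H' => H'.comap H.subtype = Y) := by
      ext H'
      rw [Arrangement.localization, Finset.mem_filter, Finset.mem_insert, Finset.mem_filter,
        Submodule.map_le_iff_le_comap]
      constructor
      · rintro ⟨hH', hle⟩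
        by_cases hT' : H'.comap H.subtype = ⊤
        · left
          rw [comap_eq_top_iff_of_range_eq H.range_subtype] at hT'
          exact ((A.isHyperplane H hH).eq_of_le (A.isHyperplane H' hH') hT').symm
        · right
          exact ⟨hH', (hYh.eq_of_le ((A.isHyperplane H' hH').comap hT') hle).symm⟩
      · rintro (rfl | ⟨hH', h⟩)
        · exact ⟨hH, by
            rw [(comap_eq_top_iff_of_range_eq H'.range_subtype).mpr le_rfl]; exact le_top⟩
        · exact ⟨hH', h.ge⟩
    rw [h1, Finset.card_insert_of_notMem, Nat.add_sub_cancel, Arrangement.pull_mult, if_neg hT]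
    intro h
    exact hT (by
      rw [← (Finset.mem_filter.mp h).2]
      exact (comap_eq_top_iff_of_range_eq H.range_subtype).mpr le_rfl)
  · exact (Finsupp.notMem_support_iff.mp hY).symm

end Pull

/-! ### The inductive steps -/

section Steps

universe u' v'

variable {K : Type u'} [Field K] {V : Type v'} [AddCommGroup V] [Module K V]
  {W : Type v'} [AddCommGroup W] [Module K W]

/-- Adding a hyperplane whose intersection with the image of `f` is proper. -/
theorem isInductivelyFreeMulti_pull_of_deletion [FiniteDimensional K V] [FiniteDimensional K W]
    {A : Arrangement K V} {H : Submodule K V} (hH : H ∈ A.hyps) {f : W →ₗ[K] V}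
    (hf : Function.Injective f) (hT : H.comap f ≠ ⊤) {g : H.comap f →ₗ[K] H}
    (hg : H.subtype ∘ₗ g = f ∘ₗ (H.comap f).subtype) (hA : PullLifts A f)
    (hA'' : PullLifts (A.restriction H) g)
    (hext : ∀ β : Dual K H, β ∘ₗ g = 0 → ∃ α : Dual K V, α ∘ₗ f = 0 ∧ α ∘ₗ H.subtype = β)
    (hlift : ∀ ξ ∈ (A.restriction H).derModule, KillsConormal g ξ →
      ∃ ζ ∈ A.derModule, KillsConormal f ζ ∧ Rel H.subtype ζ ξ)
    (hdel : IsInductivelyFreeMulti K W ((A.deletion H).pull f))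
    (hres : IsInductivelyFreeMulti K (H.comap f) ((A.restriction H).pull g))
    {E' E'' : Multiset ℕ} (hE' : HasExponents ((A.deletion H).pull f).derModule E')
    (hE'' : HasExponents ((A.restriction H).pull g).derModule E'') (hE : E'' ≤ E') :
    IsInductivelyFreeMulti K W (A.pull f) := by
  have hHyp := A.isHyperplane H hH
  have hY : H.comap f ∈ (A.pull f).mult.support :=
    Arrangement.mem_support_pull.mpr ⟨hT, H, hH, rfl⟩
  refine IsInductivelyFreeMulti.add W (A.pull f) (H.comap f) hY ((A.restriction H).pull g) ?_
    ((pull_deletion hH hT).symm ▸ hdel) hres E' E'' ((pull_deletion hH hT).symm ▸ hE') hE'' hE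
  refine Multiarrangement.isEulerRestriction_of_rel hY ?_ ?_ ?_
  · rw [← support_pull_comp]
    ext Z
    change Z ∈ ((A.restriction H).pull g).mult.support ↔ _
    rw [support_restriction_pull, hg]
    rfl
  -- Into: lift `θ` to `D(𝒜)`, restrict to `H`, then to the intersection. By `hext` conormal forms
  -- of `g` extend to conormal forms of `f`, so the second restriction respects the multiplicities.
  · intro θ hθ η hη
    obtain ⟨ζ, hζ, hζ0, hζθ⟩ := hA θ hθ
    obtain ⟨ξ, hξ⟩ := exists_rel_of_dvd H.injective_subtype
      ((Submodule.range_subtype H).trans (ker_form hHyp).symm)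
      (Arrangement.mem_derModule_iff.mp hζ H hH)
    have h1 : Rel (H.subtype ∘ₗ g) ζ η := by rw [hg]; exact hζθ.comp hη
    refine mem_derModule_pull (mem_derModule_restriction hζ hξ)
      (hξ.of_comp H.injective_subtype h1) fun β hβ => ?_
    obtain ⟨α, hα, rfl⟩ := hext β hβ
    rw [hξ, hζ0 α hα, map_zero]
  · intro η hη
    obtain ⟨ξ, hξ, hξ0, hξη⟩ := hA'' η hη
    obtain ⟨ζ, hζ, hζ0, hζξ⟩ := hlift ξ hξ hξ0
    obtain ⟨θ, hθ⟩ := hζ0.exists_rel hf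
    refine ⟨θ, mem_derModule_pull hζ hθ hζ0, hθ.of_comp hf ?_⟩
    rw [← hg]
    exact hζξ.comp hξη

theorem pull_mult_eq_one_of_bijective {A : Arrangement K V} {f : W →ₗ[K] V}
    (hf : Function.Bijective f) {Y : Submodule K W} (hY : Y ∈ (A.pull f).mult.support) :
    (A.pull f).mult Y = 1 := by
  classical
  obtain ⟨hT, H, hH, rfl⟩ := Arrangement.mem_support_pull.mp hY
  rw [Arrangement.pull_mult, if_neg hT, Finset.card_eq_one]
  refine ⟨H, ?_⟩
  ext H'
  rw [Finset.mem_filter, Finset.mem_singleton]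
  constructor
  · rintro ⟨-, h⟩
    exact Submodule.comap_injective_of_surjective hf.2 h
  · rintro rfl; exact ⟨hH, rfl⟩

/-- A basis of the module of the restriction that consists of the Euler derivation and of
derivations that respect the Ziegler multiplicity. -/
theorem exists_ziegler_basis [FiniteDimensional K V] {A : Arrangement K V} {H : Submodule K V}
    (hH : H ∈ A.hyps) {E' E'' : Multiset ℕ} (hE' : HasExponents (A.deletion H).derModule E')
    (hE'' : HasExponents (A.restriction H).derModule E'') (hE : E'' ≤ E')
    (hne : (A.restriction H).hyps.Nonempty) {e : W →ₗ[K] H} (he : Function.Bijective e) :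
    ∃ (ι : Type) (_ : Fintype ι) (_ : DecidableEq ι) (η : ι → Der K W) (d : ι → ℕ) (j : ι),
      Fintype.card ι = finrank K W ∧ HomBasis ((A.restriction H).pull e).derModule η d ∧
      η j = eulerDer K W ∧ d j = 1 ∧ (∀ i, i ≠ j → η i ∈ (A.pull (H.subtype ∘ₗ e)).derModule) ∧
      HasExponents (A.restriction H).derModule (Finset.univ.val.map d) := by
  classical
  have hHyp := A.isHyperplane H hH
  have h0 := form_ne_zero hHyp
  have hrs : LinearMap.range H.subtype = LinearMap.ker (form H) := by
    rw [Submodule.range_subtype, ker_form hHyp]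
  obtain ⟨θ, d, j, η, hθ, hrel, hη⟩ := addition hH hE' hE'' hE
  obtain ⟨H₁, hH₁⟩ := hne
  obtain ⟨k, hk, hbas⟩ := hη.exists_euler hH₁
  choose s hs1 hs2 hs3 using fun i => exists_sub_smul_eulerDer hH (hθ.mem i)
  -- Subtracting `s i` times the Euler derivation on `V` makes `θ i` kill `α_H`, so its restriction
  -- respects the multiplicities of `𝒜` on `H`. On `H` this is subtraction of a multiple of the
  -- Euler derivation, which still leaves a basis.
  have hb := hbas (fun i => res H.subtype (s i)) fun i => by
    by_cases hz : s i = 0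
    · rw [hz, map_zero, zero_smul]; exact hasPdeg_zero _
    · have h1 := hθ.pdeg i (form H)
      rw [hs3, mul_comm] at h1
      obtain ⟨hle, h2⟩ := mem_homogPart_of_mul (lin_mem_homogPart (form H))
        (mul_ne_zero (lin_ne_zero h0) hz) h1
      have h3 := hasPdeg_eulerDer.smul (res_mem_homogPart H.subtype h2)
      rwa [Nat.sub_add_cancel hle] at h3
  have hcard : Fintype.card {i // i ≠ j} = finrank K H := by
    have := finrank_add_one_of_range_eq H.injective_subtype h0 hrs
    rw [Fintype.card_subtype_compl, Fintype.card_subtype_eq, Fintype.card_fin]; omega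
  obtain ⟨ω, hω, hωb⟩ := hb.pull_of_bijective hcard he
  refine ⟨{i // i ≠ j}, inferInstance, inferInstance, ω, fun i => d i, k,
    hcard.trans (LinearEquiv.ofBijective e he).finrank_eq.symm, hωb, ?_, hk, fun i hi => ?_,
    hη.hasExponents hcard⟩
  · have h1 := hω k
    rw [Function.update_self] at h1
    exact h1.unique he.1 (rel_eulerDer e)
  · have h1 := hω i
    rw [Function.update_of_ne hi] at h1
    have h2 : Rel H.subtype (θ i - s i • eulerDer K V)
        (η i - res H.subtype (s i) • eulerDer K H) :=
      (hrel i).sub ((rel_eulerDer H.subtype).smul (s i))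
    refine mem_derModule_pull (hs1 i) (h2.comp h1) ?_
    refine killsConormal_of_apply_eq_zero (α₀ := form H) ?_ (hs2 i)
    rw [LinearMap.range_comp, LinearMap.range_eq_top.mpr he.2, Submodule.map_top, hrs]

theorem mem_derModule_of_mult_le {M N : Multiarrangement K W} (h : ∀ Y, M.mult Y ≤ N.mult Y)
    {θ : Der K W} (hθ : θ ∈ N.derModule) : θ ∈ M.derModule := by
  rw [Multiarrangement.mem_derModule_iff]
  intro Y hY
  exact (pow_dvd_pow _ (h Y)).trans
    (Multiarrangement.dvd_of_mem hθ (ker_form (M.isHyperplane Y hY)))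

end Steps

end HypArr

end

noncomputable section

namespace HypArr

/-! ### Multiplicities between a simple arrangement and its Ziegler multiplicity -/

section Chain

variable {K : Type u} [Field K] {V : Type v} [AddCommGroup V] [Module K V]
  {W : Type v} [AddCommGroup W] [Module K W]

/-- All natural multiarrangements on hyperplanes of `𝒜`, and on `V` itself, are inductively free. -/
def IsHereditarilyFree (A : Arrangement K V) : Prop :=
  ∀ (W : Type v) [AddCommGroup W] [Module K W] (f : W →ₗ[K] V), Function.Injective f →
    (LinearMap.range f = ⊤ ∨ LinearMap.range f ∈ A.hyps) → IsInductivelyFreeMulti K W (A.pull f)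

/-- Raising the multiplicities of a simple arrangement multiplies the Euler derivation of a suitable
basis by a product of linear forms. -/
theorem HomBasis.update_euler [FiniteDimensional K W] {S M : Multiarrangement K W} {ι : Type*}
    [Fintype ι] [DecidableEq ι] {η : ι → Der K W} {d : ι → ℕ} (h : HomBasis S.derModule η d)
    {j : ι} (hj : η j = eulerDer K W) (hη : ∀ i, i ≠ j → η i ∈ M.derModule)
    (hSM : ∀ Y, S.mult Y ≤ M.mult Y) :
    ∃ (θ : ι → Der K W) (p : ℕ), HomBasis M.derModule θ (Function.update d j p) := by
  -- The Euler derivation supplies one factor `α_Y` at every `Y`; the multiplier must supply the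
  -- other `M(Y) - 1`.
  have ha : ∀ c : CoordRing K W, c • η j ∈ M.derModule ↔
      ∏ Y ∈ M.mult.support, lin (form Y) ^ (M.mult Y - 1) ∣ c := by
    intro c
    have hstep : ∀ Y ∈ M.mult.support, lin (form Y) ^ M.mult Y ∣ (c • η j) (lin (form Y)) ↔
        lin (form Y) ^ (M.mult Y - 1) ∣ c := by
      intro Y hY
      have hpos : M.mult Y - 1 + 1 = M.mult Y :=
        Nat.sub_add_cancel (Nat.one_le_iff_ne_zero.mpr (Finsupp.mem_support_iff.mp hY))
      rw [hj, Derivation.smul_apply, smul_eq_mul, eulerDer_lin]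
      conv_lhs => rw [← hpos, pow_succ]
      exact mul_dvd_mul_iff_right (lin_ne_zero (form_ne_zero (M.isHyperplane Y hY)))
    rw [Multiarrangement.mem_derModule_iff]
    constructor
    · intro hc
      refine Finset.prod_dvd_of_isRelPrime (fun Y hY Y' hY' hne => ?_) fun Y hY =>
        (hstep Y hY).mp (hc Y hY)
      have h1 := M.isHyperplane Y hY
      have h2 := M.isHyperplane Y' hY'
      refine IsRelPrime.pow (isRelPrime_lin (form_ne_zero h1) (form_ne_zero h2) ?_)
      rwa [ker_form h1, ker_form h2]
    · exact fun hc Y hY => (hstep Y hY).mpr ((Finset.dvd_prod_of_mem _ hY).trans hc)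
  exact ⟨_, _, h.step (fun θ hθ => mem_derModule_of_mult_le hSM hθ) j
    (Finset.prod_ne_zero_iff.mpr fun Y hY =>
      pow_ne_zero _ (lin_ne_zero (form_ne_zero (M.isHyperplane Y hY))))
    (prod_mem_homogPart _ _ _ fun Y _ => pow_mem_homogPart (lin_mem_homogPart (form Y)) _)
    (fun _ => 0) (fun i hi => by rw [zero_smul, sub_zero]; exact hη i hi) ((ha _).mpr dvd_rfl)
    (fun c => (ha c).mp) (fun i _ => by rw [zero_smul]; exact hasPdeg_zero _)⟩

/-- Restricting a multiarrangement between `𝒜` and its Ziegler multiplicity to a hyperplane of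
multiplicity at least two gives the natural multiarrangement of `𝒜` on that hyperplane. -/
theorem isEulerRestriction_pull [FiniteDimensional K V] [FiniteDimensional K W]
    {B : Arrangement K V} {e : W →ₗ[K] V} (he : Function.Bijective e) (hB : PullLifts B e)
    {M N : Multiarrangement K W}
    (hN : ∀ ω ∈ (B.pull e).derModule, ∃ c : CoordRing K W, ω - c • eulerDer K W ∈ N.derModule)
    (hSM : ∀ Y, (B.pull e).mult Y ≤ M.mult Y) (hMN : ∀ Y, M.mult Y ≤ N.mult Y)
    (hsupp : M.mult.support = (B.pull e).mult.support)
    {Y : Submodule K W} (hY : 2 ≤ M.mult Y) (hBY : PullLifts B (e ∘ₗ Y.subtype)) :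
    M.IsEulerRestriction Y (B.pull (e ∘ₗ Y.subtype)) := by
  have hYM : Y ∈ M.mult.support := Finsupp.mem_support_iff.mpr (by omega)
  have hHyp := M.isHyperplane Y hYM
  have h0 := lin_ne_zero (form_ne_zero hHyp)
  have hr : LinearMap.range Y.subtype = LinearMap.ker (form Y) := by
    rw [Submodule.range_subtype, ker_form hHyp]
  have hYf := Y.injective_subtype
  have hS : eulerDer K W ∈ (B.pull e).derModule := by
    obtain ⟨η, hη⟩ := exists_rel_of_bijective he (eulerDer K V)
    have := mem_derModule_pull B.eulerDer_mem hη
      (killsConormal_of_range_eq_top (LinearMap.range_eq_top.mpr he.2) _)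
    rwa [hη.unique he.1 (rel_eulerDer e)] at this
  have hsq : ∀ {L : Multiarrangement K W}, (∀ Z, M.mult Z ≤ L.mult Z) → ∀ θ ∈ L.derModule,
      lin (form Y) ^ 2 ∣ θ (lin (form Y)) := fun hL θ hθ =>
    (pow_dvd_pow _ (hY.trans (hL Y))).trans (Multiarrangement.dvd_of_mem hθ (ker_form hHyp))
  have hrel0 : ∀ c : CoordRing K W, lin (form Y) ∣ c → ∀ {θ : Der K W} {η : Der K Y},
      Rel Y.subtype θ η → Rel Y.subtype (θ - c • eulerDer K W) η := fun c hc θ η h => by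
    have := h.sub ((rel_eulerDer Y.subtype).smul c)
    rwa [(res_eq_zero_iff hYf hr).mpr hc, zero_smul, sub_zero] at this
  refine Multiarrangement.isEulerRestriction_of_rel hYM ?_ ?_ ?_
  · rw [support_pull_comp]
    congr 1
    exact Arrangement.ext hsupp.symm
  · intro θ hθ η hη
    obtain ⟨g, hg⟩ := hsq (fun _ => le_rfl) θ hθ
    -- As `θ(α_Y) = α_Y ^ 2 g`, this correction makes `θ` kill `α_Y`, and it leaves the restriction
    -- to `Y` unchanged because its coefficient is divisible by `α_Y`.
    have h1 := hrel0 (lin (form Y) * g) (dvd_mul_right _ _) hη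
    have hk : (θ - (lin (form Y) * g) • eulerDer K W) (lin (form Y)) = 0 := by
      rw [Derivation.sub_apply, Derivation.smul_apply, eulerDer_lin, hg, smul_eq_mul]; ring
    have hkill := killsConormal_of_apply_eq_zero hr hk
    obtain ⟨ξ, hξ, -, hrel⟩ := hB _ (Submodule.sub_mem _ (mem_derModule_of_mult_le hSM hθ)
      (Submodule.smul_mem _ (lin (form Y) * g) hS))
    refine mem_derModule_pull hξ (hrel.comp h1) fun β hβ => ?_
    have h2 := hkill (β ∘ₗ e) (by rw [LinearMap.comp_assoc]; exact hβ)
    -- With `α₀ = 0` the criterion says that `res e` is injective.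
    rw [hrel, res_eq_zero_iff (α₀ := 0) he.1 (by
      rw [LinearMap.range_eq_top.mpr he.2, LinearMap.ker_zero]), lin_zero, zero_dvd_iff] at h2
    exact h2
  · intro η hη
    obtain ⟨ξ, hξ, hξ0, hξη⟩ := hBY η hη
    obtain ⟨ω, hω⟩ := exists_rel_of_bijective he ξ
    have hωS : ω ∈ (B.pull e).derModule := mem_derModule_pull hξ hω
      (killsConormal_of_range_eq_top (LinearMap.range_eq_top.mpr he.2) ξ)
    -- Since `ω` kills `α_Y`, multiplicity at least two forces `α_Y ^ 2 ∣ c α_Y`. So `α_Y ∣ c`, and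
    -- the correction is invisible on `Y`.
    obtain ⟨c, hc⟩ := hN ω hωS
    refine ⟨_, mem_derModule_of_mult_le hMN hc, hrel0 c ?_ (hω.of_comp he.1 hξη)⟩
    obtain ⟨β, hβ⟩ := exists_comp_eq he.1 (form Y)
    have h2 : ω (lin (form Y)) = 0 := by
      rw [← hβ, hω, hξ0 β, map_zero]
      rw [← LinearMap.comp_assoc, hβ]
      ext y
      have : (y : W) ∈ LinearMap.ker (form Y) := (ker_form hHyp).ge y.2
      exact this
    have h3 := hsq hMN _ hc
    rw [Derivation.sub_apply, h2, zero_sub, dvd_neg, Derivation.smul_apply, eulerDer_lin,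
      smul_eq_mul, sq] at h3
    exact (mul_dvd_mul_iff_right h0).mp h3

/-- The natural multiarrangement of `𝒜` on the hyperplane `H` that was added last. -/
theorem isInductivelyFreeMulti_pull_of_range_eq [FiniteDimensional K V] {A : Arrangement K V}
    {H : Submodule K V} (hH : H ∈ A.hyps) {E' E'' : Multiset ℕ}
    (hE' : HasExponents (A.deletion H).derModule E')
    (hE'' : HasExponents (A.restriction H).derModule E'') (hE : E'' ≤ E')
    (hres : IsHereditarilyFree (A.restriction H)) {e : W →ₗ[K] H} (he : Function.Bijective e) :
    IsInductivelyFreeMulti K W (A.pull (H.subtype ∘ₗ e)) := by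
  classical
  have : FiniteDimensional K W := FiniteDimensional.of_injective e he.1
  have her : LinearMap.range e = ⊤ := LinearMap.range_eq_top.mpr he.2
  have hσ := hres W e he.1 (Or.inl her)
  have hsupp := support_restriction_pull A H e
  set κ := A.pull (H.subtype ∘ₗ e) with hκ
  set σ := (A.restriction H).pull e with hσdef
  have hσκ : ∀ Y, σ.mult Y ≤ κ.mult Y := fun Y => by
    by_cases hY : Y ∈ σ.mult.support
    · rw [pull_mult_eq_one_of_bijective he hY]
      rw [hsupp] at hY
      exact Nat.one_le_iff_ne_zero.mpr (Finsupp.mem_support_iff.mp hY)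
    · rw [Finsupp.notMem_support_iff.mp hY]; exact Nat.zero_le _
  -- The claim is proved for every multiplicity between `σ` and `κ`, by induction on its total. The
  -- chain ends at `σ`, which the hypothesis on `𝒜''` covers.
  suffices key : ∀ n, ∀ M : Multiarrangement K W, (∀ Y, σ.mult Y ≤ M.mult Y) →
      (∀ Y, M.mult Y ≤ κ.mult Y) → ∑ Y ∈ M.mult.support, M.mult Y = n →
      IsInductivelyFreeMulti K W M from key _ κ hσκ (fun _ => le_rfl) rfl
  intro n
  induction n with
  | zero =>
    intro M hσM _ hn
    convert hσ using 1
    ext Y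
    refine le_antisymm ?_ (hσM Y)
    by_cases hY : Y ∈ M.mult.support
    · exact (Finset.sum_eq_zero_iff.mp hn Y hY).le.trans (Nat.zero_le _)
    · rw [Finsupp.notMem_support_iff.mp hY]; exact Nat.zero_le _
  | succ n ih =>
    intro M hσM hMκ hn
    by_cases hM : M = σ
    · rw [hM]; exact hσ
    obtain ⟨Y, hY⟩ : ∃ Y, σ.mult Y < M.mult Y := by
      by_contra! hcon
      exact hM (Multiarrangement.ext (Finsupp.ext fun Y => le_antisymm (hcon Y) (hσM Y)))
    have hYκ : Y ∈ σ.mult.support := by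
      rw [hsupp, Finsupp.mem_support_iff]
      have := hMκ Y
      omega
    have hYM : Y ∈ M.mult.support := Finsupp.mem_support_iff.mpr (by omega)
    have hY2 : 2 ≤ M.mult Y := by
      rw [pull_mult_eq_one_of_bijective he hYκ] at hY; exact hY
    have hsuppM : M.mult.support = σ.mult.support := by
      refine Finset.Subset.antisymm (fun Z hZ => ?_) fun Z hZ => ?_
      · rw [hsupp]
        rw [Finsupp.mem_support_iff] at hZ ⊢
        have := hMκ Z; omega
      · rw [Finsupp.mem_support_iff] at hZ ⊢
        have := hσM Z; omega
    have hσM' : ∀ Z, σ.mult Z ≤ (M.deletion Y).mult Z := fun Z => by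
      by_cases hZ : Z = Y
      · rw [hZ, Multiarrangement.deletion_mult_self]; omega
      · rw [Multiarrangement.deletion_mult_of_ne _ hZ]; exact hσM Z
    have hM'κ : ∀ Z, (M.deletion Y).mult Z ≤ κ.mult Z := fun Z => by
      refine le_trans ?_ (hMκ Z)
      by_cases hZ : Z = Y
      · rw [hZ, Multiarrangement.deletion_mult_self]; omega
      · rw [Multiarrangement.deletion_mult_of_ne _ hZ]
    obtain ⟨-, H₁, hH₁, hHY⟩ := Arrangement.mem_support_pull.mp hYκ
    obtain ⟨ι, _, _, η, d, j, hcard, hη, hηj, hdj, hηκ, hexp⟩ :=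
      exists_ziegler_basis hH hE' hE'' hE ⟨H₁, hH₁⟩ he
    have hf : Function.Injective (e ∘ₗ Y.subtype) := he.1.comp Y.injective_subtype
    have hr : LinearMap.range (e ∘ₗ Y.subtype) = H₁ := by
      rw [LinearMap.range_comp, Submodule.range_subtype, ← hHY, Submodule.map_comap_eq, her,
        top_inf_eq]
    obtain ⟨hexpN, hliftN⟩ := exps_pull_of_range_mem hexp hf hH₁ hr
    obtain ⟨-, hlift⟩ := exps_pull_of_range_eq_top hexp he.1 her
    obtain ⟨θ, p, hθ⟩ := hη.update_euler hηj
      (fun i hi => mem_derModule_of_mult_le hM'κ (hηκ i hi)) hσM'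
    refine IsInductivelyFreeMulti.add W M Y hYM _
      (isEulerRestriction_pull he hlift ?_ hσM hMκ hsuppM hY2 hliftN)
      (ih _ hσM' hM'κ ?_) (hres Y _ hf (Or.inr (hr ▸ hH₁))) _ _ (hθ.hasExponents hcard) hexpN ?_
    · intro ω hω
      obtain ⟨c, rfl⟩ := hη.exists_sum hω
      refine ⟨c j, ?_⟩
      rw [Fintype.sum_eq_add_sum_subtype_ne _ j, hηj, add_sub_cancel_left]
      exact Submodule.sum_mem _ fun i _ => Submodule.smul_mem _ _ (hηκ i i.2)
    · have := Multiarrangement.degree_deletion hYM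
      omega
    -- The exponents of the Euler restriction are the degrees `d i` with `i ≠ j`; the deletion has
    -- these and the degree of the multiple of the Euler derivation.
    · rw [map_univ_val_eq_cons d j, hdj, Multiset.erase_cons_head, map_univ_val_eq_cons _ j]
      refine le_trans (le_of_eq ?_) (Multiset.le_cons_self _ _)
      exact Multiset.map_congr rfl fun i _ => (Function.update_of_ne i.2 _ _).symm

end Chain

end HypArr

end

noncomputable section

namespace HypArr

/-! ### Hereditary freeness of inductively free arrangements -/

section Main

variable {K : Type u} [Field K] {V : Type v} [AddCommGroup V] [Module K V]

theorem exists_lift_restriction [FiniteDimensional K V] {A : Arrangement K V} {H : Submodule K V}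
    (hH : H ∈ A.hyps) {E' E'' : Multiset ℕ} (hE' : HasExponents (A.deletion H).derModule E')
    (hE'' : HasExponents (A.restriction H).derModule E'') (hE : E'' ≤ E') :
    (∃ E, HasExponents A.derModule E) ∧
      ∀ ξ ∈ (A.restriction H).derModule, ∃ ζ ∈ A.derModule, Rel H.subtype ζ ξ := by
  obtain ⟨θ, d, j, η, hθ, hrel, hη⟩ := addition hH hE' hE'' hE
  exact ⟨⟨_, hθ.hasExponents (Fintype.card_fin _)⟩, fun ξ hξ =>
    exists_lift_of_basis H.injective_subtype hη (fun i => hθ.mem i) hrel hξ⟩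

/-- If the image of `f` is `H`, multiplicities are raised from those of `𝒜''`; otherwise only the
hyperplane `f⁻¹(H)` is added. -/
theorem isHereditarilyFree_of_deletion [FiniteDimensional K V] {A : Arrangement K V}
    {H : Submodule K V} (hH : H ∈ A.hyps) {E' E'' : Multiset ℕ}
    (hE' : HasExponents (A.deletion H).derModule E')
    (hE'' : HasExponents (A.restriction H).derModule E'') (hE : E'' ≤ E')
    (hdel : IsHereditarilyFree (A.deletion H)) (hres : IsHereditarilyFree (A.restriction H)) :
    IsHereditarilyFree A := by
  intro W _ _ f hf hr
  have : FiniteDimensional K W := FiniteDimensional.of_injective f hf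
  have hHyp := A.isHyperplane H hH
  by_cases hfH : LinearMap.range f = H
  · let e : W →ₗ[K] H := f.codRestrict H fun w => hfH ▸ LinearMap.mem_range_self f w
    have he : Function.Bijective e := by
      refine ⟨fun x y h => hf (congrArg Subtype.val h), fun y => ?_⟩
      obtain ⟨w, hw⟩ := hfH.ge y.2
      exact ⟨w, Subtype.ext hw⟩
    have h := isInductivelyFreeMulti_pull_of_range_eq hH hE' hE'' hE hres he
    rwa [LinearMap.subtype_comp_codRestrict] at h
  obtain ⟨⟨E, hA⟩, hlift⟩ := exists_lift_restriction hH hE' hE'' hE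
  have hT : H.comap f ≠ ⊤ := by
    rw [Ne, comap_eq_top_iff_of_range_eq rfl]
    intro hle
    rcases hr with hr | hr
    · exact hHyp.ne_top (top_le_iff.mp (hr ▸ hle))
    · exact hfH ((A.isHyperplane _ hr).eq_of_le hHyp hle)
  let g : H.comap f →ₗ[K] H := (f ∘ₗ (H.comap f).subtype).codRestrict H fun x => x.2
  have hg : H.subtype ∘ₗ g = f ∘ₗ (H.comap f).subtype := rfl
  have hgi : Function.Injective g := fun x y h => Subtype.ext (hf (congrArg Subtype.val h))
  have hgr : LinearMap.range g = (LinearMap.range f).comap H.subtype := by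
    ext y
    constructor
    · rintro ⟨x, rfl⟩
      exact ⟨x, rfl⟩
    · rintro ⟨w, hw⟩
      exact ⟨⟨w, show f w ∈ H from hw ▸ y.2⟩, Subtype.ext hw⟩
  rcases hr with hr | hr
  · rw [hr, Submodule.comap_top] at hgr
    obtain ⟨-, hAl⟩ := exps_pull_of_range_eq_top hA hf hr
    obtain ⟨hX', -⟩ := exps_pull_of_range_eq_top hE' hf hr
    obtain ⟨hX'', hl''⟩ := exps_pull_of_range_eq_top hE'' hgi hgr
    refine isInductivelyFreeMulti_pull_of_deletion hH hf hT hg hAl hl'' (fun β hβ => ?_)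
      (fun ξ hξ _ => ?_) (hdel W f hf (Or.inl hr)) (hres _ g hgi (Or.inl hgr)) hX' hX'' hE
    · exact ⟨0, LinearMap.zero_comp _, by
        rw [eq_zero_of_comp_eq_zero hgr hβ, LinearMap.zero_comp]⟩
    · obtain ⟨ζ, hζ, hrel⟩ := hlift ξ hξ
      exact ⟨ζ, hζ, killsConormal_of_range_eq_top hr ζ, hrel⟩
  · have hHyp₀ := A.isHyperplane _ hr
    have hnle : ¬ H ≤ LinearMap.range f := fun h => hfH (hHyp.eq_of_le hHyp₀ h).symm
    have hr' : LinearMap.range f ∈ (A.deletion H).hyps := mem_deletion.mpr ⟨hfH, hr⟩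
    have hr'' : LinearMap.range g ∈ (A.restriction H).hyps :=
      mem_restriction.mpr ⟨_, hr, hnle, hgr.symm⟩
    obtain ⟨-, hAl⟩ := exps_pull_of_range_mem hA hf hr rfl
    obtain ⟨hX', -⟩ := exps_pull_of_range_mem hE' hf hr' rfl
    obtain ⟨hX'', hl''⟩ := exps_pull_of_range_mem hE'' hgi hr'' rfl
    have hker := ker_form hHyp₀
    have hker' : LinearMap.ker (form (LinearMap.range f) ∘ₗ H.subtype) = LinearMap.range g := by
      rw [LinearMap.ker_comp, hker, hgr]
    refine isInductivelyFreeMulti_pull_of_deletion hH hf hT hg hAl hl'' (fun β hβ => ?_)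
      (fun ξ hξ hξ0 => ?_) (hdel W f hf (Or.inr hr')) (hres _ g hgi (Or.inr hr'')) hX' hX''
      (Multiset.erase_le_erase 1 hE)
    · obtain ⟨c, rfl⟩ := exists_smul_of_ker_le
        (hker'.le.trans (range_le_ker_of_comp_eq_zero hβ))
      refine ⟨c • form (LinearMap.range f), ?_, LinearMap.smul_comp _ _ _⟩
      ext w
      have : f w ∈ LinearMap.ker (form (LinearMap.range f)) :=
        hker.ge (LinearMap.mem_range_self f w)
      simp [LinearMap.mem_ker.mp this]
    · obtain ⟨ζ, hζ, hrel⟩ := hlift ξ hξ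
      -- The lift need not kill the form of the image of `f`, so a multiple `s` of the Euler
      -- derivation is subtracted. Since `ξ` kills the restricted form, which is nonzero, `s`
      -- vanishes on `H` and the correction does not change `ξ`.
      obtain ⟨s, hs, hs0, hζs⟩ := exists_sub_smul_eulerDer hr hζ
      refine ⟨_, hs, killsConormal_of_apply_eq_zero hker.symm hs0, ?_⟩
      have h1 := hξ0 (form (LinearMap.range f) ∘ₗ H.subtype) (by
        ext x
        have : g x ∈ LinearMap.ker (form (LinearMap.range f) ∘ₗ H.subtype) :=
          hker'.ge (LinearMap.mem_range_self g x)
        exact this)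
      rw [hrel, hζs, map_mul, res_lin, mul_eq_zero] at h1
      have h2 : res H.subtype s = 0 := h1.resolve_right (lin_ne_zero fun h0 => hnle (by
        have := range_le_ker_of_comp_eq_zero h0
        rwa [Submodule.range_subtype, hker] at this))
      have h3 := hrel.sub ((rel_eulerDer H.subtype).smul s)
      rwa [h2, zero_smul, sub_zero] at h3

theorem isHereditarilyFree_empty [FiniteDimensional K V] :
    IsHereditarilyFree (Arrangement.empty K V) := by
  intro W _ _ f hf _
  have : FiniteDimensional K W := FiniteDimensional.of_injective f hf
  have h : (Arrangement.empty K V).pull f = Multiarrangement.empty K W := by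
    ext Y
    rw [Arrangement.pull_mult]
    simp [Arrangement.empty, Multiarrangement.empty]
  rw [h]
  exact IsInductivelyFreeMulti.empty W

theorem IsInductivelyFree.isHereditarilyFree {A : Arrangement K V}
    (hA : IsInductivelyFree K V A) : IsHereditarilyFree A := by
  induction hA with
  | empty V => exact isHereditarilyFree_empty
  | add V A H hH _ _ E' E'' hE' hE'' hE ihdel ihres =>
    exact isHereditarilyFree_of_deletion hH hE' hE'' hE ihdel ihres

end Main

end HypArr

end

theorem theorem1p3 {K : Type u} [Field K] {V : Type v} [AddCommGroup V] [Module K V]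
    [FiniteDimensional K V] (A : HypArr.Arrangement K V)
    (hA : HypArr.IsInductivelyFree K V A) (H₀ : Submodule K V) (hH₀ : H₀ ∈ A.hyps) :
    HypArr.IsInductivelyFreeMulti K H₀ (A.zieglerRestriction H₀) := by
  rw [HypArr.zieglerRestriction_eq_pull hH₀]
  exact hA.isHereditarilyFree H₀ H₀.subtype H₀.injective_subtype
    (Or.inr (H₀.range_subtype.symm ▸ hH₀))
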